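/- For $k\ge 2$, a $k$-graph $\mathcal H=(V,E)$ consists of a finite vertex set $V$ and an edge set $E\subseteq\binom Vk$. For a $d$-set $S\subseteq V$ let $\deg_{\mathcal H}(S)$ be the number of edges containing $S$, and let $\delta_d(\mathcal H)$ be the minimum of $\deg_{\mathcal H}(S)$ over all $d$-sets $S\subseteq V$. For a partition $V=A\,\dot\cup\,B$ with $|V|=n$, let $\mathcal B_{n,k}(A,B)$ (respectively $\overline{\mathcal B}_{n,k}(A,B)$) be the $k$-graph on $V$ whose edges are all $k$-subsets of $V$ that meet $A$ in an odd (respectively even) number of vertices. A $k$-graph $\mathcal H$ on $n$ vertices is $\epsilon$-close to a $k$-graph $\mathcal H'$ on $n$ vertices if $\mathcal H$ can be made a copy of $\mathcal H'$ by adding and deleting in total at most $\epsilon n^k$ edges. A Hamilton $\ell$-cycle in $\mathcal H$ is a spanning subhypergraph for which there is a cyclic ordering of $V$ such that each of its edges consists of $k$ consecutive vertices and every two consecutive edges share exactly $\ell$ vertices (so it has $n/(k-\ell)$ edges, each starting $k-\ell$ positions after the previous one). **Theorem (Nonextremal Case).** For any even integer $k\ge 4$, any integer $d$ with $k/2\le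 d\le k-1$, and any $\epsilon>0$, there exist $\gamma>0$ and $n_0\in\mathbb N$ such that the following holds for every $k$-graph $\mathcal H=(V,E)$ on $n\ge n_0$ vertices with $n\in\frac k2\mathbb N$. Suppose that for every partition $V=A\,\dot\cup\,B$ with $|A|=\lfloor n/2\rfloor$, $\mathcal H$ is $\epsilon$-close neither to $\mathcal B_{n,k}(A,B)$ nor to $\overline{\mathcal B}_{n,k}(A,B)$, and that $$\delta_d(\mathcal H)\ge\Bigl(\frac12-\gamma\Bigr)\binom{n-d}{k-d}.$$ Then $\mathcal H$ contains a Hamilton $(k/2)$-cycle. -/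

import Mathlib

/-- A `k`-uniform hypergraph with vertex set `V`. -/
structure KGraph (V : Type*) (k : ℕ) where
  edges : Finset (Finset V)
  uniform : ∀ e ∈ edges, e.card = k

namespace KGraph

/-- `deg_H(S)`: the number of edges containing `S`. -/
def degree {V : Type*} [DecidableEq V] {k : ℕ} (H : KGraph V k) (S : Finset V) : ℕ :=
  (H.edges.filter (fun e => S ⊆ e)).card

/-- `δ_d(H)`: the minimum of `deg_H(S)` over all `d`-element vertex sets `S`. -/
noncomputable def minDegree {V : Type*} [DecidableEq V] {k : ℕ} (H : KGraph V k) (d : ℕ) : ℕ :=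
  sInf (H.degree '' {S : Finset V | S.card = d})

/-- `𝓑_{n,k}(A, B)` with `B = V \ A`: the edges are all `k`-sets meeting `A` in an odd number
of vertices. -/
def oddGraph {V : Type*} [Fintype V] [DecidableEq V] (k : ℕ) (A : Finset V) : KGraph V k where
  edges := (Finset.univ.powersetCard k).filter (fun e => Odd (e ∩ A).card)
  uniform := fun _ he => (Finset.mem_powersetCard.mp (Finset.mem_filter.mp he).1).2

/-- The complementary `k`-graph on `(A, B)` with `B = V \ A`: the edges are all `k`-sets meeting
`A` in an even number of vertices. -/
def evenGraph {V : Type*} [Fintype V] [DecidableEq V] (k : ℕ) (A : Finset V) : KGraph V k where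
  edges := (Finset.univ.powersetCard k).filter (fun e => Even (e ∩ A).card)
  uniform := fun _ he => (Finset.mem_powersetCard.mp (Finset.mem_filter.mp he).1).2

/-- `G` is a copy of `H'`: there is a bijection of the vertex sets preserving edges and
non-edges. -/
def IsCopy {V W : Type*} {k : ℕ} (G : KGraph V k) (H' : KGraph W k) : Prop :=
  ∃ φ : V ≃ W, ∀ e : Finset V, e ∈ G.edges ↔ e.map φ.toEmbedding ∈ H'.edges

/-- `H` is `ε`-close to `H'`: adding and deleting in total at most `ε n ^ k` edges turns `H`
into a copy of `H'`. -/
def IsClose {V W : Type*} [Fintype V] [DecidableEq V] {k : ℕ} (ε : ℝ)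
    (H : KGraph V k) (H' : KGraph W k) : Prop :=
  ∃ G : KGraph V k, G.IsCopy H' ∧
    ((symmDiff H.edges G.edges).card : ℝ) ≤ ε * (Fintype.card V : ℝ) ^ k

/-- The `k` consecutive vertices starting at position `i` of a cyclic ordering `f`. -/
def window {V : Type*} [DecidableEq V] {n : ℕ} (f : ZMod n ≃ V) (k i : ℕ) : Finset V :=
  (Finset.range k).image (fun j => f ((i + j : ℕ) : ZMod n))

/-- `C` is an `ℓ`-cycle on the whole vertex set `V`: in some cyclic ordering of `V`, the edges are
`m` windows of `k` consecutive vertices, each shifted by `k - ℓ` from the previous one and going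
exactly once around (`m (k - ℓ) = n`), and any two consecutive ones (cyclically, the first one
following the last) share exactly `ℓ` vertices. -/
def IsCycle {V : Type*} [Fintype V] [DecidableEq V] {k : ℕ} (C : KGraph V k) (ℓ : ℕ) : Prop :=
  ∃ (f : ZMod (Fintype.card V) ≃ V) (m : ℕ),
    m * (k - ℓ) = Fintype.card V ∧
    C.edges = (Finset.range m).image (fun i => window f k (i * (k - ℓ))) ∧
    ∀ i < m, (window f k (i * (k - ℓ)) ∩ window f k ((i + 1) * (k - ℓ))).card = ℓ

/-- `H` contains a Hamilton `ℓ`-cycle, i.e. an `ℓ`-cycle as a spanning subhypergraph. -/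
def HasHamiltonCycle {V : Type*} [Fintype V] [DecidableEq V] {k : ℕ} (H : KGraph V k)
    (ℓ : ℕ) : Prop :=
  ∃ C : KGraph V k, C.IsCycle ℓ ∧ C.edges ⊆ H.edges

/-- The partition `V = A ∪ (V \ A)` is balanced: `|A| ≤ |V \ A| ≤ |A| + 1`, so the two parts are
of equal size if `|V|` is even, and `|A| = ⌊|V| / 2⌋` in general. -/
def IsBalanced {V : Type*} [Fintype V] [DecidableEq V] (A : Finset V) : Prop :=
  A.card ≤ Aᶜ.card ∧ Aᶜ.card ≤ A.card + 1

end KGraph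

section Development

open Finset Function
open scoped Classical

/-- The proportion of the elements of a finite type that satisfy `p`. -/
noncomputable def freq {α : Type*} [Fintype α] (p : α → Prop) : ℝ :=
  (#{x | p x} : ℝ) / Fintype.card α

section Dens
variable {α β : Type*} [Fintype α] [Fintype β]

theorem freq_nonneg (p : α → Prop) : 0 ≤ freq p := by
  unfold freq; positivity

theorem freq_mono {p q : α → Prop} (h : ∀ x, p x → q x) : freq p ≤ freq q := by
  unfold freq
  gcongr
  exact h _

theorem freq_congr {p q : α → Prop} (h : ∀ x, p x ↔ q x) : freq p = freq q :=
  le_antisymm (freq_mono fun x => (h x).1) (freq_mono fun x => (h x).2)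

theorem freq_le_one (p : α → Prop) : freq p ≤ 1 := by
  unfold freq
  apply div_le_one_of_le₀ _ (by positivity)
  exact_mod_cast card_le_univ _

theorem freq_le_add {p q r : α → Prop} (h : ∀ x, p x → q x ∨ r x) :
    freq p ≤ freq q + freq r := by
  unfold freq
  rw [← add_div]
  gcongr
  have : (#{x | p x} : ℕ) ≤ #{x | q x} + #{x | r x} := by
    refine le_trans (card_le_card ?_) (card_union_le _ _)
    intro x hx
    simpa using h x (by simpa using hx)
  exact_mod_cast this

theorem freq_exists_le {ι : Type*} [Fintype ι] (p : ι → α → Prop) :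
    freq (fun x => ∃ i, p i x) ≤ ∑ i, freq (p i) := by
  unfold freq
  rw [← Finset.sum_div]
  gcongr
  have key : ∀ q : α → Prop, (∀ x, q x → ∃ i, p i x) → #{x | q x} ≤ ∑ i, #{x | p i x} := by
    intro q hq
    refine le_trans (card_le_card ?_) (card_biUnion_le (s := univ) (t := fun i => {x | p i x}))
    intro x hx
    simpa using hq x (by simpa using hx)
  exact_mod_cast key _ fun x hx => hx

theorem freq_not [Nonempty α] (p : α → Prop) : freq (fun x => ¬ p x) = 1 - freq p := by
  unfold freq
  have key : ∀ q : α → Prop, (∀ x, q x ↔ ¬ p x) → #{x | p x} + #{x | q x} = #(univ : Finset α) := by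
    intro q hq
    rw [← card_filter_add_card_filter_not (s := (univ : Finset α)) p]
    congr 2
    ext x; simp [hq]
  have h := key (fun x => ¬ p x) fun _ => Iff.rfl
  have hc : (Fintype.card α : ℝ) ≠ 0 := by exact_mod_cast Fintype.card_ne_zero
  rw [eq_sub_iff_add_eq, ← add_div, div_eq_one_iff_eq hc]
  rw [card_univ] at h
  rw [add_comm]; exact_mod_cast h

theorem freq_equiv (e : α ≃ β) (p : β → Prop) : freq (fun x => p (e x)) = freq p := by
  unfold freq
  rw [Fintype.card_congr e]
  congr 2
  exact card_equiv e (by simp)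

theorem freq_prod (p : α × β → Prop) :
    freq p = (∑ x, freq fun y => p (x, y)) / Fintype.card α := by
  unfold freq
  rw [← Finset.sum_div, div_div, Fintype.card_prod]
  push_cast
  rw [mul_comm]
  congr 1
  have : #{x | p x} = ∑ x, #{y | p (x, y)} := by
    simp only [card_filter]
    rw [Fintype.sum_prod_type]
  exact_mod_cast this

theorem freq_and_prod (p : α → Prop) (q : β → Prop) :
    freq (fun z : α × β => p z.1 ∧ q z.2) = freq p * freq q := by
  unfold freq
  rw [div_mul_div_comm, Fintype.card_prod]
  push_cast
  congr 1
  rw [← Nat.cast_mul, ← card_product]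
  congr 2
  ext ⟨x, y⟩; simp

theorem freq_true [Nonempty α] : freq (fun _ : α => True) = 1 := by
  unfold freq
  simp

theorem freq_false : freq (fun _ : α => False) = 0 := by
  unfold freq
  simp

theorem freq_fst [Nonempty β] (p : α → Prop) : freq (fun z : α × β => p z.1) = freq p := by
  have := freq_and_prod p (fun _ : β => True)
  simpa [freq_true] using this

theorem freq_snd [Nonempty α] (p : β → Prop) : freq (fun z : α × β => p z.2) = freq p := by
  have := freq_and_prod (fun _ : α => True) p
  simpa [freq_true] using this

theorem freq_swap (p : α × β → Prop) : freq (fun z : β × α => p (z.2, z.1)) = freq p :=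
  freq_equiv (Equiv.prodComm β α) p

theorem exists_freq_fiber_le [Nonempty α] (p : α × β → Prop) :
    ∃ x, freq (fun y => p (x, y)) ≤ freq p := by
  by_contra! hcon
  have h1 := freq_prod p
  have hc : (0 : ℝ) < Fintype.card α := by exact_mod_cast Fintype.card_pos
  rw [eq_div_iff hc.ne'] at h1
  have h2 : ∑ _x : α, freq p < ∑ x, freq fun y => p (x, y) :=
    sum_lt_sum_of_nonempty univ_nonempty fun x _ => hcon x
  simp at h2
  linarith

/-- Markov's inequality for fibres. -/
theorem freq_fiber_gt_mul_le (p : α × β → Prop) (c : ℝ) :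
    freq (fun x => c < freq fun y => p (x, y)) * c ≤ freq p := by
  rw [freq_prod p]
  unfold freq
  rw [div_mul_eq_mul_div]
  gcongr
  rw [← nsmul_eq_mul, ← sum_const, sum_filter]
  refine sum_le_sum fun x _ => ?_
  split_ifs with hx
  · exact hx.le
  · exact freq_nonneg _

theorem exists_of_freq_pos {p : α → Prop} (h : 0 < freq p) : ∃ x, p x := by
  by_contra! hcon
  have : freq p ≤ 0 := by
    rw [← freq_false (α := α)]; exact freq_mono fun x hx => hcon x hx
  linarith

theorem exists_not_of_freq_lt_one [Nonempty α] {p : α → Prop} (h : freq p < 1) : ∃ x, ¬ p x := by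
  apply exists_of_freq_pos
  rw [freq_not]; linarith

theorem freq_pi {ι : Type*} [Fintype ι] [DecidableEq ι] (p : α → Prop) :
    freq (fun s : ι → α => ∀ i, p (s i)) = freq p ^ Fintype.card ι := by
  unfold freq
  rw [div_pow, Fintype.card_fun]
  push_cast
  congr 1
  rw [← Nat.cast_pow]
  congr 1
  rw [← card_univ (α := ι), ← prod_const, ← Fintype.card_piFinset]
  congr 1
  ext s; simp

theorem freq_eq_sum (p : α → Prop) :
    freq p = (∑ x, if p x then (1 : ℝ) else 0) / Fintype.card α := by
  unfold freq
  simp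

end Dens

section Additive
variable {V : Type*}

/-- Exchange the `i`-th entry of the first tuple with the `j`-th entry of the second one. -/
def exchange {h : ℕ} (i j : Fin h) (z : (Fin h → V) × (Fin h → V)) :
    (Fin h → V) × (Fin h → V) :=
  (update z.1 i (z.2 j), update z.2 j (z.1 i))

theorem exchange_involutive {h : ℕ} (i j : Fin h) :
    Involutive (exchange (V := V) i j) := by
  rintro ⟨s, t⟩
  simp [exchange]

variable [Fintype V]

theorem freq_exchange {h : ℕ} (i j : Fin h) (p : (Fin h → V) × (Fin h → V) → Prop) :
    freq (fun z => p (exchange i j z)) = freq p :=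
  freq_equiv (exchange_involutive i j).toPerm p

/-- A function of `h` independent variables that is mostly unchanged when one variable is
resampled is mostly constant. -/
theorem freq_ne_le_sum_freq_update {M : Type*} {h : ℕ} (Ψ : (Fin h → V) → M) :
    freq (fun z : (Fin h → V) × (Fin h → V) => Ψ z.1 ≠ Ψ z.2) ≤
      ∑ i, freq (fun z : (Fin h → V) × (Fin h → V) => Ψ z.1 ≠ Ψ (update z.1 i (z.2 i))) := by
  let D : ℕ → ℝ := fun i => if hi : i < h then
    freq (fun z : (Fin h → V) × (Fin h → V) => Ψ z.1 ≠ Ψ (update z.1 ⟨i, hi⟩ (z.2 ⟨i, hi⟩))) else 0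
  let g : ℕ → (Fin h → V) → (Fin h → V) → (Fin h → V) :=
    fun j s t l => if l.val < j then t l else s l
  have key : ∀ j ≤ h, freq (fun z : (Fin h → V) × (Fin h → V) => Ψ z.1 ≠ Ψ (g j z.1 z.2)) ≤
      ∑ i ∈ range j, D i := by
    intro j hj
    induction j with
    | zero => simp [g, freq_false]
    | succ j ih =>
      rw [sum_range_succ]
      have hinv : Involutive
          (fun z : (Fin h → V) × (Fin h → V) => (g j z.1 z.2, g j z.2 z.1)) := by
        rintro ⟨s, t⟩
        ext l <;> simp only [g] <;> split_ifs <;> rfl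
      have h2 : D j = freq (fun z : (Fin h → V) × (Fin h → V) =>
          Ψ (g j z.1 z.2) ≠ Ψ (g (j + 1) z.1 z.2)) := by
        have hlt : j < h := hj
        simp only [D, hlt, dif_pos]
        rw [← freq_equiv hinv.toPerm]
        refine freq_congr fun z => ?_
        have : update (g j z.1 z.2) ⟨j, hlt⟩ (g j z.2 z.1 ⟨j, hlt⟩) = g (j + 1) z.1 z.2 := by
          ext l
          by_cases hl : l = ⟨j, hlt⟩
          · subst hl; simp [g]
          · have : l.val ≠ j := fun h => hl (Fin.ext h)
            rw [update_of_ne hl]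
            simp only [g]
            have : l.val < j + 1 ↔ l.val < j := by omega
            simp [this]
        simp [this]
      rw [h2]
      have h3 := ih (by omega)
      suffices hs : freq (fun z : (Fin h → V) × (Fin h → V) => Ψ z.1 ≠ Ψ (g (j + 1) z.1 z.2)) ≤
          freq (fun z : (Fin h → V) × (Fin h → V) => Ψ z.1 ≠ Ψ (g j z.1 z.2)) +
          freq (fun z : (Fin h → V) × (Fin h → V) => Ψ (g j z.1 z.2) ≠ Ψ (g (j + 1) z.1 z.2)) by
        exact hs.trans (add_le_add_left h3 _)
      apply freq_le_add
      intro z hz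
      by_cases h0 : Ψ z.1 = Ψ (g j z.1 z.2)
      · right
        rw [← h0]
        exact hz
      · exact Or.inl h0
  have := key h le_rfl
  refine le_trans (le_of_eq ?_) (this.trans (le_of_eq ?_))
  · refine freq_congr fun z => ?_
    simp [g]
  · rw [← Fin.sum_univ_eq_sum_range D]
    simp [D]

/-- If the sum of the values of `χ` at two tuples is mostly preserved when entries are exchanged
between them, then `χ` is mostly an affine function of the entries. -/
theorem exists_additive_approx [Nonempty V] {M : Type*} [AddCommGroup M] {h : ℕ}
    (χ : (Fin h → V) → M) (i₀ : Fin h) (ξ : ℝ)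
    (H : ∀ i, freq (fun z : (Fin h → V) × (Fin h → V) =>
      χ z.1 + χ z.2 ≠ χ (exchange i i₀ z).1 + χ (exchange i i₀ z).2) ≤ ξ) :
    ∃ (b : Fin h → V) (C : M),
      freq (fun s => χ s ≠ C + ∑ j, χ (update b i₀ (s j))) ≤ h ^ 2 * ξ := by
  let T := Fin h → V
  have h1 : ∀ i, freq (fun z : T × (T × T) =>
      χ z.2.1 + χ (update z.1 i₀ (z.2.2 i)) ≠
        χ (update z.2.1 i (z.2.2 i)) + χ (update z.1 i₀ (z.2.1 i))) ≤ ξ := by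
    intro i
    have hinv : Involutive (fun z : T × (T × T) =>
        ((update z.1 i₀ (z.2.2 i), (z.2.1, update z.2.2 i (z.1 i₀))) : T × (T × T))) := by
      rintro ⟨b, s, t⟩
      simp
    refine le_trans (le_of_eq ?_) (H i)
    rw [← freq_fst (β := T) (fun z : T × T =>
      χ z.1 + χ z.2 ≠ χ (exchange i i₀ z).1 + χ (exchange i i₀ z).2)]
    let e : T × (T × T) ≃ (T × T) × T := hinv.toPerm.trans
      { toFun := fun z => ((z.2.1, z.1), z.2.2)
        invFun := fun z => (z.1.2, (z.1.1, z.2))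
        left_inv := fun _ => rfl
        right_inv := fun _ => rfl }
    rw [← freq_equiv e]
    refine freq_congr fun z => ?_
    simp [e, exchange]
  have h2 : freq (fun z : T × (T × T) => ∃ i, χ z.2.1 + χ (update z.1 i₀ (z.2.2 i)) ≠
        χ (update z.2.1 i (z.2.2 i)) + χ (update z.1 i₀ (z.2.1 i))) ≤ h * ξ := by
    refine (freq_exists_le _).trans ((sum_le_sum fun i _ => h1 i).trans ?_)
    simp
  obtain ⟨b, hb⟩ := exists_freq_fiber_le (fun z : T × (T × T) =>
    ∃ i, χ z.2.1 + χ (update z.1 i₀ (z.2.2 i)) ≠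
        χ (update z.2.1 i (z.2.2 i)) + χ (update z.1 i₀ (z.2.1 i)))
  replace hb := hb.trans h2
  let Ψ : T → M := fun s => χ s - ∑ j, χ (update b i₀ (s j))
  have h3 : freq (fun z : T × T => Ψ z.1 ≠ Ψ z.2) ≤ h * (h * ξ) := by
    refine (freq_ne_le_sum_freq_update Ψ).trans ?_
    have : ∀ i ∈ (univ : Finset (Fin h)),
        freq (fun z : T × T => Ψ z.1 ≠ Ψ (update z.1 i (z.2 i))) ≤ h * ξ := by
      intro i _
      refine le_trans (freq_mono ?_) hb
      rintro ⟨s, t⟩ hz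
      refine ⟨i, fun hcon => hz ?_⟩
      have hsum : ∑ j, χ (update b i₀ (update s i (t i) j)) - ∑ j, χ (update b i₀ (s j)) =
          χ (update b i₀ (t i)) - χ (update b i₀ (s i)) := by
        rw [← sum_sub_distrib, sum_eq_single i]
        · simp
        · intro j _ hj; simp [update_of_ne hj]
        · simp
      simp only [Ψ]
      dsimp only at hcon
      rw [sub_eq_iff_eq_add] at hsum
      rw [hsum, eq_sub_of_add_eq hcon]
      abel
    refine (sum_le_sum this).trans ?_
    simp
  obtain ⟨t, ht⟩ := exists_freq_fiber_le (fun z : T × T => Ψ z.2 ≠ Ψ z.1)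
  refine ⟨b, Ψ t, ?_⟩
  have h4 : freq (fun z : T × T => Ψ z.2 ≠ Ψ z.1) ≤ h * (h * ξ) := by
    refine le_trans (le_of_eq ?_) h3
    exact freq_congr fun z => ne_comm
  calc _ = freq (fun y => Ψ y ≠ Ψ t) := freq_congr fun s => by
        simp only [Ψ, ne_eq, sub_eq_iff_eq_add]
    _ ≤ _ := ht.trans h4
    _ = _ := by ring

end Additive

section Structure
variable {V : Type*} [DecidableEq V] {k h : ℕ}

/-- The entries of the tuples `s` and `t` together form an edge. -/
def KGraph.PairEdge (H : KGraph V k) (s t : Fin h → V) : Prop :=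
  univ.image s ∪ univ.image t ∈ H.edges

theorem KGraph.pairEdge_comm (H : KGraph V k) (s t : Fin h → V) :
    H.PairEdge s t ↔ H.PairEdge t s := by
  unfold PairEdge; rw [union_comm]

theorem KGraph.pairEdge_exchange (H : KGraph V k) (i j : Fin h)
    (z : (Fin h → V) × (Fin h → V)) :
    H.PairEdge (exchange i j z).1 (exchange i j z).2 ↔ H.PairEdge z.1 z.2 := by
  have key : ∀ z : (Fin h → V) × (Fin h → V),
      univ.image z.1 ∪ univ.image z.2 ⊆
        univ.image (exchange i j z).1 ∪ univ.image (exchange i j z).2 := by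
    rintro ⟨s, t⟩ x hx
    simp only [mem_union, mem_image, mem_univ, true_and, exchange] at hx ⊢
    rcases hx with ⟨l, rfl⟩ | ⟨l, rfl⟩
    · by_cases hl : l = i
      · subst hl; exact Or.inr ⟨j, by simp⟩
      · exact Or.inl ⟨l, by simp [update_of_ne hl]⟩
    · by_cases hl : l = j
      · subst hl; exact Or.inl ⟨i, by simp⟩
      · exact Or.inr ⟨l, by simp [update_of_ne hl]⟩
  have h2 := key (exchange i j z)
  rw [exchange_involutive i j z] at h2
  unfold PairEdge
  rw [subset_antisymm (key z) h2]

theorem exists_pair_enumeration (e : Finset V) (he : e.card = h + h) :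
    ∃ z : (Fin h → V) × (Fin h → V), univ.image z.1 ∪ univ.image z.2 = e ∧
      ∀ ι : V → ZMod 2, ∑ j, ι (z.1 j) + ∑ j, ι (z.2 j) = ∑ x ∈ e, ι x := by
  let g := (e.equivFinOfCardEq he).symm
  have hsum : ∀ ι : V → ZMod 2, ∑ j, ι (g (Fin.castAdd h j)) + ∑ j, ι (g (Fin.natAdd h j)) =
      ∑ x ∈ e, ι x := by
    intro ι
    rw [← Fin.sum_univ_add (fun i => ι (g i))]
    rw [← Finset.sum_coe_sort e]
    exact Equiv.sum_comp g (fun x : e => ι x)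
  refine ⟨(fun j => g (Fin.castAdd h j), fun j => g (Fin.natAdd h j)), ?_, hsum⟩
  ext x
  simp only [mem_union, mem_image, mem_univ, true_and]
  constructor
  · rintro (⟨j, rfl⟩ | ⟨j, rfl⟩) <;> exact Subtype.property _
  · intro hx
    obtain ⟨i, hi⟩ := g.surjective ⟨x, hx⟩
    induction i using Fin.addCases with
    | left j => exact Or.inl ⟨j, by rw [hi]⟩
    | right j => exact Or.inr ⟨j, by rw [hi]⟩

variable [Fintype V]

theorem card_le_of_freq_pairs_le (S : Finset (Finset V)) (hS : ∀ e ∈ S, e.card = h + h)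
    (p : (Fin h → V) × (Fin h → V) → Prop) (ε : ℝ) (hp : freq p ≤ ε)
    (hmem : ∀ e ∈ S, ∀ z : (Fin h → V) × (Fin h → V), univ.image z.1 ∪ univ.image z.2 = e →
      (∀ ι : V → ZMod 2, ∑ j, ι (z.1 j) + ∑ j, ι (z.2 j) = ∑ x ∈ e, ι x) → p z) :
    (S.card : ℝ) ≤ ε * (Fintype.card V : ℝ) ^ (h + h) := by
  rcases isEmpty_or_nonempty ((Fin h → V) × (Fin h → V)) with hemp | hne
  · have : S = ∅ := by
      rw [Finset.eq_empty_iff_forall_notMem]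
      intro e he
      obtain ⟨z, -⟩ := exists_pair_enumeration e (hS e he)
      exact hemp.elim z
    subst this
    have : 0 ≤ ε := (freq_nonneg p).trans hp
    simp; positivity
  · have hN : (Fintype.card ((Fin h → V) × (Fin h → V)) : ℝ) =
        (Fintype.card V : ℝ) ^ (h + h) := by
      rw [Fintype.card_prod, Fintype.card_fun, Fintype.card_fin, ← pow_add]; push_cast; rfl
    have hpos : (0 : ℝ) < Fintype.card ((Fin h → V) × (Fin h → V)) := by
      exact_mod_cast Fintype.card_pos
    unfold freq at hp
    rw [div_le_iff₀ hpos, hN] at hp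
    refine le_trans ?_ hp
    norm_cast
    choose! F hF using fun e (he : e ∈ S) => exists_pair_enumeration e (hS e he)
    refine card_le_card_of_injOn F ?_ ?_
    · intro e he
      simpa using hmem e he _ (hF e he).1 (hF e he).2
    · intro e he e' he' hee
      rw [← (hF e he).1, ← (hF e' he').1, hee]

/-- The sum of a product of independent signs. -/
theorem freq_sum_indicator_eq_one [Nonempty V] (A : Finset V) :
    1 - 2 * freq (fun s : Fin h → V => ∑ j, (if s j ∈ A then (1 : ZMod 2) else 0) = 1) =
      (1 - 2 * freq (fun x => x ∈ A)) ^ h := by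
  have hsign : ∀ s : Fin h → V,
      (1 - 2 * (if ∑ j, (if s j ∈ A then (1 : ZMod 2) else 0) = 1 then (1 : ℝ) else 0)) =
        ∏ j, (1 - 2 * (if s j ∈ A then (1 : ℝ) else 0)) := by
    intro s
    have : ∀ J : Finset (Fin h),
        (1 - 2 * (if ∑ j ∈ J, (if s j ∈ A then (1 : ZMod 2) else 0) = 1 then (1 : ℝ) else 0)) =
        ∏ j ∈ J, (1 - 2 * (if s j ∈ A then (1 : ℝ) else 0)) := by
      intro J
      induction J using Finset.induction_on with
      | empty => simp
      | insert a J ha ih =>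
        rw [sum_insert ha, prod_insert ha, ← ih]
        generalize ∑ j ∈ J, (if s j ∈ A then (1 : ZMod 2) else 0) = y
        have hy : y = 0 ∨ y = 1 := by
          fin_cases y; exacts [Or.inl rfl, Or.inr rfl]
        by_cases hs : s a ∈ A
        · rcases hy with rfl | rfl <;>
            norm_num [hs, show (1 : ZMod 2) + 1 = 0 from rfl]
        · rcases hy with rfl | rfl <;> simp [hs]
    exact this univ
  have hc : (Fintype.card V : ℝ) ≠ 0 := by exact_mod_cast Fintype.card_ne_zero
  have h1 : (1 - 2 * freq (fun x => x ∈ A)) =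
      (∑ x, (1 - 2 * (if x ∈ A then (1 : ℝ) else 0))) / Fintype.card V := by
    rw [freq_eq_sum, sum_sub_distrib, ← mul_sum]
    field_simp
    simp only [sum_boole, sum_const, card_univ, nsmul_one]
    congr! 3
    convert sum_boole (R := ℝ) (fun x => x ∈ A) univ
  have hc' : (Fintype.card (Fin h → V) : ℝ) ≠ 0 := by exact_mod_cast Fintype.card_ne_zero
  have h2 : 1 - 2 * freq (fun s : Fin h → V => ∑ j, (if s j ∈ A then (1 : ZMod 2) else 0) = 1) =
      (∑ s : Fin h → V, ∏ j, (1 - 2 * (if s j ∈ A then (1 : ℝ) else 0))) /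
        Fintype.card (Fin h → V) := by
    rw [← sum_congr rfl fun s _ => hsign s, freq_eq_sum, sum_sub_distrib, ← mul_sum]
    field_simp
    simp
  rw [h1, h2, div_pow, Fintype.card_fun, Fintype.card_fin]
  push_cast
  congr 1
  have := Finset.prod_univ_sum (κ := fun _ => V) (fun _ : Fin h => (univ : Finset V))
    (fun _ x => (1 - 2 * (if x ∈ A then (1 : ℝ) else 0)))
  rw [prod_const, card_univ, Fintype.card_fin, Fintype.piFinset_univ] at this
  exact this.symm

theorem exists_balanced_near (A₀ : Finset V) (ρ : ℝ) (hn : 2 ≤ ρ * Fintype.card V)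
    (h0 : |1 - 2 * freq (fun x => x ∈ A₀)| ≤ ρ) :
    ∃ A : Finset V, KGraph.IsBalanced A ∧ freq (fun x => ¬ (x ∈ A ↔ x ∈ A₀)) ≤ ρ := by
  set n := Fintype.card V with hndef
  have hnpos : (0 : ℝ) < n := by
    by_contra hcon
    have : (n : ℝ) = 0 := le_antisymm (not_lt.1 hcon) (by positivity)
    rw [this] at hn; linarith
  have hfr : freq (fun x => x ∈ A₀) = (A₀.card : ℝ) / n := by
    unfold freq; simp [hndef]
  rw [hfr, abs_le] at h0
  have e1 : 1 - 2 * ((A₀.card : ℝ) / n) = (n - 2 * A₀.card) / n := by field_simp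
  rw [e1, le_div_iff₀ hnpos, div_le_iff₀ hnpos] at h0
  have hcl : A₀.card ≤ n := card_le_univ _
  have hbal : ∀ A : Finset V, A.card = n / 2 → KGraph.IsBalanced A := by
    intro A hA
    unfold KGraph.IsBalanced
    rw [card_compl, hA]
    omega
  have hq1 : 2 * ((n / 2 : ℕ) : ℝ) ≤ n := by exact_mod_cast Nat.mul_div_le n 2
  have hq2 : (n : ℝ) ≤ 2 * ((n / 2 : ℕ) : ℝ) + 1 := by
    have : n ≤ 2 * (n / 2) + 1 := by omega
    exact_mod_cast this
  rcases le_total (n / 2) A₀.card with hle | hle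
  · obtain ⟨A, hA, hcard⟩ := exists_subset_card_eq hle
    refine ⟨A, hbal A hcard, ?_⟩
    unfold freq
    rw [div_le_iff₀ hnpos]
    have : #{x | ¬ (x ∈ A ↔ x ∈ A₀)} ≤ #(A₀ \ A) := by
      apply card_le_card; intro x hx
      simp only [mem_filter, mem_univ, true_and, mem_sdiff] at hx ⊢
      by_cases h1 : x ∈ A
      · exact absurd ⟨fun _ => hA h1, fun _ => h1⟩ hx
      · exact ⟨by tauto, h1⟩
    have h3 : (#{x | ¬ (x ∈ A ↔ x ∈ A₀)} : ℝ) ≤ A₀.card - (n / 2 : ℕ) := by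
      rw [card_sdiff_of_subset hA, hcard] at this
      rw [← Nat.cast_sub hle]; exact_mod_cast this
    refine le_trans (le_of_eq ?_) (h3.trans ?_)
    · norm_cast
      convert rfl
    · linarith [h0.1]
  · obtain ⟨A, hA, hcard⟩ := exists_superset_card_eq hle (by omega : n / 2 ≤ n)
    refine ⟨A, hbal A hcard, ?_⟩
    unfold freq
    rw [div_le_iff₀ hnpos]
    have : #{x | ¬ (x ∈ A ↔ x ∈ A₀)} ≤ #(A \ A₀) := by
      apply card_le_card; intro x hx
      simp only [mem_filter, mem_univ, true_and, mem_sdiff] at hx ⊢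
      by_cases h1 : x ∈ A₀
      · exact absurd ⟨fun _ => h1, fun _ => hA h1⟩ hx
      · exact ⟨by tauto, h1⟩
    have h3 : (#{x | ¬ (x ∈ A ↔ x ∈ A₀)} : ℝ) ≤ (n / 2 : ℕ) - A₀.card := by
      rw [card_sdiff_of_subset hA, hcard] at this
      rw [← Nat.cast_sub hle]; exact_mod_cast this
    refine le_trans (le_of_eq ?_) (h3.trans ?_)
    · norm_cast
      convert rfl
    · linarith [h0.2]

/-- If `H` mostly agrees with the parity of the intersection with a balanced set, in the sense of
random pairs of tuples, then it is close to one of the two extremal graphs. -/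
theorem KGraph.isClose_of_freq_le (H : KGraph V (h + h)) (A : Finset V) (c : ZMod 2) (ε : ℝ)
    (hp : freq (fun z : (Fin h → V) × (Fin h → V) => ¬ (H.PairEdge z.1 z.2 ↔
      ∑ j, (if z.1 j ∈ A then (1 : ZMod 2) else 0) +
        ∑ j, (if z.2 j ∈ A then (1 : ZMod 2) else 0) = c)) ≤ ε) :
    H.IsClose ε (oddGraph (h + h) A) ∨ H.IsClose ε (evenGraph (h + h) A) := by
  have hsum : ∀ e : Finset V, ∑ x ∈ e, (if x ∈ A then (1 : ZMod 2) else 0) =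
      ((e ∩ A).card : ZMod 2) := by
    intro e
    rw [sum_ite_mem, sum_const, nsmul_one]
  have hcopy : ∀ G : KGraph V (h + h), G.IsCopy G := fun G => ⟨Equiv.refl V, fun e => by simp⟩
  have key : ∀ G : KGraph V (h + h), (∀ e : Finset V, e.card = h + h →
      (e ∈ G.edges ↔ ((e ∩ A).card : ZMod 2) = c)) → H.IsClose ε G := by
    intro G hG
    refine ⟨G, hcopy G, ?_⟩
    refine card_le_of_freq_pairs_le _ ?_ _ ε hp ?_
    · intro e he
      rcases mem_symmDiff.1 he with h1 | h1
      · exact H.uniform e h1.1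
      · exact G.uniform e h1.1
    · intro e he z hz hι
      rw [hι (fun x => if x ∈ A then (1 : ZMod 2) else 0), hsum]
      unfold PairEdge
      rw [hz]
      rcases mem_symmDiff.1 he with h1 | h1
      · rw [hG e (H.uniform e h1.1)] at h1; tauto
      · rw [hG e (G.uniform e h1.1)] at h1; tauto
  have hc : c = 0 ∨ c = 1 := by fin_cases c; exacts [Or.inl rfl, Or.inr rfl]
  rcases hc with rfl | rfl
  · right
    apply key
    intro e he
    simp [evenGraph, he, mem_powersetCard, ZMod.natCast_eq_zero_iff_even]
  · left
    apply key
    intro e he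
    simp [oddGraph, he, mem_powersetCard, ZMod.natCast_eq_one_iff_odd]

/-- If adjacency of tuples is mostly governed by a balanced two-colouring `χ` of the tuples, then
the hypergraph is close to one of the two extremal graphs. -/
theorem KGraph.exists_isClose_of_coloring (h : ℕ) (hh : 0 < h) (ε : ℝ) (hε : 0 < ε) :
    ∃ ξ : ℝ, 0 < ξ ∧ ∃ n₀ : ℕ, ∀ (V : Type*) [Fintype V] [DecidableEq V] (H : KGraph V (h + h))
      (χ : (Fin h → V) → ZMod 2) (c : ZMod 2), n₀ ≤ Fintype.card V →
      freq (fun z : (Fin h → V) × (Fin h → V) =>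
        ¬ (H.PairEdge z.1 z.2 ↔ χ z.1 + χ z.2 = c)) ≤ ξ →
      |1 - 2 * freq (fun s => χ s = 1)| ≤ ξ →
      ∃ A : Finset V, IsBalanced A ∧
        (H.IsClose ε (oddGraph (h + h) A) ∨ H.IsClose ε (evenGraph (h + h) A)) := by
  have hhR : (0 : ℝ) < h := by exact_mod_cast hh
  obtain ⟨ρ, hρ, hρε⟩ : ∃ ρ : ℝ, 0 < ρ ∧ 2 * h * ρ ≤ ε / 2 :=
    ⟨ε / (4 * h), by positivity, by field_simp; norm_num⟩
  obtain ⟨ξ, hξ, hξ1, hξ2⟩ : ∃ ξ : ℝ, 0 < ξ ∧ ξ * (1 + 4 * h ^ 2) ≤ ε / 2 ∧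
      ξ * (1 + 4 * h ^ 2) ≤ ρ ^ h := by
    refine ⟨min (ε / 2) (ρ ^ h) / (1 + 4 * h ^ 2), by positivity, ?_, ?_⟩
    · rw [div_mul_cancel₀ _ (by positivity)]; exact min_le_left _ _
    · rw [div_mul_cancel₀ _ (by positivity)]; exact min_le_right _ _
  refine ⟨ξ, hξ, max 1 ⌈2 / ρ⌉₊, ?_⟩
  intro V _ _ H χ c hn hE hbal
  have hn1 : 1 ≤ Fintype.card V := (le_max_left _ _).trans hn
  have : Nonempty V := Fintype.card_pos_iff.1 hn1
  have hn2 : 2 ≤ ρ * Fintype.card V := by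
    have h1 : (2 / ρ : ℝ) ≤ Fintype.card V :=
      (Nat.le_ceil _).trans (by exact_mod_cast (le_max_right _ _).trans hn)
    rw [div_le_iff₀ hρ] at h1; linarith
  have hz2 : ∀ x y c : ZMod 2, ((x = c) ↔ (y = c)) → x = y := by decide
  have hex : ∀ i, freq (fun z : (Fin h → V) × (Fin h → V) =>
      χ z.1 + χ z.2 ≠ χ (exchange i ⟨0, hh⟩ z).1 + χ (exchange i ⟨0, hh⟩ z).2) ≤ 2 * ξ := by
    intro i
    let p : (Fin h → V) × (Fin h → V) → Prop := fun z =>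
      ¬ (H.PairEdge z.1 z.2 ↔ χ z.1 + χ z.2 = c)
    have h1 : freq (fun z => p (exchange i ⟨0, hh⟩ z)) ≤ ξ := by rw [freq_exchange]; exact hE
    have : freq (fun z : (Fin h → V) × (Fin h → V) =>
        χ z.1 + χ z.2 ≠ χ (exchange i ⟨0, hh⟩ z).1 + χ (exchange i ⟨0, hh⟩ z).2) ≤
        freq p + freq (fun z => p (exchange i ⟨0, hh⟩ z)) := by
      apply freq_le_add
      intro z hz
      by_contra! hcon
      simp only [p, not_not] at hcon
      obtain ⟨h3, h4⟩ := hcon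
      rw [H.pairEdge_exchange] at h4
      exact hz (hz2 _ _ c (h3.symm.trans h4))
    have h5 : freq p ≤ ξ := hE
    linarith
  obtain ⟨b, C, hbC⟩ := exists_additive_approx χ ⟨0, hh⟩ (2 * ξ) hex
  set A₀ : Finset V := {x | χ (update b ⟨0, hh⟩ x) = 1} with hA₀
  have hα : ∀ x, χ (update b ⟨0, hh⟩ x) = if x ∈ A₀ then (1 : ZMod 2) else 0 := by
    intro x
    simp only [hA₀, mem_filter, mem_univ, true_and]
    generalize χ (update b ⟨0, hh⟩ x) = y
    fin_cases y <;> rfl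
  simp only [hα] at hbC
  let Q : (Fin h → V) → Prop := fun s =>
    χ s ≠ C + ∑ j, if s j ∈ A₀ then (1 : ZMod 2) else 0
  have hQ : freq Q ≤ h ^ 2 * (2 * ξ) := hbC
  -- the sign sum of `A₀` is small
  have hA₀bal : |1 - 2 * freq (fun x => x ∈ A₀)| ≤ ρ := by
    have h1 := freq_sum_indicator_eq_one (h := h) A₀
    set q := freq (fun s : Fin h → V => ∑ j, (if s j ∈ A₀ then (1 : ZMod 2) else 0) = 1) with hq
    have hC : C = 0 ∨ C = 1 := by
      clear hbC Q hQ; fin_cases C; exacts [Or.inl rfl, Or.inr rfl]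
    have hq' : |1 - 2 * q| ≤ ξ * (1 + 4 * h ^ 2) := by
      rcases hC with rfl | rfl
      · have u1 : q ≤ freq (fun s => χ s = 1) + freq Q := by
          apply freq_le_add; intro s hs
          simp only [Q]
          rw [hs]; simp only [zero_add]; tauto
        have u2 : freq (fun s => χ s = 1) ≤ q + freq Q := by
          apply freq_le_add; intro s hs
          simp only [Q]
          rw [hs]; simp only [zero_add]
          by_cases h7 : ∑ j, (if s j ∈ A₀ then (1 : ZMod 2) else 0) = 1
          · exact Or.inl h7
          · exact Or.inr (Ne.symm h7)
        rw [abs_le] at hbal ⊢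
        constructor <;> nlinarith [hbal.1, hbal.2]
      · have hz3 : ∀ x y : ZMod 2, x = 1 → y ≠ 1 ∨ y ≠ 1 + x := by decide
        have hz4 : ∀ x y : ZMod 2, y ≠ 1 → x = 1 ∨ y ≠ 1 + x := by decide
        have hnot := freq_not (fun s => χ s = 1)
        have u1 : q ≤ freq (fun s => ¬ χ s = 1) + freq Q := by
          apply freq_le_add; intro s hs
          exact hz3 _ _ hs
        have u2 : freq (fun s => ¬ χ s = 1) ≤ q + freq Q := by
          apply freq_le_add; intro s hs
          exact hz4 _ _ hs
        rw [hnot] at u1 u2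
        rw [abs_le] at hbal ⊢
        constructor <;> nlinarith [hbal.1, hbal.2]
    rw [h1, abs_pow] at hq'
    exact le_of_pow_le_pow_left₀ hh.ne' hρ.le (hq'.trans hξ2)
  obtain ⟨A, hA, hAA⟩ := exists_balanced_near A₀ ρ hn2 hA₀bal
  refine ⟨A, hA, H.isClose_of_freq_le A c ε ?_⟩
  let R : (Fin h → V) → Prop := fun s => ∃ j, ¬ (s j ∈ A ↔ s j ∈ A₀)
  have hR : freq R ≤ h * ρ := by
    refine (freq_exists_le _).trans ?_
    have : ∀ j ∈ (univ : Finset (Fin h)),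
        freq (fun s : Fin h → V => ¬ (s j ∈ A ↔ s j ∈ A₀)) ≤ ρ := by
      intro j _
      refine le_trans (le_of_eq ?_) hAA
      rw [← freq_fst (β := {i : Fin h // i ≠ j} → V) (fun x => ¬ (x ∈ A ↔ x ∈ A₀)),
        ← freq_equiv (Equiv.funSplitAt j V)]
      exact freq_congr fun s => Iff.rfl
    refine (sum_le_sum this).trans ?_
    simp
  have hfin : freq (fun z : (Fin h → V) × (Fin h → V) => ¬ (H.PairEdge z.1 z.2 ↔
      ∑ j, (if z.1 j ∈ A then (1 : ZMod 2) else 0) +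
        ∑ j, (if z.2 j ∈ A then (1 : ZMod 2) else 0) = c)) ≤
      freq (fun z : (Fin h → V) × (Fin h → V) => ¬ (H.PairEdge z.1 z.2 ↔ χ z.1 + χ z.2 = c)) +
      ((freq (fun z : (Fin h → V) × (Fin h → V) => Q z.1) +
        freq (fun z : (Fin h → V) × (Fin h → V) => Q z.2)) +
      (freq (fun z : (Fin h → V) × (Fin h → V) => R z.1) +
        freq (fun z : (Fin h → V) × (Fin h → V) => R z.2))) := by
    have s1 : freq (fun z : (Fin h → V) × (Fin h → V) => Q z.1 ∨ Q z.2) ≤ _ :=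
      freq_le_add fun z hz => hz
    have s2 : freq (fun z : (Fin h → V) × (Fin h → V) => R z.1 ∨ R z.2) ≤ _ :=
      freq_le_add fun z hz => hz
    have s3 : freq (fun z : (Fin h → V) × (Fin h → V) => (Q z.1 ∨ Q z.2) ∨ (R z.1 ∨ R z.2)) ≤ _ :=
      freq_le_add fun z hz => hz
    refine le_trans (freq_le_add (q := fun z : (Fin h → V) × (Fin h → V) =>
      ¬ (H.PairEdge z.1 z.2 ↔ χ z.1 + χ z.2 = c))
      (r := fun z => (Q z.1 ∨ Q z.2) ∨ (R z.1 ∨ R z.2)) ?_) (by linarith)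
    rintro ⟨s, t⟩ hz
    by_contra! hcon
    obtain ⟨g1, ⟨g2, g3⟩, g4, g5⟩ := hcon
    simp only [Q, R, not_not, ne_eq, not_exists] at g2 g3 g4 g5
    apply hz
    dsimp only at g1 ⊢
    simp only [g4, g5]
    rw [g1, g2, g3]
    have hz5 : ∀ x : ZMod 2, x + x = 0 := by decide
    have : ∀ x y : ZMod 2, C + x + (C + y) = x + y := by
      intro x y
      calc C + x + (C + y) = (C + C) + (x + y) := by ring
        _ = x + y := by rw [hz5, zero_add]
    rw [this]
  rw [freq_fst, freq_snd, freq_fst, freq_snd] at hfin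
  nlinarith

end Structure

section Concentration

/-- Hoeffding's lemma for a uniformly random element of a finite type. -/
theorem sum_exp_le_of_abs_le {ι : Type*} [Fintype ι] (X : ι → ℝ) (a : ℝ)
    (hX : ∀ i, |X i| ≤ a) (h0 : ∑ i, X i = 0) :
    ∑ i, Real.exp (X i) ≤ Fintype.card ι * Real.exp (a ^ 2 / 2) := by
  rcases isEmpty_or_nonempty ι with hι | ⟨⟨i₀⟩⟩
  · simp
  rcases ((abs_nonneg _).trans (hX i₀)).eq_or_lt with ha | ha
  · have : ∀ i, X i = 0 := fun i => abs_eq_zero.1 (le_antisymm (ha ▸ hX i) (abs_nonneg _))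
    simp [this, ← ha]
  have key : ∀ i, Real.exp (X i) ≤ Real.cosh a + X i * (Real.sinh a / a) := by
    intro i
    have h1 := abs_le.1 (hX i)
    have hc := convexOn_exp.2 (Set.mem_univ a) (Set.mem_univ (-a))
      (show 0 ≤ (a + X i) / (2 * a) from div_nonneg (by linarith) (by linarith))
      (show 0 ≤ (a - X i) / (2 * a) from div_nonneg (by linarith) (by linarith))
      (by field_simp; ring)
    have h2 : ((a + X i) / (2 * a)) • a + ((a - X i) / (2 * a)) • (-a) = X i := by
      simp only [smul_eq_mul]; field_simp; ring
    rw [h2] at hc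
    refine hc.trans (le_of_eq ?_)
    rw [Real.cosh_eq, Real.sinh_eq]
    simp only [smul_eq_mul]
    field_simp
    ring
  refine (sum_le_sum fun i _ => key i).trans ?_
  rw [sum_add_distrib, ← sum_mul, h0]
  simp only [sum_const, card_univ, nsmul_eq_mul, zero_mul, add_zero]
  gcongr
  exact Real.cosh_le_exp_half_sq a

theorem sum_exp_perm_le {α : Type*} [Fintype α] [DecidableEq α] (f : Equiv.Perm α → ℝ) (c : ℝ)
    (hf : ∀ x y π, |f (Equiv.swap x y * π) - f π| ≤ c) (l : ℝ) :
    ∑ π, Real.exp (l * (f π - (∑ σ, f σ) / Fintype.card (Equiv.Perm α))) ≤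
      Fintype.card (Equiv.Perm α) * Real.exp (2 * Fintype.card α * (l * c) ^ 2) := by
  revert f
  refine Fintype.induction_empty_option (P := fun α _ => ∀ [DecidableEq α],
    ∀ f : Equiv.Perm α → ℝ, (∀ x y π, |f (Equiv.swap x y * π) - f π| ≤ c) →
    ∑ π, Real.exp (l * (f π - (∑ σ, f σ) / Fintype.card (Equiv.Perm α))) ≤
      Fintype.card (Equiv.Perm α) * Real.exp (2 * Fintype.card α * (l * c) ^ 2)) ?_ ?_ ?_ α
  · intro α β _ e ih _ f hf
    let _ : DecidableEq α := e.decidableEq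
    let _ : Fintype α := Fintype.ofEquiv β e.symm
    have h1 := ih (fun π => f (e.permCongr π)) (by
      intro x y π
      have : e.permCongr (Equiv.swap x y * π) = Equiv.swap (e x) (e y) * e.permCongr π := by
        ext z
        simp [Equiv.permCongr_apply, e.injective.swap_apply]
      rw [this]; exact hf _ _ _)
    have h2 : ∑ σ, f (e.permCongr σ) = ∑ σ, f σ := Equiv.sum_comp e.permCongr f
    rw [h2, Equiv.sum_comp e.permCongr (fun π => Real.exp (l * (f π -
      (∑ σ, f σ) / Fintype.card (Equiv.Perm α)))), Fintype.card_congr e.permCongr] at h1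
    rw [Fintype.card_congr e] at h1
    exact h1
  · intro _ f hf
    simp [Fintype.card_unique]
  · intro α _ ih inst f hf
    obtain rfl : inst = Option.instDecidableEq := Subsingleton.elim _ _
    let N : ℝ := Fintype.card (Equiv.Perm α)
    have hN : 0 < N := by simp only [N]; exact_mod_cast Fintype.card_pos
    let F : Option α → Equiv.Perm α → ℝ :=
      fun p e => f (Equiv.swap none p * Equiv.optionCongr e)
    let g : Option α → ℝ := fun p => (∑ e, F p e) / N
    have hsplit : ∀ φ : Equiv.Perm (Option α) → ℝ,
        ∑ π, φ π = ∑ p, ∑ e, φ (Equiv.swap none p * Equiv.optionCongr e) := by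
      intro φ
      rw [← Equiv.sum_comp Equiv.Perm.decomposeOption.symm, Fintype.sum_prod_type]
      rfl
    have hcard : (Fintype.card (Equiv.Perm (Option α)) : ℝ) = Fintype.card (Option α) * N := by
      rw [Fintype.card_congr Equiv.Perm.decomposeOption, Fintype.card_prod]; push_cast; rfl
    have hO : (0 : ℝ) < Fintype.card (Option α) := by exact_mod_cast Fintype.card_pos
    have hmean : (∑ σ, f σ) / Fintype.card (Equiv.Perm (Option α)) =
        (∑ p, g p) / Fintype.card (Option α) := by
      rw [hsplit, hcard]
      simp only [g]
      rw [← sum_div, div_div, mul_comm]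
    set μ := (∑ p, g p) / Fintype.card (Option α) with hμ
    have hc : 0 ≤ c := (abs_nonneg _).trans (hf none none 1)
    have hgdiff : ∀ p q, |g p - g q| ≤ 2 * c := by
      intro p q
      have h1 : g p - g q = (∑ e, (F p e - F q e)) / N := by
        simp only [g]; rw [sum_sub_distrib, sub_div]
      rw [h1, abs_div, abs_of_pos hN, div_le_iff₀ hN]
      refine (abs_sum_le_sum_abs _ _).trans ?_
      have : ∀ e ∈ (univ : Finset (Equiv.Perm α)), |F p e - F q e| ≤ 2 * c := by
        intro e _
        have h2 := abs_le.1 (hf none p (Equiv.optionCongr e))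
        have h3 := abs_le.1 (hf none q (Equiv.optionCongr e))
        simp only [F]
        rw [abs_le]; constructor <;> linarith [h2.1, h2.2, h3.1, h3.2]
      refine (sum_le_sum this).trans (le_of_eq ?_)
      simp [N]; ring
    have hgμ : ∀ p, |g p - μ| ≤ 2 * c := by
      intro p
      have h1 : g p - μ = (∑ q, (g p - g q)) / Fintype.card (Option α) := by
        rw [sum_sub_distrib, sub_div, ← hμ, sum_const, card_univ, nsmul_eq_mul,
          mul_div_cancel_left₀ _ hO.ne']
      rw [h1, abs_div, abs_of_pos hO, div_le_iff₀ hO]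
      refine (abs_sum_le_sum_abs _ _).trans ?_
      refine (sum_le_sum fun q _ => hgdiff p q).trans (le_of_eq ?_)
      simp; ring
    have hh := sum_exp_le_of_abs_le (fun p => l * (g p - μ)) (|l| * (2 * c))
      (fun p => by rw [abs_mul]; gcongr; exact hgμ p)
      (by
        rw [← mul_sum, sum_sub_distrib, hμ, sum_const, card_univ, nsmul_eq_mul,
          mul_div_cancel₀ _ hO.ne', sub_self, mul_zero])
    rw [hmean, hsplit, hcard]
    have hin : ∀ p, ∑ e, Real.exp (l * (F p e - μ)) ≤
        (N * Real.exp (2 * Fintype.card α * (l * c) ^ 2)) * Real.exp (l * (g p - μ)) := by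
      intro p
      have h1 := ih (F p) (by
        intro x y π
        have : Equiv.swap none p * Equiv.optionCongr (Equiv.swap x y * π) =
            Equiv.swap (Equiv.swap none p (some x)) (Equiv.swap none p (some y)) *
              (Equiv.swap none p * Equiv.optionCongr π) := by
          have h3 : Equiv.optionCongr (Equiv.swap x y * π) =
              Equiv.swap (some x) (some y) * Equiv.optionCongr π := by
            rw [← Equiv.optionCongr_swap]
            ext z; cases z <;> rfl
          rw [h3, ← mul_assoc, ← mul_assoc, Equiv.mul_swap_eq_swap_mul]
        simp only [F]
        rw [this]; exact hf _ _ _)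
      refine le_trans (le_of_eq ?_) (mul_le_mul_of_nonneg_right h1 (Real.exp_pos _).le)
      rw [sum_mul]
      refine sum_congr rfl fun e _ => ?_
      rw [← Real.exp_add]
      congr 1
      simp only [g, N]
      ring
    refine (sum_le_sum fun p _ => hin p).trans ?_
    rw [← mul_sum]
    refine (mul_le_mul_of_nonneg_left hh (by positivity)).trans (le_of_eq ?_)
    have : (|l| * (2 * c)) ^ 2 / 2 = 2 * (l * c) ^ 2 := by
      rw [mul_pow, sq_abs]; ring
    rw [this, Fintype.card_option]
    push_cast
    rw [show 2 * ((Fintype.card α : ℝ) + 1) * (l * c) ^ 2 =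
      2 * Fintype.card α * (l * c) ^ 2 + 2 * (l * c) ^ 2 by ring, Real.exp_add]
    ring

theorem freq_perm_le_exp {α : Type*} [Fintype α] [DecidableEq α] [Nonempty α]
    (f : Equiv.Perm α → ℝ) (c : ℝ) (hc : 0 < c)
    (hf : ∀ x y π, |f (Equiv.swap x y * π) - f π| ≤ c) (t : ℝ) :
    freq (fun π => 0 ≤ t ∧ f π ≤ (∑ σ, f σ) / Fintype.card (Equiv.Perm α) - t) ≤
      Real.exp (-(t ^ 2 / (8 * Fintype.card α * c ^ 2))) := by
  by_cases ht : 0 ≤ t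
  swap
  · simp only [ht, false_and, freq_false]; positivity
  set μ := (∑ σ, f σ) / Fintype.card (Equiv.Perm α)
  have hn : (0 : ℝ) < Fintype.card α := by exact_mod_cast Fintype.card_pos
  have hN : (0 : ℝ) < Fintype.card (Equiv.Perm α) := by exact_mod_cast Fintype.card_pos
  set n : ℝ := (Fintype.card α : ℝ)
  let l : ℝ := t / (4 * n * c ^ 2)
  have hl : 0 ≤ l := by positivity
  have h1 := sum_exp_perm_le f c hf (-l)
  have h2 : freq (fun π => 0 ≤ t ∧ f π ≤ μ - t) * Real.exp (l * t) ≤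
      (∑ π, Real.exp (-l * (f π - μ))) / Fintype.card (Equiv.Perm α) := by
    rw [freq_eq_sum, div_mul_eq_mul_div, sum_mul]
    gcongr with π _
    split_ifs with hπ
    · rw [one_mul]
      apply Real.exp_le_exp.2
      nlinarith [hπ.2]
    · rw [zero_mul]; positivity
  have h3 : (∑ π, Real.exp (-l * (f π - μ))) / Fintype.card (Equiv.Perm α) ≤
      Real.exp (2 * n * (-l * c) ^ 2) := by
    rw [div_le_iff₀ hN, mul_comm]; exact h1
  have h4 := h2.trans h3
  rw [← le_div_iff₀ (Real.exp_pos _), ← Real.exp_sub] at h4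
  refine h4.trans (le_of_eq ?_)
  congr 1
  simp only [l]
  field_simp
  ring

end Concentration

section Sampling
variable {V : Type*} [Fintype V] [DecidableEq V]

theorem freq_eq_const (x : V) : freq (fun y => y = x) = 1 / Fintype.card V := by
  unfold freq
  congr 2
  norm_cast
  rw [card_eq_one]
  exact ⟨x, by ext; simp⟩

theorem freq_not_injective_le {κ : Type*} [Fintype κ] [DecidableEq κ] :
    freq (fun z : κ → V => ¬ Injective z) ≤ (Fintype.card κ : ℝ) ^ 2 / Fintype.card V := by
  have h1 : ∀ z : κ → V, ¬ Injective z → ∃ p : κ × κ, p.1 ≠ p.2 ∧ z p.1 = z p.2 := by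
    intro z hz
    unfold Injective at hz
    push Not at hz
    obtain ⟨a, b, hab, hne⟩ := hz
    exact ⟨(a, b), hne, hab⟩
  refine (freq_mono h1).trans ((freq_exists_le _).trans ?_)
  have : ∀ p ∈ (univ : Finset (κ × κ)),
      freq (fun z : κ → V => p.1 ≠ p.2 ∧ z p.1 = z p.2) ≤ 1 / Fintype.card V := by
    rintro ⟨i, j⟩ _
    by_cases hij : i = j
    · simp only [hij, ne_eq, not_true, false_and, freq_false]; positivity
    · have e1 : freq (fun z : κ → V => i ≠ j ∧ z i = z j) =
          freq (fun q : V × ({l // l ≠ j} → V) => q.1 = q.2 ⟨i, hij⟩) := by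
        rw [← freq_equiv (Equiv.funSplitAt j V)]
        refine freq_congr fun z => ?_
        simp [Equiv.funSplitAt, hij, eq_comm]
      dsimp only
      rw [e1, ← freq_swap, freq_prod]
      simp only [freq_eq_const, sum_const, card_univ, nsmul_eq_mul]
      rw [mul_comm]
      exact div_le_of_le_mul₀ (by positivity) (by positivity) le_rfl
  refine (sum_le_sum this).trans (le_of_eq ?_)
  simp only [sum_const, card_univ, Fintype.card_prod, nsmul_eq_mul]
  push_cast
  ring

theorem exists_perm_comp_eq {κ : Type*} [Fintype κ] (g z : κ → V) (hg : Injective g)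
    (hz : Injective z) : ∃ σ : Equiv.Perm V, ∀ i, σ (g i) = z i := by
  let e : {x // x ∈ Set.range g} ≃ {x // x ∈ Set.range z} :=
    (Equiv.ofInjective g hg).symm.trans (Equiv.ofInjective z hz)
  refine ⟨e.extendSubtype, fun i => ?_⟩
  rw [Equiv.extendSubtype_apply_of_mem e (g i) ⟨i, rfl⟩]
  have : (⟨g i, ⟨i, rfl⟩⟩ : {x // x ∈ Set.range g}) = Equiv.ofInjective g hg i := rfl
  rw [this]
  simp only [e, Equiv.trans_apply]
  rw [Equiv.symm_apply_apply]
  rfl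

/-- A random permutation maps a fixed injective tuple to a nearly uniform tuple. -/
theorem freq_sub_le_freq_perm {κ : Type*} [Fintype κ] [DecidableEq κ] [Nonempty V]
    (g : κ → V) (hg : Injective g) (φ : (κ → V) → Prop) :
    freq φ - (Fintype.card κ : ℝ) ^ 2 / Fintype.card V ≤
      freq (fun π : Equiv.Perm V => φ (fun i => π (g i))) := by
  have h1 : freq (fun p : (κ → V) × Equiv.Perm V => φ (fun i => p.2 (p.1 i)) ∧ Injective p.1) =
      freq (fun z : κ → V => φ z ∧ Injective z) := by
    rw [← freq_swap, freq_prod]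
    have : ∀ π : Equiv.Perm V, freq (fun z : κ → V => φ (fun i => π (z i)) ∧ Injective z) =
        freq (fun z : κ → V => φ z ∧ Injective z) := by
      intro π
      rw [← freq_equiv (Equiv.arrowCongr (Equiv.refl κ) π) (fun z => φ z ∧ Injective z)]
      refine freq_congr fun z => ?_
      have e1 : (Equiv.arrowCongr (Equiv.refl κ) π) z = fun i => π (z i) := rfl
      rw [e1]
      have e2 : Injective (fun i => π (z i)) ↔ Injective z := π.injective.of_comp_iff z
      rw [e2]
    simp only [this, sum_const, card_univ, nsmul_eq_mul]
    field_simp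
  have h2 : freq (fun p : (κ → V) × Equiv.Perm V => φ (fun i => p.2 (p.1 i)) ∧ Injective p.1) ≤
      freq (fun π : Equiv.Perm V => φ (fun i => π (g i))) := by
    rw [freq_prod]
    have hpos : (0 : ℝ) < Fintype.card (κ → V) := by exact_mod_cast Fintype.card_pos
    rw [div_le_iff₀ hpos]
    have : ∀ z ∈ (univ : Finset (κ → V)),
        freq (fun π : Equiv.Perm V => φ (fun i => π (z i)) ∧ Injective z) ≤
        freq (fun π : Equiv.Perm V => φ (fun i => π (g i))) := by
      intro z _
      by_cases hz : Injective z
      · obtain ⟨σ, hσ⟩ := exists_perm_comp_eq z g hz hg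
        rw [← freq_equiv (Equiv.mulRight σ) (fun π : Equiv.Perm V => φ (fun i => π (z i)) ∧ _)]
        refine freq_mono fun π hπ => ?_
        have : ∀ i, (Equiv.mulRight σ π) (z i) = π (g i) := by
          intro i; simp [hσ]
        simp only [this] at hπ
        exact hπ.1
      · simp only [hz, and_false, freq_false]; exact freq_nonneg _
    refine (sum_le_sum this).trans (le_of_eq ?_)
    simp; ring
  have h3 : freq φ ≤ freq (fun z : κ → V => φ z ∧ Injective z) +
      freq (fun z : κ → V => ¬ Injective z) := by
    apply freq_le_add
    intro z hz
    by_cases hi : Injective z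
    · exact Or.inl ⟨hz, hi⟩
    · exact Or.inr hi
  have h4 := freq_not_injective_le (κ := κ) (V := V)
  linarith

variable {m h : ℕ}

/-- The `a`-th part of the partition of `V` into `h`-tuples given by a permutation. -/
def part (e : Fin m × Fin h ≃ V) (π : Equiv.Perm V) (a : Fin m) : Fin h → V :=
  fun j => π (e (a, j))

/-- The index of the part containing `x`. -/
def partIndex (e : Fin m × Fin h ≃ V) (π : Equiv.Perm V) (x : V) : Fin m :=
  (e.symm (π.symm x)).1

theorem part_swap_of_ne {V : Type*} [DecidableEq V] (e : Fin m × Fin h ≃ V)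
    (π : Equiv.Perm V) (x y : V) (a : Fin m)
    (hx : a ≠ partIndex e π x) (hy : a ≠ partIndex e π y) :
    part e (Equiv.swap x y * π) a = part e π a := by
  funext j
  simp only [part, Equiv.Perm.mul_apply]
  apply Equiv.swap_apply_of_ne_of_ne
  · rintro rfl; exact hx (by simp [partIndex])
  · rintro rfl; exact hy (by simp [partIndex])

theorem freq_fin_eq (a : Fin m) : freq (fun b : Fin m => b = a) = 1 / m := by
  rw [freq_eq_const]; simp

theorem freq_part_swap_le {V : Type*} [DecidableEq V] (e : Fin m × Fin h ≃ V)
    (π : Equiv.Perm V) (x y : V)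
    (φ : (Fin h → V) → Prop) :
    freq (fun a => φ (part e (Equiv.swap x y * π) a)) ≤
      freq (fun a => φ (part e π a)) + 2 / m := by
  have h1 : freq (fun a => φ (part e (Equiv.swap x y * π) a)) ≤
      freq (fun a => φ (part e π a)) +
        freq (fun a => a = partIndex e π x ∨ a = partIndex e π y) := by
    apply freq_le_add
    intro a ha
    by_cases h2 : a = partIndex e π x ∨ a = partIndex e π y
    · exact Or.inr h2
    · push Not at h2
      rw [part_swap_of_ne e π x y a h2.1 h2.2] at ha
      exact Or.inl ha
  have h2 : freq (fun a => a = partIndex e π x ∨ a = partIndex e π y) ≤ _ :=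
    freq_le_add fun a ha => ha
  rw [freq_fin_eq, freq_fin_eq] at h2
  calc _ ≤ _ := h1
    _ ≤ freq (fun a => φ (part e π a)) + (1 / m + 1 / m) := by gcongr
    _ = _ := by ring

theorem freq_pair_part_swap_le {V : Type*} [DecidableEq V] (e : Fin m × Fin h ≃ V)
    (π : Equiv.Perm V) (x y : V)
    (φ : (Fin h → V) × (Fin h → V) → Prop) :
    freq (fun p : Fin m × Fin m => φ (part e (Equiv.swap x y * π) p.1,
        part e (Equiv.swap x y * π) p.2)) ≤
      freq (fun p : Fin m × Fin m => φ (part e π p.1, part e π p.2)) + 4 / m := by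
  rcases Nat.eq_zero_or_pos m with rfl | hm
  · simp [freq]
  have : Nonempty (Fin m) := ⟨⟨0, hm⟩⟩
  let B : Fin m → Prop := fun a => a = partIndex e π x ∨ a = partIndex e π y
  have h1 : freq (fun p : Fin m × Fin m => φ (part e (Equiv.swap x y * π) p.1,
        part e (Equiv.swap x y * π) p.2)) ≤
      freq (fun p : Fin m × Fin m => φ (part e π p.1, part e π p.2)) +
        freq (fun p : Fin m × Fin m => B p.1 ∨ B p.2) := by
    apply freq_le_add
    intro a ha
    by_cases h2 : B a.1 ∨ B a.2
    · exact Or.inr h2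
    · simp only [B] at h2
      push Not at h2
      rw [part_swap_of_ne e π x y a.1 h2.1.1 h2.1.2,
        part_swap_of_ne e π x y a.2 h2.2.1 h2.2.2] at ha
      exact Or.inl ha
  have h2 : freq (fun a => B a) ≤ _ :=
    freq_le_add fun a ha => ha
  rw [freq_fin_eq, freq_fin_eq] at h2
  have h3 : freq (fun p : Fin m × Fin m => B p.1 ∨ B p.2) ≤ _ :=
    freq_le_add fun a ha => ha
  rw [freq_fst, freq_snd] at h3
  calc _ ≤ _ := h1
    _ ≤ freq (fun p : Fin m × Fin m => φ (part e π p.1, part e π p.2)) +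
      ((1 / m + 1 / m) + (1 / m + 1 / m)) := by linarith
    _ = _ := by ring

theorem freq_pair_part_mean_ge (hh : 0 < h) (e : Fin m × Fin h ≃ V) (hm : 0 < m)
    (φ : (Fin h → V) × (Fin h → V) → Prop) :
    freq φ - 5 * h / m ≤ (∑ π : Equiv.Perm V,
      freq (fun p : Fin m × Fin m => φ (part e π p.1, part e π p.2))) /
        Fintype.card (Equiv.Perm V) := by
  have : Nonempty (Fin m) := ⟨⟨0, hm⟩⟩
  have : Nonempty V := ⟨e (⟨0, hm⟩, ⟨0, hh⟩)⟩
  have hcardV : (Fintype.card V : ℝ) = m * h := by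
    rw [← Fintype.card_congr e]; simp
  have hmR : (0 : ℝ) < m := by exact_mod_cast hm
  have hhR : (0 : ℝ) < h := by exact_mod_cast hh
  rw [← freq_prod (fun q : Equiv.Perm V × (Fin m × Fin m) =>
    φ (part e q.1 q.2.1, part e q.1 q.2.2)), ← freq_swap (fun q : Equiv.Perm V × (Fin m × Fin m) =>
    φ (part e q.1 q.2.1, part e q.1 q.2.2)),
    freq_prod (fun z : (Fin m × Fin m) × Equiv.Perm V => _)]
  have hoff : ∀ p : Fin m × Fin m, p.1 ≠ p.2 →
      freq φ - 4 * h / m ≤ freq (fun π => φ (part e π p.1, part e π p.2)) := by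
    rintro ⟨a, b⟩ hab
    have hab' : a ≠ b := hab
    let g : Fin h ⊕ Fin h → V := Sum.elim (fun j => e (a, j)) (fun j => e (b, j))
    have hg : Injective g := by
      rintro (i | i) (j | j) hij <;> simp [g] at hij ⊢
      · exact hij
      · exact hab' hij.1
      · exact hab' hij.1.symm
      · exact hij
    have h1 := freq_sub_le_freq_perm g hg
      (fun z => φ (fun j => z (Sum.inl j), fun j => z (Sum.inr j)))
    have h2 : freq (fun z : Fin h ⊕ Fin h → V =>
        φ (fun j => z (Sum.inl j), fun j => z (Sum.inr j))) = freq φ :=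
      freq_equiv (Equiv.sumArrowEquivProdArrow (Fin h) (Fin h) V) φ
    have h3 : (Fintype.card (Fin h ⊕ Fin h) : ℝ) ^ 2 / (m * h) = 4 * h / m := by
      simp only [Fintype.card_sum, Fintype.card_fin]; push_cast; field_simp; ring
    calc freq φ - 4 * h / m = _ := by rw [← h3, ← h2, ← hcardV]
      _ ≤ _ := h1
  have hcm : (Fintype.card (Fin m × Fin m) : ℝ) = m * m := by simp
  rw [hcm, le_div_iff₀ (by positivity)]
  have hge : ∀ p ∈ (univ : Finset (Fin m × Fin m)),
      freq φ - 4 * h / m - (if p.1 = p.2 then (1 : ℝ) else 0) ≤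
        freq (fun π => φ (part e π p.1, part e π p.2)) := by
    intro p _
    by_cases hp : p.1 = p.2
    · rw [if_pos hp]
      have := freq_nonneg (fun π => φ (part e π p.1, part e π p.2))
      have h5 := freq_le_one φ
      have : 0 ≤ 4 * (h : ℝ) / m := by positivity
      linarith
    · rw [if_neg hp]
      linarith [hoff p hp]
  refine le_trans ?_ (sum_le_sum hge)
  rw [sum_sub_distrib, Fintype.sum_prod_type (f := fun p : Fin m × Fin m =>
    if p.1 = p.2 then (1 : ℝ) else 0)]
  simp only [sum_const, card_univ, nsmul_eq_mul, hcm, sum_ite_eq, mem_univ, if_true,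
    Fintype.card_fin, mul_one]
  have e1 : (1 : ℝ) ≤ h := by exact_mod_cast hh
  have e2 : (freq φ - 5 * h / m) * (m * m) = freq φ * m * m - 5 * h * m := by field_simp
  have e3 : (m : ℝ) * m * (freq φ - 4 * h / m) = freq φ * m * m - 4 * h * m := by field_simp
  rw [e2, e3]
  nlinarith

/-- There is a partition of `V` into `h`-tuples that represents polynomially many given
pair statistics faithfully. -/
theorem exists_perm_sampling (h : ℕ) (hh : 0 < h) (τ : ℝ) (hτ : 0 < τ) :
    ∃ m₀ : ℕ, ∀ m ≥ m₀, ∀ (V : Type*) [Fintype V] [DecidableEq V] (e : Fin m × Fin h ≃ V)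
      (Z : Type*) [Fintype Z] (φ : Z → (Fin h → V) × (Fin h → V) → Prop),
      Fintype.card Z ≤ 10 * Fintype.card (Fin h → V) →
      ∃ π : Equiv.Perm V, ∀ z, freq (φ z) - τ ≤
        freq (fun p : Fin m × Fin m => φ z (part e π p.1, part e π p.2)) := by
  have hhR : (0 : ℝ) < h := by exact_mod_cast hh
  let κ : ℝ := τ ^ 2 / (512 * h)
  have hκ : 0 < κ := by positivity
  have hlim : Filter.Tendsto (fun m : ℕ => (κ * m) ^ h * Real.exp (-(κ * m))) Filter.atTop
      (nhds 0) :=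
    (Real.tendsto_pow_mul_exp_neg_atTop_nhds_zero h).comp
      (tendsto_natCast_atTop_atTop.const_mul_atTop hκ)
  have hev := hlim.eventually (gt_mem_nhds (show (0 : ℝ) < κ ^ h / (20 * h ^ h) by positivity))
  obtain ⟨m₁, hm₁⟩ := Filter.eventually_atTop.1 hev
  refine ⟨max m₁ (max 1 ⌈10 * h / τ⌉₊), ?_⟩
  intro m hm V _ _ e Z _ φ hZ
  have hm1 : m₁ ≤ m := (le_max_left _ _).trans hm
  have hm2 : 1 ≤ m := (le_max_left _ _).trans ((le_max_right _ _).trans hm)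
  have hm3 : 10 * h / τ ≤ m := (Nat.le_ceil _).trans
    (by exact_mod_cast (le_max_right _ _).trans ((le_max_right _ _).trans hm))
  have hmR : (0 : ℝ) < m := by exact_mod_cast hm2
  have : Nonempty V := ⟨e (⟨0, hm2⟩, ⟨0, hh⟩)⟩
  have hcardV : (Fintype.card V : ℝ) = m * h := by
    rw [← Fintype.card_congr e]; simp
  let f : Z → Equiv.Perm V → ℝ := fun z π =>
    freq (fun p : Fin m × Fin m => φ z (part e π p.1, part e π p.2))
  have hLip : ∀ z x y π, |f z (Equiv.swap x y * π) - f z π| ≤ 4 / m := by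
    intro z x y π
    have h1 := freq_pair_part_swap_le e π x y (φ z)
    have h2 := freq_pair_part_swap_le e (Equiv.swap x y * π) x y (φ z)
    rw [← mul_assoc, Equiv.swap_mul_self, one_mul] at h2
    rw [abs_le]
    constructor <;> simp only [f] <;> linarith
  have hmean : ∀ z, freq (φ z) - τ / 2 ≤ (∑ σ, f z σ) / Fintype.card (Equiv.Perm V) := by
    intro z
    have h1 := freq_pair_part_mean_ge hh e hm2 (φ z)
    have h2 : 5 * (h : ℝ) / m ≤ τ / 2 := by
      rw [div_le_iff₀ hτ] at hm3
      rw [div_le_iff₀ hmR]; linarith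
    simp only [f]
    linarith
  have hbad : ∀ z ∈ (univ : Finset Z), freq (fun π => 0 ≤ τ / 2 ∧
      f z π ≤ (∑ σ, f z σ) / Fintype.card (Equiv.Perm V) - τ / 2) ≤ Real.exp (-(κ * m)) := by
    intro z _
    refine (freq_perm_le_exp (f z) (4 / m) (by positivity) (hLip z) (τ / 2)).trans (le_of_eq ?_)
    congr 2
    rw [hcardV]
    simp only [κ]
    field_simp
    ring
  have hunion : freq (fun π => ∃ z, 0 ≤ τ / 2 ∧
      f z π ≤ (∑ σ, f z σ) / Fintype.card (Equiv.Perm V) - τ / 2) < 1 := by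
    refine (freq_exists_le _).trans_lt ((sum_le_sum hbad).trans_lt ?_)
    simp only [sum_const, card_univ, nsmul_eq_mul]
    have hZR : (Fintype.card Z : ℝ) ≤ 10 * (m * h) ^ h := by
      rw [Fintype.card_fun, Fintype.card_fin] at hZ
      rw [← hcardV]; exact_mod_cast hZ
    have h1 := hm₁ m hm1
    rw [lt_div_iff₀ (by positivity), mul_pow] at h1
    have h2 : κ ^ h * (20 * ((m * h) ^ h * Real.exp (-(κ * m)))) < κ ^ h * 1 := by
      rw [mul_pow]; linarith
    have h3 := lt_of_mul_lt_mul_left h2 (by positivity)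
    have h4 := mul_le_mul_of_nonneg_right hZR (Real.exp_pos (-(κ * m))).le
    have h5 : 0 ≤ ((m : ℝ) * h) ^ h * Real.exp (-(κ * m)) := by positivity
    linarith
  obtain ⟨π, hπ⟩ := exists_not_of_freq_lt_one hunion
  push Not at hπ
  refine ⟨π, fun z => ?_⟩
  have h1 := hπ z (by positivity)
  have h2 := hmean z
  simp only [f] at h1 h2 ⊢
  linarith

end Sampling

section Rotation

theorem card_filter_product_eq_sum {α β : Type*} (S : Finset α) (T : Finset β)
    (Q : α → β → Prop) :
    #{p ∈ S ×ˢ T | Q p.1 p.2} = ∑ a ∈ S, #{b ∈ T | Q a b} := by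
  rw [card_filter, sum_product]
  exact sum_congr rfl fun a _ => by rw [card_filter]

theorem card_filter_product_eq_sum_right {α β : Type*} (S : Finset α) (T : Finset β)
    (Q : α → β → Prop) :
    #{p ∈ S ×ˢ T | Q p.1 p.2} = ∑ b ∈ T, #{a ∈ S | Q a b} := by
  rw [card_filter, sum_product_right]
  exact sum_congr rfl fun a _ => by rw [card_filter]

theorem exists_card_filter_lt_eq (A : Finset ℕ) (r : ℕ) (hr : r ≤ #A) :
    ∃ μ, #{a ∈ A | a < μ} = r := by
  induction r with
  | zero => exact ⟨0, by simp⟩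
  | succ r ih =>
    obtain ⟨μ, hμ⟩ := ih (by omega)
    have hne : ({a ∈ A | ¬ a < μ} : Finset ℕ).Nonempty := by
      rw [← card_pos]
      have := card_filter_add_card_filter_not (s := A) (fun a => a < μ)
      omega
    let x := ({a ∈ A | ¬ a < μ} : Finset ℕ).min' hne
    have hx := min'_mem _ hne
    simp only [mem_filter] at hx
    refine ⟨x + 1, ?_⟩
    have : ({a ∈ A | a < x + 1} : Finset ℕ) = insert x {a ∈ A | a < μ} := by
      ext a
      simp only [mem_filter, mem_insert]
      constructor
      · rintro ⟨h1, h2⟩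
        by_cases h3 : a < μ
        · exact Or.inr ⟨h1, h3⟩
        · left
          have : x ≤ a := min'_le _ a (mem_filter.2 ⟨h1, h3⟩)
          omega
      · rintro (rfl | ⟨h1, h2⟩)
        · exact ⟨hx.1, by omega⟩
        · exact ⟨h1, by have := hx.2; omega⟩
    rw [this, card_insert_of_notMem, hμ]
    simp only [mem_filter, not_and]
    intro _; exact hx.2

set_option maxHeartbeats 1000000 in
/-- Counting form of the rotation argument: if no rotation of a Hamilton path closes up, then the
non-neighbourhood of the last vertex is nearly independent, or nearly separated from its
complement. -/
theorem sparse_or_cut_of_no_rotation (m : ℕ) (R : ℕ → ℕ → Prop) (hs : ∀ i j, R i j → R j i)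
    (hirr : ∀ i, ¬ R i i) (g : ℝ) (hg1 : 1 ≤ g) (hgm : 1000 * g ≤ m)
    (hdeg : ∀ i < m, (m : ℝ) / 2 - g ≤ #{t ∈ range m | R i t})
    (F1 : ∀ t, t + 1 < m → R 0 (t + 1) → ¬ R t (m - 1))
    (F2 : ∀ i t, i + 1 < m → R 0 (i + 1) → t < i → R i t → ¬ R (t + 1) (m - 1))
    (F3 : ∀ i t, i + 1 < t → t < m → R 0 (i + 1) → R i t → ¬ R (t - 1) (m - 1))
    (D : Finset ℕ) (hD : D = {t ∈ range m | ¬ R t (m - 1)}) :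
    |(#D : ℝ) - m / 2| ≤ g ∧
      ((#{p ∈ D ×ˢ D | R p.1 p.2} : ℝ) ≤ 140 * g * m ∨
        (#{p ∈ D ×ˢ (range m \ D) | R p.1 p.2} : ℝ) ≤ 140 * g * m) := by
  have hmR : (1000 : ℝ) ≤ m := by linarith
  have hm : 1000 ≤ m := by exact_mod_cast hmR
  have memD : ∀ t, t ∈ D ↔ t < m ∧ ¬ R t (m - 1) := by intro t; simp [hD]
  set A : Finset ℕ := {i ∈ range m | i + 1 < m ∧ R 0 (i + 1)} with hA
  have memA : ∀ i, i ∈ A ↔ i + 1 < m ∧ R 0 (i + 1) := by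
    intro i; simp [hA]; omega
  have hAD : A ⊆ D := by
    intro i hi
    rw [memA] at hi; rw [memD]
    exact ⟨by omega, F1 i hi.1 hi.2⟩
  have hAcard : (m : ℝ) / 2 - g ≤ #A := by
    refine (hdeg 0 (by omega)).trans ?_
    have : #{t ∈ range m | R 0 t} ≤ #A := by
      refine card_le_card_of_injOn (fun t => t - 1) ?_ ?_
      · intro t ht
        simp only [coe_filter, mem_range, Set.mem_ofPred_eq] at ht
        have h0 : t ≠ 0 := by rintro rfl; exact hirr 0 ht.2
        have h1 : t - 1 + 1 = t := by omega
        rw [mem_coe, memA, h1]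
        exact ht
      · intro t ht t' ht' htt
        simp only [coe_filter, mem_range, Set.mem_ofPred_eq] at ht ht'
        have h0 : t ≠ 0 := by rintro rfl; exact hirr 0 ht.2
        have h0' : t' ≠ 0 := by rintro rfl; exact hirr 0 ht'.2
        dsimp only at htt
        omega
    exact_mod_cast this
  have hDcard : (#D : ℝ) ≤ m / 2 + g := by
    have h1 := hdeg (m - 1) (by omega)
    have h2 : #{t ∈ range m | R (m - 1) t} + #D = m := by
      have := card_filter_add_card_filter_not (s := range m) (fun t => R (m - 1) t)
      rw [card_range] at this
      rw [hD]
      convert this using 4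
      exact ⟨fun h h' => h (hs _ _ h'), fun h h' => h (hs _ _ h')⟩
    have h3 : (#{t ∈ range m | R (m - 1) t} : ℝ) + #D = m := by exact_mod_cast h2
    linarith
  have hADle : (#A : ℝ) ≤ #D := by exact_mod_cast card_le_card hAD
  have hDA : (#(D \ A) : ℝ) ≤ 2 * g := by
    have : (#(D \ A) : ℝ) = #D - #A := by
      rw [card_sdiff_of_subset hAD, Nat.cast_sub (card_le_card hAD)]
    linarith
  refine ⟨by rw [abs_le]; constructor <;> linarith, ?_⟩
  -- neighbourhoods of the vertices of `A`
  let U : ℕ → Finset ℕ := fun i =>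
    {t ∈ range m | (t < i ∧ t + 1 ∈ D) ∨ (i + 1 < t ∧ t - 1 ∈ D)}
  have hNU : ∀ i ∈ A, ∀ t < m, R i t → t ∈ U i ∨ t = i + 1 := by
    intro i hi t ht hR
    rw [memA] at hi
    simp only [U, mem_filter, mem_range, memD]
    rcases lt_trichotomy t i with h1 | h1 | h1
    · exact Or.inl ⟨ht, Or.inl ⟨h1, by omega, F2 i t hi.1 hi.2 h1 hR⟩⟩
    · subst h1; exact absurd hR (hirr _)
    · by_cases h2 : t = i + 1
      · exact Or.inr h2
      · exact Or.inl ⟨ht, Or.inr ⟨by omega, by omega, F3 i t (by omega) ht hi.2 hR⟩⟩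
  have hUD : ∀ i, #(U i) ≤ #D := by
    intro i
    refine card_le_card_of_injOn (fun t => if t < i then t + 1 else t - 1) ?_ ?_
    · intro t ht
      simp only [U, coe_filter, mem_range, Set.mem_ofPred_eq] at ht
      rcases ht.2 with h | h
      · simp [h.1, h.2]
      · have : ¬ t < i := by omega
        simp [this, h.2]
    · intro t ht t' ht' htt
      simp only [U, coe_filter, mem_range, Set.mem_ofPred_eq] at ht ht'
      dsimp only at htt
      split_ifs at htt <;> omega
  have hUmiss : ∀ i ∈ A, (#{t ∈ U i | ¬ R i t} : ℝ) ≤ 3 * g := by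
    intro i hi
    have him : i < m := by rw [memA] at hi; omega
    have h1 := card_filter_add_card_filter_not (s := U i) (fun t => R i t)
    have h2 : #{t ∈ range m | R i t} ≤ #{t ∈ U i | R i t} + 1 := by
      have : ({t ∈ range m | R i t} : Finset ℕ) ⊆ insert (i + 1) {t ∈ U i | R i t} := by
        intro t ht
        simp only [mem_filter, mem_range, mem_insert] at ht ⊢
        rcases hNU i hi t ht.1 ht.2 with h | h
        · exact Or.inr ⟨h, ht.2⟩
        · exact Or.inl h
      exact (card_le_card this).trans (card_insert_le _ _)
    have h3 := hUD i
    have h4 := hdeg i him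
    have h5 : #{t ∈ U i | ¬ R i t} + #{t ∈ range m | R i t} ≤ #D + 1 := by omega
    have h6 : (#{t ∈ U i | ¬ R i t} : ℝ) + #{t ∈ range m | R i t} ≤ #D + 1 := by
      exact_mod_cast h5
    linarith
  -- median split
  obtain ⟨μ, hμ⟩ := exists_card_filter_lt_eq A (#A / 2) (Nat.div_le_self _ _)
  set AL : Finset ℕ := {a ∈ A | a < μ} with hAL
  set AR : Finset ℕ := {a ∈ A | μ < a} with hAR
  have hALR : #A ≤ #AL + #AR + 1 := by
    have : A ⊆ insert μ (AL ∪ AR) := by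
      intro a ha
      simp only [hAL, hAR, mem_insert, mem_union, mem_filter]
      rcases lt_trichotomy a μ with h | h | h <;> tauto
    refine (card_le_card this).trans ((card_insert_le _ _).trans ?_)
    have := card_union_le AL AR
    omega
  have hALc : (m : ℝ) / 5 ≤ #AL := by
    have : #A ≤ 2 * #AL + 1 := by omega
    have : (#A : ℝ) ≤ 2 * #AL + 1 := by exact_mod_cast this
    linarith
  have hARc : (m : ℝ) / 5 ≤ #AR := by
    have : #A ≤ 2 * #AR + 2 := by omega
    have : (#A : ℝ) ≤ 2 * #AR + 2 := by exact_mod_cast this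
    linarith
  have hAm : ∀ S ⊆ A, (#S : ℝ) ≤ m := by
    intro S hS
    have := (card_le_card (hS.trans (filter_subset _ _))).trans (card_range m).le
    exact_mod_cast this
  set l := #{a ∈ AL | a + 1 ∈ D} with hl
  set l' := #{a ∈ AL | ¬ a + 1 ∈ D} with hl'
  set r := #{a ∈ AR | a - 1 ∈ D} with hr
  set r' := #{a ∈ AR | ¬ a - 1 ∈ D} with hr'
  have hll : l + l' = #AL := card_filter_add_card_filter_not _
  have hrr : r + r' = #AR := card_filter_add_card_filter_not _
  have hlr' : (l : ℝ) * r' ≤ 3 * g * m := by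
    obtain ⟨Q, hQ⟩ : ∃ Q : ℕ → ℕ → Prop, ∀ a a', Q a a' ↔ a ∈ U a' ∧ ¬ R a' a :=
      ⟨_, fun _ _ => Iff.rfl⟩
    have h1 : l * r' ≤ #{p ∈ AL ×ˢ AR | Q p.1 p.2} := by
      rw [hl, hr', ← card_product]
      apply card_le_card
      rintro ⟨a, a'⟩ hp
      simp only [mem_product, mem_filter, hAL, hAR, hQ] at hp ⊢
      obtain ⟨⟨⟨ha, haμ⟩, hp1⟩, ⟨ha', haμ'⟩, hp2⟩ := hp
      refine ⟨⟨⟨ha, haμ⟩, ha', haμ'⟩, ?_, ?_⟩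
      · simp only [U, mem_filter, mem_range]
        rw [memA] at ha
        exact ⟨by omega, Or.inl ⟨by omega, hp1⟩⟩
      · intro hR
        apply hp2
        rw [memA] at ha ha'
        rw [memD]
        exact ⟨by omega, F3 a a' (by omega) (by omega) ha.2 (hs _ _ hR)⟩
    rw [card_filter_product_eq_sum_right AL AR Q] at h1
    have h2 : ∀ a' ∈ AR, (#{a ∈ AL | Q a a'} : ℝ) ≤ 3 * g := by
      intro a' ha'
      refine le_trans ?_ (hUmiss a' (mem_filter.1 ha').1)
      norm_cast
      apply card_le_card
      intro a ha
      simp only [mem_filter, hQ] at ha ⊢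
      exact ha.2
    calc (l : ℝ) * r' ≤ ∑ a' ∈ AR, (#{a ∈ AL | Q a a'} : ℝ) := by exact_mod_cast h1
      _ ≤ ∑ a' ∈ AR, 3 * g := sum_le_sum h2
      _ = #AR * (3 * g) := by simp
      _ ≤ m * (3 * g) := by
        refine mul_le_mul_of_nonneg_right (hAm _ ?_) (by linarith)
        exact filter_subset _ _
      _ = _ := by ring
  have hl'r : (l' : ℝ) * r ≤ 3 * g * m := by
    obtain ⟨Q, hQ⟩ : ∃ Q : ℕ → ℕ → Prop, ∀ a a', Q a a' ↔ a' ∈ U a ∧ ¬ R a a' :=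
      ⟨_, fun _ _ => Iff.rfl⟩
    have h1 : l' * r ≤ #{p ∈ AL ×ˢ AR | Q p.1 p.2} := by
      rw [hl', hr, ← card_product]
      apply card_le_card
      rintro ⟨a, a'⟩ hp
      simp only [mem_product, mem_filter, hAL, hAR, hQ] at hp ⊢
      obtain ⟨⟨⟨ha, haμ⟩, hp1⟩, ⟨ha', haμ'⟩, hp2⟩ := hp
      refine ⟨⟨⟨ha, haμ⟩, ha', haμ'⟩, ?_, ?_⟩
      · simp only [U, mem_filter, mem_range]
        rw [memA] at ha'
        exact ⟨by omega, Or.inr ⟨by omega, hp2⟩⟩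
      · intro hR
        apply hp1
        rw [memA] at ha ha'
        rw [memD]
        exact ⟨by omega, F2 a' a (by omega) ha'.2 (by omega) (hs _ _ hR)⟩
    rw [card_filter_product_eq_sum AL AR Q] at h1
    have h2 : ∀ a ∈ AL, (#{a' ∈ AR | Q a a'} : ℝ) ≤ 3 * g := by
      intro a ha
      refine le_trans ?_ (hUmiss a (mem_filter.1 ha).1)
      norm_cast
      apply card_le_card
      intro a' ha'
      simp only [mem_filter, hQ] at ha' ⊢
      exact ha'.2
    calc (l' : ℝ) * r ≤ ∑ a ∈ AL, (#{a' ∈ AR | Q a a'} : ℝ) := by exact_mod_cast h1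
      _ ≤ ∑ a ∈ AL, 3 * g := sum_le_sum h2
      _ = #AL * (3 * g) := by simp
      _ ≤ m * (3 * g) := by
        refine mul_le_mul_of_nonneg_right (hAm _ ?_) (by linarith)
        exact filter_subset _ _
      _ = _ := by ring
  have hllR : (l : ℝ) + l' = #AL := by exact_mod_cast hll
  have hrrR : (r : ℝ) + r' = #AR := by exact_mod_cast hrr
  have hbig : ∀ x y : ℝ, (m : ℝ) / 10 ≤ x → 0 ≤ y → x * y ≤ 3 * g * m → y ≤ 30 * g := by
    intro x y hx hy hxy
    have h1 : (m : ℝ) / 10 * y ≤ 3 * g * m := (mul_le_mul_of_nonneg_right hx hy).trans hxy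
    have h2 : (m : ℝ) * y ≤ m * (30 * g) := by linarith
    exact le_of_mul_le_mul_left h2 (by linarith)
  -- summation over `D`
  have hsum : ∀ T ⊆ range m, ∀ c : ℝ, (∀ a ∈ A, (#{t ∈ T | R a t} : ℝ) ≤ c) → 0 ≤ c →
      c ≤ 138 * g → (#{p ∈ D ×ˢ T | R p.1 p.2} : ℝ) ≤ 140 * g * m := by
    intro T hT c hc hc0 hcg
    rw [card_filter_product_eq_sum D T R, ← sum_sdiff hAD]
    push_cast
    have h1 : ∑ a ∈ A, (#{t ∈ T | R a t} : ℝ) ≤ m * c := by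
      refine (sum_le_sum hc).trans ?_
      simp only [sum_const, nsmul_eq_mul]
      exact mul_le_mul_of_nonneg_right (hAm _ subset_rfl) hc0
    have h2 : ∑ a ∈ D \ A, (#{t ∈ T | R a t} : ℝ) ≤ 2 * g * m := by
      refine (sum_le_sum (g := fun _ => (m : ℝ)) fun a _ => ?_).trans ?_
      · have := (card_le_card ((filter_subset (fun t => R a t) T).trans hT)).trans (card_range m).le
        exact_mod_cast this
      · simp only [sum_const, nsmul_eq_mul]
        gcongr
    nlinarith
  rcases le_or_gt ((m : ℝ) / 10) l with hcase | hcase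
  · right
    have hr'30 := hbig l r' hcase (by positivity) hlr'
    have hl'30 := hbig r l' (by linarith) (by positivity) (by rw [mul_comm]; exact hl'r)
    -- few right ends
    set b := #{d ∈ D | d + 1 ∉ D} with hb
    set s := #{d ∈ D | ¬ (0 < d ∧ d - 1 ∈ D)} with hsdef
    have hsb : s ≤ b := by
      have h1 : #{d ∈ D | ¬ (d + 1 ∉ D)} ≤ #{d ∈ D | 0 < d ∧ d - 1 ∈ D} := by
        refine card_le_card_of_injOn (fun d => d + 1) ?_ (by intro x _ y _ h; simpa using h)
        intro d hd
        simp only [coe_filter, Set.mem_ofPred_eq, not_not] at hd ⊢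
        exact ⟨hd.2, by omega, by simpa using hd.1⟩
      have h2 := card_filter_add_card_filter_not (s := D) (fun d => d + 1 ∉ D)
      have h3 := card_filter_add_card_filter_not (s := D) (fun d => 0 < d ∧ d - 1 ∈ D)
      omega
    have hb66 : (b : ℝ) ≤ 66 * g := by
      -- starts and ends to the right of `μ`
      have e1 : #{d ∈ D | μ < d ∧ d + 1 ∉ D} ≤ #{d ∈ D | μ < d ∧ d - 1 ∉ D} + 1 := by
        have h1 : #{d ∈ D | μ < d ∧ d - 1 ∈ D} ≤ #{d ∈ D | μ < d ∧ d + 1 ∈ D} + 1 := by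
          have : #{d ∈ D | μ < d ∧ d - 1 ∈ D} ≤ #(insert μ {d ∈ D | μ < d ∧ d + 1 ∈ D}) := by
            refine card_le_card_of_injOn (fun d => d - 1) ?_ ?_
            · intro d hd
              simp only [coe_filter, Set.mem_ofPred_eq, coe_insert, Set.mem_insert_iff] at hd ⊢
              by_cases h : d - 1 = μ
              · exact Or.inl h
              · exact Or.inr ⟨hd.2.2, by omega, by
                  rw [show d - 1 + 1 = d by omega]; exact hd.1⟩
            · intro d hd d' hd' hdd
              simp only [coe_filter, Set.mem_ofPred_eq] at hd hd'
              dsimp only at hdd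
              omega
          exact this.trans (card_insert_le _ _)
        have h2 := card_filter_add_card_filter_not (s := {d ∈ D | μ < d}) (fun d => d + 1 ∈ D)
        have h3 := card_filter_add_card_filter_not (s := {d ∈ D | μ < d}) (fun d => d - 1 ∈ D)
        simp only [filter_filter] at h2 h3
        omega
      have e2 : #{d ∈ D | μ < d ∧ d - 1 ∉ D} ≤ r' + #(D \ A) := by
        have : ({d ∈ D | μ < d ∧ d - 1 ∉ D} : Finset ℕ) ⊆
            {a ∈ AR | ¬ a - 1 ∈ D} ∪ (D \ A) := by
          intro d hd
          simp only [mem_filter, mem_union, mem_sdiff, hAR] at hd ⊢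
          by_cases h : d ∈ A
          · exact Or.inl ⟨⟨h, hd.2.1⟩, hd.2.2⟩
          · exact Or.inr ⟨hd.1, h⟩
        exact (card_le_card this).trans (card_union_le _ _)
      have e3 : #{d ∈ D | d < μ ∧ d + 1 ∉ D} ≤ l' + #(D \ A) := by
        have : ({d ∈ D | d < μ ∧ d + 1 ∉ D} : Finset ℕ) ⊆
            {a ∈ AL | ¬ a + 1 ∈ D} ∪ (D \ A) := by
          intro d hd
          simp only [mem_filter, mem_union, mem_sdiff, hAL] at hd ⊢
          by_cases h : d ∈ A
          · exact Or.inl ⟨⟨h, hd.2.1⟩, hd.2.2⟩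
          · exact Or.inr ⟨hd.1, h⟩
        exact (card_le_card this).trans (card_union_le _ _)
      have e4 : b ≤ #{d ∈ D | d < μ ∧ d + 1 ∉ D} + #{d ∈ D | μ < d ∧ d + 1 ∉ D} + 1 := by
        have : ({d ∈ D | d + 1 ∉ D} : Finset ℕ) ⊆ insert μ
            ({d ∈ D | d < μ ∧ d + 1 ∉ D} ∪ {d ∈ D | μ < d ∧ d + 1 ∉ D}) := by
          intro d hd
          simp only [mem_filter, mem_insert, mem_union] at hd ⊢
          rcases lt_trichotomy d μ with h | h | h <;> tauto
        refine (card_le_card this).trans ((card_insert_le _ _).trans ?_)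
        have := card_union_le ({d ∈ D | d < μ ∧ d + 1 ∉ D} : Finset ℕ)
          {d ∈ D | μ < d ∧ d + 1 ∉ D}
        omega
      have e5 : b ≤ l' + r' + 2 * #(D \ A) + 2 := by omega
      have e6 : (b : ℝ) ≤ l' + r' + 2 * #(D \ A) + 2 := by exact_mod_cast e5
      linarith
    refine hsum _ sdiff_subset (1 + s + b) ?_ (by positivity) ?_
    · intro a ha
      have : ({t ∈ range m \ D | R a t} : Finset ℕ) ⊆ insert (a + 1)
          ({d ∈ D | ¬ (0 < d ∧ d - 1 ∈ D)}.image (fun d => d - 1) ∪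
            {d ∈ D | d + 1 ∉ D}.image (fun d => d + 1)) := by
        intro t ht
        simp only [mem_filter, mem_sdiff, mem_range, mem_insert, mem_union, mem_image] at ht ⊢
        rcases hNU a ha t ht.1.1 ht.2 with h | h
        · right
          simp only [U, mem_filter, mem_range] at h
          rcases h.2 with h | h
          · exact Or.inl ⟨t + 1, ⟨h.2, by simpa using ht.1.2⟩, by simp⟩
          · refine Or.inr ⟨t - 1, ⟨h.2, ?_⟩, by omega⟩
            rw [show t - 1 + 1 = t by omega]; exact ht.1.2
        · exact Or.inl h
      have h1 := (card_le_card this).trans (card_insert_le _ _)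
      have h2 := card_union_le ({d ∈ D | ¬ (0 < d ∧ d - 1 ∈ D)}.image (fun d => d - 1))
        ({d ∈ D | d + 1 ∉ D}.image (fun d => d + 1))
      have h3 : #({d ∈ D | ¬ (0 < d ∧ d - 1 ∈ D)}.image (fun d => d - 1)) ≤ s := card_image_le
      have h4 : #({d ∈ D | d + 1 ∉ D}.image (fun d => d + 1)) ≤ b := card_image_le
      have h5 : #{t ∈ range m \ D | R a t} ≤ 1 + s + b := by omega
      exact_mod_cast h5
    · have : (s : ℝ) ≤ b := by exact_mod_cast hsb
      linarith
  · left
    have hr30 := hbig l' r (by linarith) (by positivity) hl'r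
    have hl30 := hbig r' l (by linarith) (by positivity) (by rw [mul_comm]; exact hlr')
    set x := #{d ∈ D | d + 1 ∈ D} with hx
    have hx65 : (x : ℝ) ≤ 65 * g := by
      have e2 : #{d ∈ D | μ < d ∧ d - 1 ∈ D} ≤ r + #(D \ A) := by
        have : ({d ∈ D | μ < d ∧ d - 1 ∈ D} : Finset ℕ) ⊆
            {a ∈ AR | a - 1 ∈ D} ∪ (D \ A) := by
          intro d hd
          simp only [mem_filter, mem_union, mem_sdiff, hAR] at hd ⊢
          by_cases h : d ∈ A
          · exact Or.inl ⟨⟨h, hd.2.1⟩, hd.2.2⟩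
          · exact Or.inr ⟨hd.1, h⟩
        exact (card_le_card this).trans (card_union_le _ _)
      have e3 : #{d ∈ D | d < μ ∧ d + 1 ∈ D} ≤ l + #(D \ A) := by
        have : ({d ∈ D | d < μ ∧ d + 1 ∈ D} : Finset ℕ) ⊆
            {a ∈ AL | a + 1 ∈ D} ∪ (D \ A) := by
          intro d hd
          simp only [mem_filter, mem_union, mem_sdiff, hAL] at hd ⊢
          by_cases h : d ∈ A
          · exact Or.inl ⟨⟨h, hd.2.1⟩, hd.2.2⟩
          · exact Or.inr ⟨hd.1, h⟩
        exact (card_le_card this).trans (card_union_le _ _)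
      have e4 : x ≤ #{d ∈ D | d < μ ∧ d + 1 ∈ D} + #{d ∈ D | μ < d ∧ d - 1 ∈ D} := by
        have : ({d ∈ D | d + 1 ∈ D} : Finset ℕ) ⊆
            ({d ∈ D | d < μ ∧ d + 1 ∈ D} ∪
              {d ∈ D | μ < d ∧ d - 1 ∈ D}.image (fun d => d - 1)) := by
          intro d hd
          simp only [mem_filter, mem_union, mem_image] at hd ⊢
          rcases lt_or_ge d μ with h | h
          · exact Or.inl ⟨hd.1, h, hd.2⟩
          · exact Or.inr ⟨d + 1, ⟨hd.2, by omega, by simpa using hd.1⟩, by simp⟩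
        refine (card_le_card this).trans ((card_union_le _ _).trans ?_)
        have : #({d ∈ D | μ < d ∧ d - 1 ∈ D}.image (fun d => d - 1)) ≤
          #{d ∈ D | μ < d ∧ d - 1 ∈ D} := card_image_le
        omega
      have e5 : x ≤ l + r + 2 * #(D \ A) := by omega
      have e6 : (x : ℝ) ≤ l + r + 2 * #(D \ A) := by exact_mod_cast e5
      linarith
    have hDm : D ⊆ range m := by rw [hD]; exact filter_subset _ _
    refine hsum D hDm (1 + x + x) ?_ (by positivity) (by linarith)
    intro a ha
    have : ({t ∈ D | R a t} : Finset ℕ) ⊆ insert (a + 1)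
        ({d ∈ D | d + 1 ∈ D} ∪ {d ∈ D | d + 1 ∈ D}.image (fun d => d + 1)) := by
      intro t ht
      simp only [mem_filter, mem_insert, mem_union, mem_image] at ht ⊢
      rcases hNU a ha t (mem_range.1 (hDm ht.1)) ht.2 with h | h
      · right
        simp only [U, mem_filter, mem_range] at h
        rcases h.2 with h | h
        · exact Or.inl ⟨ht.1, h.2⟩
        · refine Or.inr ⟨t - 1, ⟨h.2, ?_⟩, by omega⟩
          rw [show t - 1 + 1 = t by omega]; exact ht.1
      · exact Or.inl h
    have h1 := (card_le_card this).trans (card_insert_le _ _)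
    have h2 := card_union_le ({d ∈ D | d + 1 ∈ D}) ({d ∈ D | d + 1 ∈ D}.image (fun d => d + 1))
    have h4 : #({d ∈ D | d + 1 ∈ D}.image (fun d => d + 1)) ≤ x := card_image_le
    have h5 : #{t ∈ D | R a t} ≤ 1 + x + x := by omega
    exact_mod_cast h5

end Rotation

section Hamilton
variable {W : Type*} [Fintype W]

/-- `w 0, …, w (card W - 1)` is a Hamilton path of `G`. -/
def SimpleGraph.IsHamPath (G : SimpleGraph W) (w : ℕ → W) : Prop :=
  Set.InjOn w (Set.Iio (Fintype.card W)) ∧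
    ∀ i, i + 1 < Fintype.card W → G.Adj (w i) (w (i + 1))

/-- `G` has a Hamilton path whose ends are adjacent. -/
def SimpleGraph.HasHamCycle (G : SimpleGraph W) : Prop :=
  ∃ w, G.IsHamPath w ∧ G.Adj (w (Fintype.card W - 1)) (w 0)

namespace SimpleGraph

theorem IsHamPath.hasHamCycle_reindex {G : SimpleGraph W} {w : ℕ → W} (hw : G.IsHamPath w)
    (m : ℕ) (hm : Fintype.card W = m) (σ : ℕ → ℕ) (h1 : ∀ i < m, σ i < m)
    (h2 : ∀ i < m, ∀ j < m, σ i = σ j → i = j)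
    (h3 : ∀ i, i + 1 < m → σ i + 1 = σ (i + 1) ∨ σ (i + 1) + 1 = σ i ∨
      G.Adj (w (σ i)) (w (σ (i + 1))))
    (h4 : G.Adj (w (σ (m - 1))) (w (σ 0))) : G.HasHamCycle := by
  subst hm
  refine ⟨fun i => w (σ i), ⟨?_, ?_⟩, h4⟩
  · intro i hi j hj hij
    exact h2 i hi j hj (hw.1 (h1 i hi) (h1 j hj) hij)
  · intro i hi
    dsimp only
    rcases h3 i hi with h | h | h
    · rw [← h]; exact hw.2 _ (h ▸ h1 (i + 1) hi)
    · rw [← h]; exact (hw.2 _ (h ▸ h1 i (by omega))).symm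
    · exact h

theorem IsHamPath.not_adj_of_adj_succ {G : SimpleGraph W} {w : ℕ → W} (hw : G.IsHamPath w)
    (hG : ¬ G.HasHamCycle) (t : ℕ) (ht : t + 1 < Fintype.card W)
    (h0 : G.Adj (w 0) (w (t + 1))) : ¬ G.Adj (w t) (w (Fintype.card W - 1)) := by
  intro hlast
  apply hG
  set m := Fintype.card W
  refine hw.hasHamCycle_reindex m rfl (fun j => if j ≤ t then t - j else j) ?_ ?_ ?_ ?_
  · intro i hi; split_ifs <;> omega
  · intro i hi j hj hij
    split_ifs at hij <;> omega
  · intro i hi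
    by_cases h : i = t
    · subst h; right; right; simpa using h0
    · split_ifs <;> omega
  · have : ¬ m - 1 ≤ t := by omega
    simpa [this] using hlast.symm

theorem IsHamPath.not_adj_of_rotation_left {G : SimpleGraph W} {w : ℕ → W} (hw : G.IsHamPath w)
    (hG : ¬ G.HasHamCycle) (i t : ℕ) (hi : i + 1 < Fintype.card W)
    (h0 : G.Adj (w 0) (w (i + 1))) (hti : t < i) (h1 : G.Adj (w i) (w t)) :
    ¬ G.Adj (w (t + 1)) (w (Fintype.card W - 1)) := by
  intro hlast
  apply hG
  set m := Fintype.card W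
  refine hw.hasHamCycle_reindex m rfl
    (fun j => if j < i - t then t + 1 + j else if j ≤ i then i - j else j) ?_ ?_ ?_ ?_
  · intro j hj; split_ifs <;> omega
  · intro a ha b hb hab
    split_ifs at hab <;> omega
  · intro j hj
    by_cases h : j + 1 = i - t
    · right; right
      have e1 : t + 1 + j = i := by omega
      have e2 : i - (j + 1) = t := by omega
      have e3 : j < i - t := by omega
      have e4 : ¬ j + 1 < i - t := by omega
      have e5 : j + 1 ≤ i := by omega
      simpa [e1, e2, e3, e4, e5] using h1
    · by_cases h' : j = i
      · subst h'; right; right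
        have e3 : ¬ j < j - t := by omega
        have e4 : ¬ j + 1 < j - t := by omega
        simpa [e3, e4] using h0
      · split_ifs <;> omega
  · have e1 : ¬ m - 1 < i - t := by omega
    have e2 : ¬ m - 1 ≤ i := by omega
    have e3 : 0 < i - t := by omega
    simpa [e1, e2, e3, hti] using hlast.symm

theorem IsHamPath.not_adj_of_rotation_right {G : SimpleGraph W} {w : ℕ → W} (hw : G.IsHamPath w)
    (hG : ¬ G.HasHamCycle) (i t : ℕ) (hit : i + 1 < t) (ht : t < Fintype.card W)
    (h0 : G.Adj (w 0) (w (i + 1))) (h1 : G.Adj (w i) (w t)) :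
    ¬ G.Adj (w (t - 1)) (w (Fintype.card W - 1)) := by
  intro hlast
  apply hG
  set m := Fintype.card W
  refine hw.hasHamCycle_reindex m rfl
    (fun j => if j < t - 1 - i then t - 1 - j else if j < t then j - (t - 1 - i) else j) ?_ ?_ ?_ ?_
  · intro j hj; split_ifs <;> omega
  · intro a ha b hb hab
    split_ifs at hab <;> omega
  · intro j hj
    by_cases h : j + 1 = t - 1 - i
    · right; right
      have e1 : t - 1 - j = i + 1 := by omega
      have e2 : j + 1 - (t - 1 - i) = 0 := by omega
      have e3 : j < t - 1 - i := by omega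
      have e4 : ¬ j + 1 < t - 1 - i := by omega
      have e5 : j + 1 < t := by omega
      simpa only [e1, e2, e3, e4, e5, if_true, if_false] using h0.symm
    · by_cases h' : j + 1 = t
      · right; right
        have e1 : j - (t - 1 - i) = i := by omega
        have e3 : ¬ j < t - 1 - i := by omega
        have e4 : ¬ j + 1 < t - 1 - i := by omega
        have e5 : j < t := by omega
        have e6 : ¬ j + 1 < t := by omega
        simp only [e1, e3, e4, e5, e6, if_true, if_false]
        rw [h']; exact h1
      · split_ifs <;> omega
  · have e1 : ¬ m - 1 < t - 1 - i := by omega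
    have e3 : 0 < t - 1 - i := by omega
    have e2 : ¬ m - 1 < t := by omega
    simpa only [e1, e2, e3, if_true, if_false, Nat.sub_zero] using hlast.symm

theorem IsHamPath.image_range {G : SimpleGraph W} {w : ℕ → W} (hw : G.IsHamPath w) :
    (range (Fintype.card W)).image w = univ := by
  rw [← card_eq_iff_eq_univ, card_image_of_injOn]
  · simp
  · simpa using hw.1

theorem IsHamPath.card_filter {G : SimpleGraph W} {w : ℕ → W} (hw : G.IsHamPath w)
    (p : W → Prop) : #{t ∈ range (Fintype.card W) | p (w t)} = #{v | p v} := by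
  rw [← hw.image_range, filter_image, card_image_of_injOn]
  intro i hi j hj
  simp only [coe_filter, mem_range, Set.mem_ofPred_eq] at hi hj
  exact hw.1 hi.1 hj.1

/-- Ore's argument. -/
theorem IsHamPath.hasHamCycle_of_degrees {G : SimpleGraph W} {w : ℕ → W} (hw : G.IsHamPath w)
    (hm : 0 < Fintype.card W)
    (hdeg : Fintype.card W ≤ #{v | G.Adj (w 0) v} + #{v | G.Adj (w (Fintype.card W - 1)) v}) :
    G.HasHamCycle := by
  by_contra hG
  rw [← hw.card_filter, ← hw.card_filter] at hdeg
  set m := Fintype.card W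
  have h1 : #{t ∈ range m | G.Adj (w 0) (w t)} ≤
      #{t ∈ range (m - 1) | G.Adj (w 0) (w (t + 1))} := by
    refine card_le_card_of_injOn (fun t => t - 1) ?_ ?_
    · intro t ht
      simp only [coe_filter, mem_range, Set.mem_ofPred_eq] at ht ⊢
      have h0 : t ≠ 0 := by rintro rfl; exact G.irrefl ht.2
      rw [show t - 1 + 1 = t by omega]
      exact ⟨by omega, ht.2⟩
    · intro t ht t' ht' htt
      simp only [coe_filter, mem_range, Set.mem_ofPred_eq] at ht ht'
      have h0 : t ≠ 0 := by rintro rfl; exact G.irrefl ht.2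
      have h0' : t' ≠ 0 := by rintro rfl; exact G.irrefl ht'.2
      dsimp only at htt
      omega
  have h2 : #{t ∈ range m | G.Adj (w (m - 1)) (w t)} ≤
      #{t ∈ range (m - 1) | ¬ G.Adj (w 0) (w (t + 1))} := by
    apply card_le_card
    intro t ht
    simp only [mem_filter, mem_range] at ht ⊢
    have h0 : t ≠ m - 1 := by rintro rfl; exact G.irrefl ht.2
    refine ⟨by omega, fun h => ?_⟩
    exact hw.not_adj_of_adj_succ hG t (by omega) h ht.2.symm
  have h3 := card_filter_add_card_filter_not (s := range (m - 1))
    (fun t => G.Adj (w 0) (w (t + 1)))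
  rw [card_range] at h3
  omega

/-- A graph is Hamiltonian if Hamiltonicity can be pulled back along the successive addition of
edges. -/
theorem hasHamCycle_of_closure (hm : 3 ≤ Fintype.card W) (G₀ : SimpleGraph W)
    (hstep : ∀ G, G₀ ≤ G → G ≠ ⊤ → ∃ u v, u ≠ v ∧ ¬ G.Adj u v ∧
      ∀ w, G.IsHamPath w → (w 0 = u ∧ w (Fintype.card W - 1) = v ∨
        w 0 = v ∧ w (Fintype.card W - 1) = u) → G.HasHamCycle) :
    G₀.HasHamCycle := by
  suffices h : ∀ G : SimpleGraph W, G₀ ≤ G → G.HasHamCycle from h G₀ le_rfl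
  intro G
  induction G using (wellFounded_gt (α := SimpleGraph W)).induction with
  | _ G ih =>
  intro hG
  set m := Fintype.card W with hmdef
  by_cases htop : G = ⊤
  · subst htop
    let e := (Fintype.equivFin W).symm
    have hpos : 0 < m := by omega
    let w : ℕ → W := fun i => e ⟨i % m, Nat.mod_lt _ hpos⟩
    have hinj : ∀ i j, i < m → j < m → w i = w j → i = j := by
      intro i j hi hj hij
      have := congrArg Fin.val (e.injective hij)
      simpa [Nat.mod_eq_of_lt hi, Nat.mod_eq_of_lt hj] using this
    refine ⟨w, ⟨fun i hi j hj hij => hinj i j hi hj hij, fun i hi => ?_⟩, ?_⟩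
    · rw [top_adj]; intro h
      have := hinj _ _ (by omega) hi h
      omega
    · rw [top_adj]; intro h
      have := hinj _ _ (by omega) (by omega) h
      omega
  obtain ⟨u, v, huv, hnadj, hclose⟩ := hstep G hG htop
  have hlt : G < G ⊔ edge u v := by
    refine lt_of_le_of_ne le_sup_left fun h => hnadj ?_
    rw [h]
    exact Or.inr (by simp [edge_adj, huv])
  obtain ⟨c, hc, hc0⟩ := ih (G ⊔ edge u v) hlt (hG.trans le_sup_left)
  rw [← hmdef] at hc0
  have hpos : 0 < m := by omega
  let c' : ℕ → W := fun i => c (i % m)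
  have hinj : ∀ i j, c' i = c' j → i % m = j % m := fun i j hij =>
    hc.1 (Nat.mod_lt _ hpos) (Nat.mod_lt _ hpos) hij
  have hadj : ∀ i, (G ⊔ edge u v).Adj (c' i) (c' (i + 1)) := by
    intro i
    have hi := Nat.mod_lt i hpos
    by_cases h : i % m + 1 < m
    · have e1 : (i + 1) % m = i % m + 1 := by
        rw [Nat.add_mod, Nat.mod_eq_of_lt (show 1 < m by omega), Nat.mod_eq_of_lt h]
      simp only [c', e1]
      exact hc.2 _ h
    · have e1 : i % m = m - 1 := by omega
      have e2 : (i + 1) % m = 0 := by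
        rw [Nat.add_mod, Nat.mod_eq_of_lt (show 1 < m by omega), e1,
          show m - 1 + 1 = m by omega, Nat.mod_self]
      simp only [c', e1, e2]
      exact hc0
  have hedge : ∀ i, ¬ G.Adj (c' i) (c' (i + 1)) →
      (c' i = u ∧ c' (i + 1) = v) ∨ (c' i = v ∧ c' (i + 1) = u) := by
    intro i hi
    have := (hadj i).resolve_left hi
    rw [edge_adj] at this
    tauto
  by_cases hall : ∀ i, G.Adj (c' i) (c' (i + 1))
  · refine ⟨c, ⟨hc.1, fun i hi => ?_⟩, ?_⟩
    · have := hall i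
      rw [← hmdef] at hi
      simp only [c', Nat.mod_eq_of_lt hi, Nat.mod_eq_of_lt (show i < m by omega)] at this
      exact this
    · have := hall (m - 1)
      simp only [c', Nat.mod_eq_of_lt (show m - 1 < m by omega),
        show m - 1 + 1 = m by omega, Nat.mod_self] at this
      exact this
  push Not at hall
  obtain ⟨i₀, hi₀⟩ := hall
  have hshift : ∀ a b, a < m → b < m → (i₀ + 1 + a) % m = (i₀ + 1 + b) % m → a = b := by
    intro a b ha hb hab
    have : a ≡ b [MOD m] := Nat.ModEq.add_left_cancel' (i₀ + 1) hab
    exact Nat.ModEq.eq_of_lt_of_lt this ha hb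
  have hi₀m : (i₀ + 1 + (m - 1)) % m = i₀ % m := by
    rw [show i₀ + 1 + (m - 1) = i₀ + m by omega, Nat.add_mod_right]
  apply hclose (fun j => c' (i₀ + 1 + j))
  · refine ⟨fun a ha b hb hab => hshift a b ha hb (hinj _ _ hab), ?_⟩
    intro j hj
    by_contra hcon
    have h1 := hedge i₀ hi₀
    have h2 := hedge (i₀ + 1 + j) (by rwa [show i₀ + 1 + j + 1 = i₀ + 1 + (j + 1) by omega])
    have hcase : (c' (i₀ + 1 + j) = c' i₀) ∨
        (c' (i₀ + 1 + j) = c' (i₀ + 1) ∧ c' (i₀ + 1 + j + 1) = c' i₀) := by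
      rcases h1 with h1 | h1 <;> rcases h2 with h2 | h2
      · exact Or.inl (h2.1.trans h1.1.symm)
      · exact Or.inr ⟨h2.1.trans h1.2.symm, h2.2.trans h1.1.symm⟩
      · exact Or.inr ⟨h2.1.trans h1.2.symm, h2.2.trans h1.1.symm⟩
      · exact Or.inl (h2.1.trans h1.1.symm)
    rcases hcase with h | ⟨h, h'⟩
    · have h3 := hinj _ _ h
      rw [← hi₀m] at h3
      have := hshift _ _ (by omega) (by omega) h3
      omega
    · have h3 := hinj _ _ h
      have h4 := hshift j 0 (by omega) (by omega) (by simpa using h3)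
      have h5 := hinj _ _ h'
      rw [← hi₀m, show i₀ + 1 + j + 1 = i₀ + 1 + (j + 1) by omega] at h5
      have := hshift _ _ (by omega) (by omega) h5
      omega
  · have e0 : c' (i₀ + 1 + (m - 1)) = c' i₀ := by simp only [c', hi₀m]
    rw [e0]
    rcases hedge i₀ hi₀ with h | h
    · exact Or.inr ⟨h.2, h.1⟩
    · exact Or.inl ⟨h.2, h.1⟩

/-- A graph with minimum degree slightly below half the order is Hamiltonian if no set of about
half of its vertices is nearly independent or nearly separated from its complement. -/
theorem hasHamCycle_of_robust [DecidableEq W] (G₀ : SimpleGraph W) (g β : ℝ) (hg1 : 1 ≤ g)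
    (hgm : 1000 * g ≤ Fintype.card W) (hβ : 140 * g ≤ β * Fintype.card W)
    (hdeg : ∀ u, (Fintype.card W : ℝ) / 2 - g ≤ #{v | G₀.Adj u v})
    (hrob : ∀ D : Finset W, |(#D : ℝ) - Fintype.card W / 2| ≤ g →
      β * (Fintype.card W : ℝ) ^ 2 < #{p ∈ D ×ˢ D | G₀.Adj p.1 p.2} ∧
      β * (Fintype.card W : ℝ) ^ 2 < #{p ∈ D ×ˢ (univ \ D) | G₀.Adj p.1 p.2}) :
    G₀.HasHamCycle := by
  have hmR : (1000 : ℝ) ≤ Fintype.card W := by linarith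
  have hm : 1000 ≤ Fintype.card W := by exact_mod_cast hmR
  refine hasHamCycle_of_closure (by omega) G₀ ?_
  intro G hG htop
  obtain ⟨u, v, huv, hnadj⟩ : ∃ u v, u ≠ v ∧ ¬ G.Adj u v := by
    by_contra! hcon
    apply htop
    ext u v
    rw [top_adj]
    exact ⟨fun h => h.ne, hcon u v⟩
  refine ⟨u, v, huv, hnadj, fun w hw _ => ?_⟩
  by_contra hno
  set m := Fintype.card W with hmdef
  have key := sparse_or_cut_of_no_rotation m (fun i j => G.Adj (w i) (w j))
    (fun i j h => h.symm) (fun i => G.irrefl) g hg1 hgm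
    (fun i _ => by
      refine (hdeg (w i)).trans ?_
      have h1 : #{t ∈ range m | G.Adj (w i) (w t)} = #{v | G.Adj (w i) v} :=
        hw.card_filter (fun v => G.Adj (w i) v)
      rw [h1]
      norm_cast
      apply card_le_card
      intro x hx
      simp only [mem_filter, mem_univ, true_and] at hx ⊢
      exact hG hx)
    (fun t ht h0 => hw.not_adj_of_adj_succ hno t ht h0)
    (fun i t hi h0 hti h1 => hw.not_adj_of_rotation_left hno i t hi h0 hti h1)
    (fun i t hit ht h0 h1 => hw.not_adj_of_rotation_right hno i t hit ht h0 h1) _ rfl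
  set D₀ : Finset ℕ := {t ∈ range m | ¬ G.Adj (w t) (w (m - 1))} with hD₀
  set D : Finset W := {x | ¬ G.Adj x (w (m - 1))} with hD
  have hcard : #D₀ = #D := by
    convert hw.card_filter (fun x => ¬ G.Adj x (w (m - 1)))
  have hpull : ∀ x : W, ∃ i < m, w i = x := by
    intro x
    have h1 := hw.image_range
    rw [Finset.ext_iff] at h1
    simpa using h1 x
  choose ix hix hwix using hpull
  have htrans : ∀ (S T : Finset W) (S₀ T₀ : Finset ℕ), (∀ x ∈ S, ix x ∈ S₀) →
      (∀ x ∈ T, ix x ∈ T₀) → #{p ∈ S ×ˢ T | G₀.Adj p.1 p.2} ≤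
        #{p ∈ S₀ ×ˢ T₀ | G.Adj (w p.1) (w p.2)} := by
    intro S T S₀ T₀ hS hT
    refine card_le_card_of_injOn (fun p => (ix p.1, ix p.2)) ?_ ?_
    · rintro ⟨x, y⟩ hp
      simp only [coe_filter, mem_product, Set.mem_ofPred_eq] at hp ⊢
      refine ⟨⟨hS x hp.1.1, hT y hp.1.2⟩, ?_⟩
      rw [hwix, hwix]; exact hG hp.2
    · rintro ⟨x, y⟩ _ ⟨x', y'⟩ _ hpp
      simp only [Prod.mk.injEq] at hpp ⊢
      rw [← hwix x, ← hwix y, hpp.1, hpp.2, hwix, hwix]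
      exact ⟨rfl, rfl⟩
  have hin : ∀ x ∈ D, ix x ∈ D₀ := by
    intro x hx
    simp only [hD, mem_filter, mem_univ, true_and] at hx
    simp only [hD₀, mem_filter, mem_range, hwix]
    exact ⟨hix x, hx⟩
  have hout : ∀ x ∈ univ \ D, ix x ∈ range m \ D₀ := by
    intro x hx
    simp only [hD, mem_sdiff, mem_filter, mem_univ, true_and, not_not] at hx
    simp only [hD₀, mem_sdiff, mem_filter, mem_range, hwix]
    exact ⟨hix x, fun h => h.2 hx⟩
  obtain ⟨hsz, hor⟩ := key
  rw [hcard] at hsz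
  obtain ⟨r1, r2⟩ := hrob D hsz
  have hfin : 140 * g * m ≤ β * (m : ℝ) ^ 2 := by nlinarith
  rcases hor with h | h
  · have h1 : (#{p ∈ D ×ˢ D | G₀.Adj p.1 p.2} : ℝ) ≤ #{p ∈ D₀ ×ˢ D₀ | G.Adj (w p.1) (w p.2)} := by
      exact_mod_cast htrans D D D₀ D₀ hin hin
    linarith
  · have h1 : (#{p ∈ D ×ˢ (univ \ D) | G₀.Adj p.1 p.2} : ℝ) ≤
        #{p ∈ D₀ ×ˢ (range m \ D₀) | G.Adj (w p.1) (w p.2)} := by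
      exact_mod_cast htrans D (univ \ D) D₀ (range m \ D₀) hin hout
    linarith

/-- A consequence of the closure operation: a graph is Hamiltonian if more than half of its
vertices have degree at least half the order, and their number compensates for the minimum
degree. -/
theorem hasHamCycle_of_large_degrees (hm : 3 ≤ Fintype.card W) (G₀ : SimpleGraph W)
    (K : Finset W) (δ : ℕ) (hK : ∀ u ∈ K, Fintype.card W ≤ 2 * #{v | G₀.Adj u v})
    (hδ : ∀ u, δ ≤ #{v | G₀.Adj u v}) (hKδ : Fintype.card W + 1 ≤ #K + δ)
    (hKm : Fintype.card W + 1 ≤ 2 * #K) : G₀.HasHamCycle := by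
  refine hasHamCycle_of_closure hm G₀ ?_
  intro G hG htop
  set m := Fintype.card W with hmdef
  have hmono : ∀ u, #{v | G₀.Adj u v} ≤ #{v | G.Adj u v} := by
    intro u
    apply card_le_card
    intro x hx
    simp only [mem_filter, mem_univ, true_and] at hx ⊢
    exact hG hx
  have hore : ∀ u v, m ≤ #{x | G.Adj u x} + #{x | G.Adj v x} →
      ∀ w, G.IsHamPath w → (w 0 = u ∧ w (m - 1) = v ∨ w 0 = v ∧ w (m - 1) = u) →
        G.HasHamCycle := by
    intro u v hsum w hw hends
    apply hw.hasHamCycle_of_degrees (by omega)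
    rw [← hmdef]
    rcases hends with h | h
    · rw [h.1, h.2]; exact hsum
    · rw [h.1, h.2, add_comm]; exact hsum
  have hclique : ∀ u, (∀ v ∈ K, u ≠ v → G.Adj u v) → #K ≤ #{x | G.Adj u x} + 1 := by
    intro u hu
    have : K ⊆ insert u ({x | G.Adj u x} : Finset W) := by
      intro v hv
      simp only [mem_insert, mem_filter, mem_univ, true_and]
      by_cases h : v = u
      · exact Or.inl h
      · exact Or.inr (hu v hv (Ne.symm h))
    exact (card_le_card this).trans (card_insert_le _ _)
  by_cases h1 : ∃ u ∈ K, ∃ v ∈ K, u ≠ v ∧ ¬ G.Adj u v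
  · obtain ⟨u, hu, v, hv, huv, hnadj⟩ := h1
    refine ⟨u, v, huv, hnadj, hore u v ?_⟩
    have := hK u hu; have := hK v hv
    have := hmono u; have := hmono v
    omega
  push Not at h1
  by_cases h2 : ∃ u ∈ K, ∃ v, u ≠ v ∧ ¬ G.Adj u v
  · obtain ⟨u, hu, v, huv, hnadj⟩ := h2
    refine ⟨u, v, huv, hnadj, hore u v ?_⟩
    have h3 := hclique u (fun v hv huv => h1 u hu v hv huv)
    have := hδ v
    have := hmono v
    omega
  push Not at h2
  obtain ⟨u, v, huv, hnadj⟩ : ∃ u v, u ≠ v ∧ ¬ G.Adj u v := by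
    by_contra! hcon
    apply htop
    ext u v
    rw [top_adj]
    exact ⟨fun h => h.ne, hcon u v⟩
  refine ⟨u, v, huv, hnadj, hore u v ?_⟩
  have h3 : ∀ u, u ∉ K → #K ≤ #{x | G.Adj u x} := by
    intro u hu
    apply card_le_card
    intro v hv
    simp only [mem_filter, mem_univ, true_and]
    exact (h2 v hv u (by rintro rfl; exact hu hv)).symm
  have hu : u ∉ K := fun h => hnadj (h2 u h v huv)
  have hv : v ∉ K := fun h => hnadj (h2 v h u huv.symm).symm
  have := h3 u hu; have := h3 v hv
  omega

end SimpleGraph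
end Hamilton

section Degree
variable {V : Type*} [DecidableEq V]

theorem card_powersetCard_filter_superset (S E : Finset V) (hSE : S ⊆ E) (d : ℕ)
    (hd : #S ≤ d) :
    #{D ∈ E.powersetCard d | S ⊆ D} = (#E - #S).choose (d - #S) := by
  rw [← card_sdiff_of_subset hSE, ← card_powersetCard]
  refine card_nbij' (fun D => D \ S) (fun T => T ∪ S) ?_ ?_ ?_ ?_
  · intro D hD
    simp only [coe_filter, mem_powersetCard, Set.mem_ofPred_eq, mem_coe] at hD ⊢
    exact ⟨sdiff_subset_sdiff hD.1.1 subset_rfl, by rw [card_sdiff_of_subset hD.2, hD.1.2]⟩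
  · intro T hT
    simp only [coe_filter, mem_powersetCard, Set.mem_ofPred_eq, mem_coe] at hT ⊢
    refine ⟨⟨union_subset (hT.1.trans sdiff_subset) hSE, ?_⟩, subset_union_right⟩
    rw [card_union_of_disjoint (disjoint_of_subset_left hT.1 sdiff_disjoint), hT.2]
    omega
  · intro D hD
    simp only [coe_filter, mem_powersetCard, Set.mem_ofPred_eq] at hD
    exact sdiff_union_of_subset hD.2
  · intro T hT
    simp only [mem_powersetCard, mem_coe] at hT
    dsimp only
    rw [union_sdiff_right, sdiff_eq_self_of_disjoint (disjoint_of_subset_left hT.1 sdiff_disjoint)]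

variable [Fintype V] {k : ℕ}

/-- A bound on the degrees of `d`-sets implies the same relative bound for smaller sets. -/
theorem KGraph.le_degree_of_forall_le (H : KGraph V k) {d : ℕ} (S : Finset V) (hSd : #S ≤ d)
    (hdk : d ≤ k) (hkn : k ≤ Fintype.card V) (c : ℝ)
    (hdeg : ∀ D : Finset V, #D = d → c * ((Fintype.card V - d).choose (k - d) : ℝ) ≤ H.degree D) :
    c * ((Fintype.card V - #S).choose (k - #S) : ℝ) ≤ H.degree S := by
  set n := Fintype.card V
  set h := #S with hh
  let DS : Finset (Finset V) := {D ∈ univ.powersetCard d | S ⊆ D}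
  have hDS : #DS = (n - h).choose (d - h) := by
    have := card_powersetCard_filter_superset S univ (subset_univ _) d hSd
    rwa [card_univ] at this
  have hcount : ∑ D ∈ DS, H.degree D = (k - h).choose (d - h) * H.degree S := by
    have h1 : ∑ D ∈ DS, H.degree D =
        ∑ D ∈ DS, #(bipartiteAbove (fun D e => D ⊆ e) {e ∈ H.edges | S ⊆ e} D) := by
      refine sum_congr rfl fun D hD => ?_
      unfold degree bipartiteAbove
      congr 1
      ext e
      simp only [mem_filter]
      have : S ⊆ D := (mem_filter.1 hD).2
      constructor
      · rintro ⟨h1, h2⟩; exact ⟨⟨h1, this.trans h2⟩, h2⟩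
      · rintro ⟨⟨h1, _⟩, h2⟩; exact ⟨h1, h2⟩
    rw [h1, sum_card_bipartiteAbove_eq_sum_card_bipartiteBelow]
    have h2 : ∀ e ∈ ({e ∈ H.edges | S ⊆ e} : Finset (Finset V)),
        #(bipartiteBelow (fun D e => D ⊆ e) DS e) = (k - h).choose (d - h) := by
      intro e he
      simp only [mem_filter] at he
      rw [← H.uniform e he.1, ← card_powersetCard_filter_superset S e he.2 d hSd]
      unfold bipartiteBelow
      congr 1
      ext D
      simp only [DS, mem_filter, mem_powersetCard, subset_univ, true_and]
      tauto
    rw [sum_congr rfl h2, sum_const, smul_eq_mul, mul_comm]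
    rfl
  have hlow : (#DS : ℝ) * (c * ((n - d).choose (k - d) : ℝ)) ≤
      (k - h).choose (d - h) * H.degree S := by
    have : (∑ D ∈ DS, H.degree D : ℝ) = (k - h).choose (d - h) * H.degree S := by
      exact_mod_cast hcount
    rw [← this, ← nsmul_eq_mul]
    refine card_nsmul_le_sum _ _ _ fun D hD => hdeg D ?_
    exact (mem_powersetCard.1 (mem_filter.1 hD).1).2
  have hchoose : (n - h).choose (k - h) * (k - h).choose (d - h) =
      (n - h).choose (d - h) * (n - d).choose (k - d) := by
    have := Nat.choose_mul (n := n - h) (k := k - h) (s := d - h) (by omega)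
    rw [this]
    congr 2 <;> omega
  have hchooseR : ((n - h).choose (k - h) : ℝ) * (k - h).choose (d - h) =
      (n - h).choose (d - h) * (n - d).choose (k - d) := by exact_mod_cast hchoose
  have hpos : (0 : ℝ) < (k - h).choose (d - h) := by
    exact_mod_cast Nat.choose_pos (by omega)
  rw [hDS] at hlow
  refine le_of_mul_le_mul_left ?_ hpos
  calc ((k - h).choose (d - h) : ℝ) * (c * (n - h).choose (k - h))
      = c * ((n - h).choose (k - h) * (k - h).choose (d - h)) := by ring
    _ = (n - h).choose (d - h) * (c * (n - d).choose (k - d)) := by rw [hchooseR]; ring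
    _ ≤ _ := hlow

theorem factorial_le_card_filter_image_eq {h : ℕ} (T : Finset V) (hT : #T = h) :
    h.factorial ≤ #{t : Fin h → V | univ.image t = T} := by
  have hc : Fintype.card (Fin h ≃ T) = h.factorial := by
    rw [Fintype.card_equiv (T.equivFinOfCardEq hT).symm, Fintype.card_fin]
  rw [← hc, ← card_univ]
  refine card_le_card_of_injOn (fun f j => (f j : V)) ?_ ?_
  · intro f _
    simp only [coe_filter, mem_univ, true_and, Set.mem_ofPred_eq]
    ext x
    simp only [mem_image, mem_univ, true_and]
    constructor
    · rintro ⟨j, rfl⟩; exact (f j).2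
    · intro hx; exact ⟨f.symm ⟨x, hx⟩, by simp⟩
  · intro f _ f' _ hff
    ext j
    exact congrFun hff j

theorem KGraph.factorial_mul_degree_le {h : ℕ} (H : KGraph V (h + h)) (z : Fin h → V)
    (hz : Injective z) :
    h.factorial * H.degree (univ.image z) ≤ #{t : Fin h → V | H.PairEdge z t} := by
  set S := univ.image z with hS
  have hSc : #S = h := by rw [hS, card_image_of_injective _ hz]; simp
  let F : Finset V → Finset (Fin h → V) := fun e => {t | univ.image t = e \ S}
  have hdisj : ((H.edges.filter fun e => S ⊆ e : Finset (Finset V)) :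
      Set (Finset V)).PairwiseDisjoint F := by
    intro e he e' he' hne
    rw [Function.onFun, disjoint_left]
    intro t ht ht'
    simp only [F, mem_filter, mem_univ, true_and] at ht ht'
    simp only [coe_filter, Set.mem_ofPred_eq] at he he'
    apply hne
    rw [← sdiff_union_of_subset he.2, ← ht, ht', sdiff_union_of_subset he'.2]
  have hsub : (H.edges.filter fun e => S ⊆ e).biUnion F ⊆
      ({t | H.PairEdge z t} : Finset (Fin h → V)) := by
    intro t ht
    simp only [mem_biUnion, mem_filter, F, mem_univ, true_and] at ht ⊢
    obtain ⟨e, ⟨he, hSe⟩, hte⟩ := ht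
    unfold PairEdge
    rw [hte, ← hS, union_sdiff_of_subset hSe]
    exact he
  refine le_trans ?_ (card_le_card hsub)
  rw [card_biUnion hdisj]
  unfold degree
  rw [mul_comm, ← smul_eq_mul]
  refine card_nsmul_le_sum _ _ _ fun e he => ?_
  simp only [mem_filter] at he
  apply factorial_le_card_filter_image_eq
  rw [card_sdiff_of_subset he.2, H.uniform e he.1, hSc]
  omega

theorem KGraph.le_freq_pairEdge {h : ℕ} (hh : 0 < h) (H : KGraph V (h + h)) {d : ℕ} (hd : h ≤ d)
    (hdk : d ≤ h + h) (γ : ℝ) (hγ : 0 < γ) (hγ2 : γ ≤ 1 / 2) (hn : (h : ℝ) ^ 2 ≤ γ * Fintype.card V)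
    (hn2 : h + h ≤ Fintype.card V)
    (hdeg : (1 / 2 - γ) * ((Fintype.card V - d).choose (h + h - d) : ℝ) ≤ (H.minDegree d : ℝ))
    (z : Fin h → V) (hz : Injective z) : 1 / 2 - 2 * γ ≤ freq (fun t => H.PairEdge z t) := by
  set n := Fintype.card V with hndef
  have hnpos : (0 : ℝ) < n := by
    have : 0 < n := by omega
    exact_mod_cast this
  have hSc : #(univ.image z) = h := by rw [card_image_of_injective _ hz]; simp
  have h1 := H.le_degree_of_forall_le (univ.image z) (by rw [hSc]; exact hd) hdk hn2 (1 / 2 - γ)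
    (fun D hD => hdeg.trans (Nat.cast_le.2 (Nat.sInf_le (Set.mem_image_of_mem _ hD))))
  rw [hSc, Nat.add_sub_cancel, ← hndef] at h1
  have h2 := H.factorial_mul_degree_le z hz
  have h3 : (h.factorial : ℝ) * H.degree (univ.image z) ≤ #{t : Fin h → V | H.PairEdge z t} := by
    exact_mod_cast h2
  have h4 : (1 / 2 - γ) * ((n : ℝ) - 2 * h) ^ h ≤ #{t : Fin h → V | H.PairEdge z t} := by
    refine le_trans ?_ h3
    have h5 : (n - h + 1 - h) ^ h ≤ h.factorial * (n - h).choose h := by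
      rw [← Nat.descFactorial_eq_factorial_mul_choose]
      exact Nat.pow_sub_le_descFactorial _ _
    have h6 : ((n : ℝ) - 2 * h) ^ h ≤ h.factorial * (n - h).choose h := by
      have h7 : ((n : ℝ) - 2 * h) ≤ ((n - h + 1 - h : ℕ) : ℝ) := by
        have : n ≤ (n - h + 1 - h) + 2 * h := by omega
        have : (n : ℝ) ≤ ((n - h + 1 - h : ℕ) : ℝ) + 2 * h := by exact_mod_cast this
        linarith
      have h8 : (0 : ℝ) ≤ (n : ℝ) - 2 * h := by
        have : ((h + h : ℕ) : ℝ) ≤ n := by exact_mod_cast hn2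
        push_cast at this; linarith
      calc ((n : ℝ) - 2 * h) ^ h ≤ ((n - h + 1 - h : ℕ) : ℝ) ^ h := by gcongr
        _ ≤ _ := by exact_mod_cast h5
    calc (1 / 2 - γ) * ((n : ℝ) - 2 * h) ^ h
        ≤ (1 / 2 - γ) * (h.factorial * (n - h).choose h) := by
          apply mul_le_mul_of_nonneg_left h6; linarith
      _ = h.factorial * ((1 / 2 - γ) * (n - h).choose h) := by ring
      _ ≤ _ := by gcongr
  unfold freq
  have hcard : (Fintype.card (Fin h → V) : ℝ) = (n : ℝ) ^ h := by
    rw [Fintype.card_fun, Fintype.card_fin]; push_cast; rfl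
  rw [hcard, le_div_iff₀ (by positivity)]
  refine le_trans ?_ h4
  have hb : 1 - 2 * (h : ℝ) ^ 2 / n ≤ (1 - 2 * h / n) ^ h := by
    have hle : 2 * (h : ℝ) / n ≤ 1 := by
      rw [div_le_one hnpos]
      have : ((h + h : ℕ) : ℝ) ≤ n := by exact_mod_cast hn2
      push_cast at this; linarith
    have := one_add_mul_le_pow (show (-2 : ℝ) ≤ -(2 * h / n) by linarith) h
    calc 1 - 2 * (h : ℝ) ^ 2 / n = 1 + h * (-(2 * h / n)) := by ring
      _ ≤ _ := this
      _ = _ := by ring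
  have hfac : ((n : ℝ) - 2 * h) ^ h = (1 - 2 * h / n) ^ h * (n : ℝ) ^ h := by
    rw [← mul_pow]; congr 1; field_simp
  rw [hfac, ← mul_assoc]
  gcongr
  have hx : (h : ℝ) ^ 2 / n ≤ γ := by rw [div_le_iff₀ hnpos]; exact hn
  have hx0 : 0 ≤ (h : ℝ) ^ 2 / n := by positivity
  have hx2 : 2 * (h : ℝ) ^ 2 / n = 2 * ((h : ℝ) ^ 2 / n) := by ring
  calc 1 / 2 - 2 * γ ≤ (1 / 2 - γ) * (1 - 2 * (h : ℝ) ^ 2 / n) := by rw [hx2]; nlinarith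
    _ ≤ _ := by apply mul_le_mul_of_nonneg_left hb; linarith

end Degree

section Cycle
variable {V : Type*} {m h : ℕ}

theorem part_injective (e : Fin m × Fin h ≃ V) (π : Equiv.Perm V) (a : Fin m) :
    Injective (part e π a) := by
  intro i j hij
  simpa [part] using hij

variable [Fintype V] [DecidableEq V]

/-- The graph on the parts of a partition into `h`-tuples. -/
def KGraph.partGraph (hh : 0 < h) (H : KGraph V (h + h)) (e : Fin m × Fin h ≃ V)
    (π : Equiv.Perm V) : SimpleGraph (Fin m) where
  Adj a b := H.PairEdge (part e π a) (part e π b)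
  symm := ⟨fun a b hab => (H.pairEdge_comm _ _).1 hab⟩
  loopless := ⟨fun a ha => by
    have h1 := H.uniform _ ha
    rw [union_self, card_image_of_injective _ (part_injective e π a), card_univ,
      Fintype.card_fin] at h1
    omega⟩

theorem KGraph.hasHamiltonCycle_of_partGraph (hh : 0 < h) (hm : 3 ≤ m) (H : KGraph V (h + h))
    (e : Fin m × Fin h ≃ V) (π : Equiv.Perm V) (hG : (H.partGraph hh e π).HasHamCycle) :
    H.HasHamiltonCycle h := by
  obtain ⟨w, ⟨hinj, hadj⟩, hlast⟩ := hG
  rw [Fintype.card_fin] at hinj hadj hlast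
  set n := Fintype.card V with hn
  have hnm : n = m * h := by rw [hn, ← Fintype.card_congr e]; simp
  have hnpos : 0 < n := by rw [hnm]; positivity
  have : NeZero n := ⟨hnpos.ne'⟩
  let F : ZMod n → V := fun x => part e π (w (x.val / h)) ⟨x.val % h, Nat.mod_lt _ hh⟩
  have hFinj : Injective F := by
    intro x y hxy
    simp only [F, part, EmbeddingLike.apply_eq_iff_eq, Prod.mk.injEq, Fin.mk.injEq] at hxy
    have hx : x.val / h < m := Nat.div_lt_of_lt_mul (by rw [mul_comm, ← hnm]; exact x.val_lt)
    have hy : y.val / h < m := Nat.div_lt_of_lt_mul (by rw [mul_comm, ← hnm]; exact y.val_lt)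
    have h1 := hinj hx hy hxy.1
    apply ZMod.val_injective n
    rw [← Nat.div_add_mod x.val h, ← Nat.div_add_mod y.val h, h1, hxy.2]
  have hFbij : Bijective F :=
    (Fintype.bijective_iff_injective_and_card F).2 ⟨hFinj, by rw [ZMod.card]⟩
  let f : ZMod n ≃ V := Equiv.ofBijective F hFbij
  let P : ℕ → Finset V := fun q => univ.image (part e π (w (q % m)))
  have hf : ∀ q r (hr : r < h), f ((q * h + r : ℕ) : ZMod n) = part e π (w (q % m)) ⟨r, hr⟩ := by
    intro q r hr
    have hv : ((q * h + r : ℕ) : ZMod n).val = (q % m) * h + r := by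
      rw [ZMod.val_natCast, hnm]
      have h1 : q * h + r = m * h * (q / m) + ((q % m) * h + r) := by
        conv_lhs => rw [← Nat.div_add_mod q m]
        ring
      rw [h1, Nat.mul_add_mod]
      apply Nat.mod_eq_of_lt
      have h2 : q % m + 1 ≤ m := Nat.mod_lt _ (by omega)
      calc (q % m) * h + r < (q % m) * h + h := by omega
        _ = (q % m + 1) * h := by ring
        _ ≤ m * h := Nat.mul_le_mul_right _ h2
    have h1 : ((q % m) * h + r) / h = q % m := by
      rw [mul_comm, Nat.mul_add_div hh, Nat.div_eq_of_lt hr, add_zero]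
    have h2 : ((q % m) * h + r) % h = r := by
      rw [mul_comm, Nat.mul_add_mod, Nat.mod_eq_of_lt hr]
    simp only [f, Equiv.ofBijective_apply, F, hv, h1, h2]
  have hwin : ∀ q, window f (h + h) (q * h) = P q ∪ P (q + 1) := by
    intro q
    ext x
    simp only [window, mem_image, mem_range, mem_union, P, mem_univ, true_and]
    constructor
    · rintro ⟨j, hj, rfl⟩
      by_cases hjh : j < h
      · exact Or.inl ⟨⟨j, hjh⟩, (hf q j hjh).symm⟩
      · refine Or.inr ⟨⟨j - h, by omega⟩, ?_⟩
        rw [← hf (q + 1) (j - h) (by omega)]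
        congr 2
        rw [add_mul, one_mul]; omega
    · rintro (⟨j, rfl⟩ | ⟨j, rfl⟩)
      · exact ⟨j, by omega, hf q j j.2⟩
      · refine ⟨h + j, by omega, ?_⟩
        rw [← hf (q + 1) j j.2]
        congr 2
        ring
  have hPcard : ∀ q, #(P q) = h := by
    intro q
    simp only [P]
    rw [card_image_of_injective _ (part_injective e π _)]; simp
  have hPdisj : ∀ q q', q % m ≠ q' % m → Disjoint (P q) (P q') := by
    intro q q' hqq
    rw [disjoint_left]
    intro x hx hx'
    simp only [P, mem_image, mem_univ, true_and, part] at hx hx'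
    obtain ⟨j, rfl⟩ := hx
    obtain ⟨j', hj'⟩ := hx'
    simp only [EmbeddingLike.apply_eq_iff_eq, Prod.mk.injEq] at hj'
    exact hqq (hinj (Nat.mod_lt _ (by omega)) (Nat.mod_lt _ (by omega)) hj'.1).symm
  have hshift : ∀ q a b, a < m → b < m → (q + a) % m = (q + b) % m → a = b := by
    intro q a b ha hb hab
    have : a ≡ b [MOD m] := Nat.ModEq.add_left_cancel' q hab
    exact Nat.ModEq.eq_of_lt_of_lt this ha hb
  have hedge : ∀ q < m, P q ∪ P (q + 1) ∈ H.edges := by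
    intro q hq
    by_cases hq1 : q + 1 < m
    · have := hadj q hq1
      simp only [P, Nat.mod_eq_of_lt hq, Nat.mod_eq_of_lt hq1]
      exact this
    · have e1 : q = m - 1 := by omega
      have e2 : (q + 1) % m = 0 := by rw [e1, show m - 1 + 1 = m by omega, Nat.mod_self]
      simp only [P, Nat.mod_eq_of_lt hq, e2]
      rw [e1]
      exact hlast
  refine ⟨⟨(range m).image fun q => window f (h + h) (q * h), ?_⟩,
    ⟨f, m, ?_, ?_, ?_⟩, ?_⟩
  · intro E hE
    simp only [mem_image, mem_range] at hE
    obtain ⟨q, hq, rfl⟩ := hE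
    rw [hwin]
    exact H.uniform _ (hedge q hq)
  · rw [Nat.add_sub_cancel]; exact hnm.symm
  · simp
  · intro q hq
    rw [Nat.add_sub_cancel, hwin, hwin]
    have : (P q ∪ P (q + 1)) ∩ (P (q + 1) ∪ P (q + 1 + 1)) = P (q + 1) := by
      have d1 : Disjoint (P q) (P (q + 1)) := hPdisj _ _ fun h => by
        have := hshift q 0 1 (by omega) (by omega) (by simpa using h); omega
      have d2 : Disjoint (P q) (P (q + 1 + 1)) := hPdisj _ _ fun h => by
        have := hshift q 0 2 (by omega) (by omega) (by simpa using h); omega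
      ext x
      have t1 : x ∈ P q → x ∉ P (q + 1) := fun hx => disjoint_left.1 d1 hx
      have t2 : x ∈ P q → x ∉ P (q + 1 + 1) := fun hx => disjoint_left.1 d2 hx
      simp only [mem_inter, mem_union]
      tauto
    rw [this, hPcard]
  · intro E hE
    simp only [mem_image, mem_range] at hE
    obtain ⟨q, hq, rfl⟩ := hE
    rw [hwin]
    exact hedge q hq

end Cycle

section Robust

theorem card_filter_le_of_freq_le {m : ℕ} (p : Fin m → Prop) (c : ℝ) (hp : c ≤ freq p) :
    c * m ≤ #{a | p a} := by
  rcases Nat.eq_zero_or_pos m with rfl | hm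
  · simp
  · unfold freq at hp
    rw [Fintype.card_fin, le_div_iff₀ (by exact_mod_cast hm)] at hp
    exact hp

theorem card_filter_pair_le_of_freq_le {m : ℕ} (p : Fin m × Fin m → Prop) (c : ℝ)
    (hp : c ≤ freq p) : c * (m : ℝ) ^ 2 ≤ #{a | p a} := by
  rcases Nat.eq_zero_or_pos m with rfl | hm
  · simp
  · unfold freq at hp
    rw [Fintype.card_prod, Fintype.card_fin, le_div_iff₀ (by positivity)] at hp
    push_cast at hp
    nlinarith

theorem exists_mem_card_filter_mul_le {α β : Type*} (S : Finset α) (T : Finset β) (hS : S.Nonempty)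
    (Q : α → β → Prop) : ∃ a ∈ S, #S * #{b ∈ T | Q a b} ≤ #{p ∈ S ×ˢ T | Q p.1 p.2} := by
  rw [card_filter_product_eq_sum]
  by_contra! hcon
  have h1 : ∑ a ∈ S, ∑ x ∈ S, #{b ∈ T | Q x b} < ∑ a ∈ S, #S * #{b ∈ T | Q a b} :=
    sum_lt_sum_of_nonempty hS hcon
  rw [sum_const, ← mul_sum, smul_eq_mul] at h1
  exact lt_irrefl _ h1

/-- If no vertex neighbourhood comes close to witnessing an independent half or a sparse cut, then
no set of about half of the vertices is nearly independent or nearly separated. -/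
theorem SimpleGraph.robust_of_neighborhoods {m : ℕ} (G : SimpleGraph (Fin m)) (g β : ℝ)
    (hgm : 1000 * g ≤ m) (hg0 : 0 ≤ g) (hβg : 2 * g ≤ β * m) (hm : 0 < m)
    (hdeg : ∀ a, (m : ℝ) / 2 - g ≤ #{b | G.Adj a b})
    (h1 : ∀ a, (m : ℝ) / 2 + 5 * β * m < #{b | G.Adj a b} ∨
      10 * β * (m : ℝ) ^ 2 < #{p : Fin m × Fin m | ¬ G.Adj a p.1 ∧ ¬ G.Adj a p.2 ∧ G.Adj p.1 p.2})
    (h2 : ∀ a, (m : ℝ) / 2 + 5 * β * m < #{b | G.Adj a b} ∨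
      10 * β * (m : ℝ) ^ 2 < #{p : Fin m × Fin m | G.Adj a p.1 ∧ ¬ G.Adj a p.2 ∧ G.Adj p.1 p.2})
    (D : Finset (Fin m)) (hD : |(#D : ℝ) - m / 2| ≤ g) :
    β * (m : ℝ) ^ 2 < #{p ∈ D ×ˢ D | G.Adj p.1 p.2} ∧
      β * (m : ℝ) ^ 2 < #{p ∈ D ×ˢ (univ \ D) | G.Adj p.1 p.2} := by
  have hmR : (0 : ℝ) < m := by exact_mod_cast hm
  have hD' := abs_le.1 hD
  have hDpos : (m : ℝ) / 3 ≤ #D := by linarith [hD'.1]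
  have hβ0 : 0 ≤ β := by nlinarith
  have hDne : D.Nonempty := by
    rw [← card_pos]
    have : (0 : ℝ) < #D := by linarith
    exact_mod_cast this
  have hcompl : (#(univ \ D) : ℝ) = m - #D := by
    rw [← compl_eq_univ_sdiff, card_compl, Nat.cast_sub (card_le_univ _), Fintype.card_fin]
  -- a vertex of `D` with few neighbours in a given set
  have hvert : ∀ T : Finset (Fin m), (#{p ∈ D ×ˢ T | G.Adj p.1 p.2} : ℝ) ≤ β * (m : ℝ) ^ 2 →
      ∃ a ∈ D, (#{b ∈ T | G.Adj a b} : ℝ) ≤ 3 * β * m := by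
    intro T hT
    obtain ⟨a, ha, hle⟩ := exists_mem_card_filter_mul_le D T hDne G.Adj
    refine ⟨a, ha, ?_⟩
    have h3 : (#D : ℝ) * #{b ∈ T | G.Adj a b} ≤ β * (m : ℝ) ^ 2 :=
      le_trans (by exact_mod_cast hle) hT
    have h4 : (m : ℝ) / 3 * #{b ∈ T | G.Adj a b} ≤ β * (m : ℝ) ^ 2 :=
      (mul_le_mul_of_nonneg_right hDpos (by positivity)).trans h3
    have h5 : (m : ℝ) * #{b ∈ T | G.Adj a b} ≤ m * (3 * β * m) := by nlinarith
    exact le_of_mul_le_mul_left h5 hmR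
  -- comparison of the neighbourhood of `a` with the complement of that set
  have hcmp : ∀ (T : Finset (Fin m)) (a : Fin m), (#(univ \ T) : ℝ) ≤ m / 2 + g →
      (#{b ∈ T | G.Adj a b} : ℝ) ≤ 3 * β * m →
      (#{b | G.Adj a b} : ℝ) ≤ m / 2 + 4 * β * m ∧
      (#{b ∈ univ \ T | ¬ G.Adj a b} : ℝ) ≤ 4 * β * m := by
    intro T a hT ha
    have e1 : #{b | G.Adj a b} = #{b ∈ T | G.Adj a b} + #{b ∈ univ \ T | G.Adj a b} := by
      rw [← card_union_of_disjoint]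
      · congr 1
        ext b; simp only [mem_filter, mem_univ, true_and, mem_union, mem_sdiff]; tauto
      · refine Finset.disjoint_left.2 fun b => ?_
        simp only [mem_filter, mem_sdiff]; tauto
    have e2 := card_filter_add_card_filter_not (s := univ \ T) (fun b => G.Adj a b)
    have e1R : (#{b | G.Adj a b} : ℝ) = #{b ∈ T | G.Adj a b} + #{b ∈ univ \ T | G.Adj a b} := by
      exact_mod_cast e1
    have e2R : (#{b ∈ univ \ T | G.Adj a b} : ℝ) + #{b ∈ univ \ T | ¬ G.Adj a b} = #(univ \ T) := by
      exact_mod_cast e2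
    have e3 := hdeg a
    have : (0 : ℝ) ≤ #{b ∈ univ \ T | ¬ G.Adj a b} := by positivity
    constructor <;> linarith
  have hstrip : ∀ S : Finset (Fin m), (#(S ×ˢ (univ : Finset (Fin m))) : ℝ) = #S * m ∧
      (#((univ : Finset (Fin m)) ×ˢ S) : ℝ) = #S * m := by
    intro S
    rw [card_product, card_product]; simp [mul_comm]
  constructor
  · by_contra! hcon
    obtain ⟨a, ha, hle⟩ := hvert D hcon
    obtain ⟨c1, c2⟩ := hcmp D a (by rw [hcompl]; linarith [hD'.1]) hle
    rcases h1 a with h | h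
    · have : 0 ≤ β * m := by positivity
      nlinarith
    · set B : Finset (Fin m) := {b ∈ univ \ D | ¬ G.Adj a b}
      have hsub : ({p : Fin m × Fin m | ¬ G.Adj a p.1 ∧ ¬ G.Adj a p.2 ∧ G.Adj p.1 p.2} :
          Finset (Fin m × Fin m)) ⊆ {p ∈ D ×ˢ D | G.Adj p.1 p.2} ∪ (B ×ˢ univ ∪ univ ×ˢ B) := by
        rintro ⟨b, c⟩ hp
        simp only [mem_filter, mem_univ, true_and, mem_union, mem_product, B, mem_sdiff,
          and_true] at hp ⊢
        tauto
      have h3 := (card_le_card hsub).trans ((card_union_le _ _).trans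
        (Nat.add_le_add_left (card_union_le _ _) _))
      have h4 : (#{p : Fin m × Fin m | ¬ G.Adj a p.1 ∧ ¬ G.Adj a p.2 ∧ G.Adj p.1 p.2} : ℝ) ≤
          #{p ∈ D ×ˢ D | G.Adj p.1 p.2} +
            (#(B ×ˢ (univ : Finset (Fin m))) + #((univ : Finset (Fin m)) ×ˢ B)) := by
        exact_mod_cast h3
      rw [(hstrip B).1, (hstrip B).2] at h4
      nlinarith
  · by_contra! hcon
    obtain ⟨a, ha, hle⟩ := hvert (univ \ D) hcon
    have hsd : univ \ (univ \ D) = D := by ext; simp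
    obtain ⟨c1, c2⟩ := hcmp (univ \ D) a (by rw [hsd]; linarith [hD'.2]) hle
    rw [hsd] at c2
    rcases h2 a with h | h
    · have : 0 ≤ β * m := by positivity
      nlinarith
    · set B : Finset (Fin m) := {b ∈ D | ¬ G.Adj a b}
      set B' : Finset (Fin m) := {b ∈ univ \ D | G.Adj a b}
      have hsub : ({p : Fin m × Fin m | G.Adj a p.1 ∧ ¬ G.Adj a p.2 ∧ G.Adj p.1 p.2} :
          Finset (Fin m × Fin m)) ⊆
            {p ∈ D ×ˢ (univ \ D) | G.Adj p.1 p.2} ∪ (B' ×ˢ univ ∪ univ ×ˢ B) := by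
        rintro ⟨b, c⟩ hp
        simp only [mem_filter, mem_univ, true_and, mem_union, mem_product, B, B', mem_sdiff,
          and_true] at hp ⊢
        tauto
      have h3 := (card_le_card hsub).trans ((card_union_le _ _).trans
        (Nat.add_le_add_left (card_union_le _ _) _))
      have h4 : (#{p : Fin m × Fin m | G.Adj a p.1 ∧ ¬ G.Adj a p.2 ∧ G.Adj p.1 p.2} : ℝ) ≤
          #{p ∈ D ×ˢ (univ \ D) | G.Adj p.1 p.2} +
            (#(B' ×ˢ (univ : Finset (Fin m))) + #((univ : Finset (Fin m)) ×ˢ B)) := by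
        exact_mod_cast h3
      rw [(hstrip B').1, (hstrip B).2] at h4
      nlinarith

/-- A hypergraph in which no tuple neighbourhood comes close to an independent half or a sparse
cut has a Hamilton cycle. -/
theorem KGraph.hasHamiltonCycle_of_robust (h : ℕ) (hh : 0 < h) (δ : ℝ) (hδ : 0 < δ) :
    ∃ γ : ℝ, 0 < γ ∧ ∃ m₀ : ℕ, ∀ m ≥ m₀, ∀ (V : Type*) [Fintype V] [DecidableEq V]
      (_ : Fin m × Fin h ≃ V) (H : KGraph V (h + h)),
      (∀ z : Fin h → V, Injective z → 1 / 2 - γ ≤ freq fun t => H.PairEdge z t) →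
      (∀ z : Fin h → V, Injective z → (1 / 2 + δ ≤ freq fun t => H.PairEdge z t) ∨
        δ ≤ freq fun p : (Fin h → V) × (Fin h → V) =>
          ¬ H.PairEdge z p.1 ∧ ¬ H.PairEdge z p.2 ∧ H.PairEdge p.1 p.2) →
      (∀ z : Fin h → V, Injective z → (1 / 2 + δ ≤ freq fun t => H.PairEdge z t) ∨
        δ ≤ freq fun p : (Fin h → V) × (Fin h → V) =>
          H.PairEdge z p.1 ∧ ¬ H.PairEdge z p.2 ∧ H.PairEdge p.1 p.2) →
      H.HasHamiltonCycle h := by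
  obtain ⟨γ, hγ, hγδ, hγ1⟩ : ∃ γ : ℝ, 0 < γ ∧ 3000 * γ ≤ δ ∧ 2000 * γ ≤ 1 :=
    ⟨min (δ / 3000) (1 / 2000), by positivity,
      by linarith [min_le_left (δ / 3000) (1 / 2000 : ℝ)],
      by linarith [min_le_right (δ / 3000) (1 / 2000 : ℝ)]⟩
  obtain ⟨m₁, hm₁⟩ := exists_perm_sampling h hh γ hγ
  refine ⟨γ, hγ, max m₁ (max 3 ⌈1 / (2 * γ)⌉₊), ?_⟩
  intro m hm V _ _ e H hdeg h1 h2
  have hm3 : 3 ≤ m := (le_max_left _ _).trans ((le_max_right _ _).trans hm)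
  have hmγ : 1 ≤ 2 * γ * m := by
    have : 1 / (2 * γ) ≤ m := (Nat.le_ceil _).trans
      (by exact_mod_cast (le_max_right _ _).trans ((le_max_right _ _).trans hm))
    rw [div_le_iff₀ (by positivity)] at this; linarith
  have hmR : (0 : ℝ) < m := by positivity
  have hmpos : 0 < m := by omega
  have : Nonempty (Fin m) := ⟨⟨0, hmpos⟩⟩
  let φ : (Fin h → V) × Fin 3 → (Fin h → V) × (Fin h → V) → Prop := fun z p =>
    match z.2 with
    | 0 => H.PairEdge z.1 p.2
    | 1 => ¬ H.PairEdge z.1 p.1 ∧ ¬ H.PairEdge z.1 p.2 ∧ H.PairEdge p.1 p.2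
    | 2 => H.PairEdge z.1 p.1 ∧ ¬ H.PairEdge z.1 p.2 ∧ H.PairEdge p.1 p.2
  obtain ⟨π, hπ⟩ := hm₁ m ((le_max_left _ _).trans hm) V e ((Fin h → V) × Fin 3) φ
    (by rw [Fintype.card_prod, Fintype.card_fin]; omega)
  have : Nonempty V := ⟨e (⟨0, hmpos⟩, ⟨0, hh⟩)⟩
  have s0 : ∀ z : Fin h → V, freq (fun t => H.PairEdge z t) - γ ≤
      freq (fun a => H.PairEdge z (part e π a)) := by
    intro z
    have := hπ (z, 0)
    simp only [φ] at this
    rw [freq_snd (fun t => H.PairEdge z t),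
      freq_snd (fun a => H.PairEdge z (part e π a))] at this
    exact this
  set G := H.partGraph hh e π with hG
  have hadj : ∀ a b, G.Adj a b ↔ H.PairEdge (part e π a) (part e π b) := fun a b => Iff.rfl
  apply H.hasHamiltonCycle_of_partGraph hh hm3 e π
  rw [← hG]
  have d0 : ∀ a, (m : ℝ) / 2 - 2 * γ * m ≤ #{b | G.Adj a b} := by
    intro a
    have h3 : (freq fun t => H.PairEdge (part e π a) t) - γ ≤ freq (fun b => G.Adj a b) :=
      s0 (part e π a)
    have h4 := hdeg _ (part_injective e π a)
    have h5 := card_filter_le_of_freq_le _ (1 / 2 - 2 * γ) (by linarith :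
      1 / 2 - 2 * γ ≤ freq (fun b => G.Adj a b))
    linarith
  have dbig : ∀ a, (1 / 2 + δ ≤ freq fun t => H.PairEdge (part e π a) t) →
      (m : ℝ) / 2 + 5 * (280 * γ) * m < #{b | G.Adj a b} := by
    intro a ha
    have h3 : (freq fun t => H.PairEdge (part e π a) t) - γ ≤ freq (fun b => G.Adj a b) :=
      s0 (part e π a)
    have h5 := card_filter_le_of_freq_le _ (1 / 2 + 2999 * γ) (by linarith :
      1 / 2 + 2999 * γ ≤ freq (fun b => G.Adj a b))
    have : 0 < γ * m := by positivity
    linarith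
  refine SimpleGraph.hasHamCycle_of_robust G (2 * γ * m) (280 * γ) hmγ ?_ ?_ ?_ ?_
  · rw [Fintype.card_fin]; nlinarith
  · rw [Fintype.card_fin]; linarith
  · rw [Fintype.card_fin]; exact d0
  · rw [Fintype.card_fin]
    have hp : 0 < γ * m := by positivity
    have hp2 : 0 < γ * (m : ℝ) ^ 2 := by positivity
    refine SimpleGraph.robust_of_neighborhoods G (2 * γ * m) (280 * γ) (by nlinarith)
      (by positivity) (by nlinarith) hmpos d0 ?_ ?_
    · intro a
      rcases h1 _ (part_injective e π a) with h3 | h3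
      · exact Or.inl (dbig a h3)
      · right
        have h4 := hπ (part e π a, 1)
        simp only [φ] at h4
        have h6 : 2999 * γ ≤ freq (fun p : Fin m × Fin m =>
            ¬ G.Adj a p.1 ∧ ¬ G.Adj a p.2 ∧ G.Adj p.1 p.2) :=
          le_trans (by linarith) h4
        have h5 := card_filter_pair_le_of_freq_le _ (2999 * γ) h6
        refine lt_of_lt_of_le (b := 2999 * γ * (m : ℝ) ^ 2) (by nlinarith) (h5.trans_eq ?_)
        congr!
    · intro a
      rcases h2 _ (part_injective e π a) with h3 | h3
      · exact Or.inl (dbig a h3)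
      · right
        have h4 := hπ (part e π a, 2)
        simp only [φ] at h4
        have h6 : 2999 * γ ≤ freq (fun p : Fin m × Fin m =>
            G.Adj a p.1 ∧ ¬ G.Adj a p.2 ∧ G.Adj p.1 p.2) :=
          le_trans (by linarith) h4
        have h5 := card_filter_pair_le_of_freq_le _ (2999 * γ) h6
        refine lt_of_lt_of_le (b := 2999 * γ * (m : ℝ) ^ 2) (by nlinarith) (h5.trans_eq ?_)
        congr!

end Robust

section Barrier

/-- The indicator function of `X`. -/
noncomputable def indic {α : Type*} (X : α → Prop) (s : α) : ℤ := if X s then 1 else 0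

theorem indic_eq_zero_or_one {α : Type*} (X : α → Prop) (s : α) :
    indic X s = 0 ∨ indic X s = 1 := by
  unfold indic; split_ifs <;> simp

theorem le_freq_indic_ne {α : Type*} [Fintype α] [Nonempty α] (X : α → Prop) (κ : ℝ)
    (h1 : κ ≤ freq X) (h2 : freq X ≤ 1 - κ) (c : ℤ) : κ ≤ freq (fun s => indic X s ≠ c) := by
  by_cases hc : c = 1
  · have h3 : freq (fun s => ¬ X s) ≤ freq (fun s => indic X s ≠ c) :=
      freq_mono fun s hs => by simp [indic, hs, hc]
    rw [freq_not] at h3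
    linarith
  · exact h1.trans (freq_mono fun s hs => by simpa [indic, hs] using Ne.symm hc)

/-- The indicator function of a set of tuples of intermediate density is far from additive:
some exchange of entries changes the number of members of the set. -/
theorem exists_lt_freq_exchange_ne (h : ℕ) (hh : 2 ≤ h) :
    ∃ ξ : ℝ, 0 < ξ ∧ ∀ (V : Type*) [Fintype V] [Nonempty V] (X : (Fin h → V) → Prop),
      1 / 4 ≤ freq X → freq X ≤ 3 / 4 → ∀ i₀ : Fin h, ∃ i : Fin h,
      ξ < freq (fun z : (Fin h → V) × (Fin h → V) => indic X z.1 + indic X z.2 ≠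
        indic X (exchange i i₀ z).1 + indic X (exchange i i₀ z).2) := by
  have hhR : (2 : ℝ) ≤ h := by exact_mod_cast hh
  obtain ⟨ρ, hρ⟩ : ∃ ρ : ℝ, ρ = 1 / (16 * h) := ⟨_, rfl⟩
  have hρ0 : 0 < ρ := by rw [hρ]; positivity
  have hhρ : h * ρ = 1 / 16 := by rw [hρ]; field_simp
  refine ⟨min (ρ ^ h) (1 / 16) / (2 * h ^ 2), by positivity, ?_⟩
  intro V _ _ X hX1 hX2 i₀
  by_contra! hcon
  obtain ⟨b, C, hbC⟩ := exists_additive_approx (indic X) i₀ _ hcon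
  have hκ : (h : ℝ) ^ 2 * (min (ρ ^ h) (1 / 16) / (2 * h ^ 2)) = min (ρ ^ h) (1 / 16) / 2 := by
    field_simp
  rw [hκ] at hbC
  have hpos : 0 < min (ρ ^ h) (1 / 16) := by positivity
  have hm1 := min_le_left (ρ ^ h) (1 / 16)
  have hm2 := min_le_right (ρ ^ h) (1 / 16)
  set α : V → Prop := fun v => X (update b i₀ v) with hα
  have hall : ∀ (q : V → Prop) (c : ℤ), (∀ s : Fin h → V, (∀ j, q (s j)) →
      C + ∑ j, indic X (update b i₀ (s j)) = c) → freq (fun s => indic X s ≠ c) ≤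
        min (ρ ^ h) (1 / 16) / 2 + (1 - freq q ^ h) := by
    intro q c hq
    have h1 := freq_pi (ι := Fin h) q
    rw [Fintype.card_fin] at h1
    rw [← h1, ← freq_not]
    refine (freq_le_add ?_).trans (add_le_add_left hbC _)
    intro s hs
    by_cases h2 : ∀ j, q (s j)
    · left; rw [hq s h2]; exact hs
    · exact Or.inr h2
  have hconst : ∀ (q : V → Prop) (c : ℤ), (∀ s : Fin h → V, (∀ j, q (s j)) →
      C + ∑ j, indic X (update b i₀ (s j)) = c) → ρ < 1 - freq q := by
    intro q c hq
    by_contra! hcon2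
    have h1 := hall q c hq
    have h2 := one_add_mul_le_pow (a := freq q - 1) (by linarith [freq_nonneg q]) h
    have h3 := le_freq_indic_ne X (1 / 4) hX1 (by linarith) c
    have h4 : 1 + (freq q - 1) = freq q := by ring
    rw [h4] at h2
    nlinarith
  have hex : ∀ (q : V → Prop) (c : ℤ), (∀ s : Fin h → V, (∀ j, q (s j)) →
      C + ∑ j, indic X (update b i₀ (s j)) = c) → ρ < freq q → ∃ s, indic X s = c := by
    intro q c hq hlt
    have h1 := hall q c hq
    have h2 : ρ ^ h ≤ freq q ^ h := by gcongr
    obtain ⟨s, hs⟩ := exists_not_of_freq_lt_one (p := fun s => indic X s ≠ c) (by linarith)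
    exact ⟨s, not_not.1 hs⟩
  have e1 : ∀ s : Fin h → V, (∀ j, α (s j)) →
      C + ∑ j, indic X (update b i₀ (s j)) = C + h := by
    intro s hs
    have : ∀ j, indic X (update b i₀ (s j)) = 1 := fun j => if_pos (hs j)
    simp [this]
  have e2 : ∀ s : Fin h → V, (∀ j, ¬ α (s j)) →
      C + ∑ j, indic X (update b i₀ (s j)) = C := by
    intro s hs
    have : ∀ j, indic X (update b i₀ (s j)) = 0 := fun j => if_neg (hs j)
    simp [this]
  have f1 := hconst α _ e1
  have f2 := hconst (fun v => ¬ α v) _ e2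
  have f3 := freq_not α
  obtain ⟨s, hs⟩ := hex α _ e1 (by linarith)
  obtain ⟨t, ht⟩ := hex (fun v => ¬ α v) _ e2 (by linarith)
  have := indic_eq_zero_or_one X s
  have := indic_eq_zero_or_one X t
  omega

theorem exists_lt_freq_exchange_lt (h : ℕ) (hh : 2 ≤ h) :
    ∃ ξ : ℝ, 0 < ξ ∧ ∀ (V : Type*) [Fintype V] [Nonempty V] (X : (Fin h → V) → Prop),
      1 / 4 ≤ freq X → freq X ≤ 3 / 4 → ∀ i₀ : Fin h, ∃ i : Fin h,
      ξ < freq (fun z : (Fin h → V) × (Fin h → V) =>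
        indic X (exchange i i₀ z).1 + indic X (exchange i i₀ z).2 <
          indic X z.1 + indic X z.2) := by
  obtain ⟨ξ, hξ, hX⟩ := exists_lt_freq_exchange_ne h hh
  refine ⟨ξ / 2, by positivity, fun V _ _ X h1 h2 i₀ => ?_⟩
  obtain ⟨i, hi⟩ := hX V X h1 h2 i₀
  refine ⟨i, ?_⟩
  set q : (Fin h → V) × (Fin h → V) → Prop := fun z =>
    indic X (exchange i i₀ z).1 + indic X (exchange i i₀ z).2 <
      indic X z.1 + indic X z.2 with hq
  have h3 := freq_exchange i i₀ q
  have h4 := hi.trans_le (freq_le_add (q := q) (r := fun z => q (exchange i i₀ z)) fun z hz => by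
    simp only [hq, exchange_involutive i i₀ z]
    exact (lt_or_gt_of_ne hz).symm)
  linarith

/-- A reverse Markov inequality for fibres. -/
theorem freq_le_freq_fiber_gt_add {α β : Type*} [Fintype α] [Fintype β] [Nonempty α]
    (p : α × β → Prop) (c : ℝ) (hc0 : 0 ≤ c) :
    freq p ≤ freq (fun x => c < freq fun y => p (x, y)) + c := by
  have hc : (0 : ℝ) < Fintype.card α := by exact_mod_cast Fintype.card_pos
  rw [freq_prod p, freq_eq_sum (fun x => c < freq fun y => p (x, y)), div_add' _ _ _ hc.ne']
  gcongr
  have : c * (Fintype.card α : ℝ) = ∑ _x : α, c := by simp [mul_comm]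
  rw [this, ← sum_add_distrib]
  refine sum_le_sum fun x _ => ?_
  split_ifs with hx
  · linarith [freq_le_one fun y => p (x, y)]
  · linarith

theorem freq_or_of_disjoint {α : Type*} [Fintype α] (p q : α → Prop) (hpq : ∀ x, p x → ¬ q x) :
    freq (fun x => p x ∨ q x) = freq p + freq q := by
  rw [freq_eq_sum, freq_eq_sum, freq_eq_sum, ← add_div, ← sum_add_distrib]
  congr 1
  refine sum_congr rfl fun x _ => ?_
  have := hpq x
  by_cases h1 : p x <;> by_cases h2 : q x <;> simp_all

/-- A graph whose vertex set splits into a part `X` slightly smaller than half and its complement,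
with almost all edges between them and many edges inside the complement, is Hamiltonian. -/
theorem SimpleGraph.hasHamCycle_of_nearly_bipartite {m : ℕ} (hm : 3 ≤ m) (G : SimpleGraph (Fin m))
    (X : Fin m → Prop) (β η : ℝ) (hβ : 0 < β) (hβη : 5000 * β ≤ η) (hmβ : 1 ≤ β * m)
    (hX1 : 1 / 2 - 5 * β ≤ freq X) (hX2 : freq X ≤ 1 / 2 - β / 2)
    (hdeg : ∀ a, 1 / 2 - 5 * β ≤ freq fun b => G.Adj a b)
    (hY : η / 4 ≤ freq fun p : Fin m × Fin m => ¬ X p.1 ∧ ¬ X p.2 ∧ G.Adj p.1 p.2)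
    (hmiss : freq (fun p : Fin m × Fin m => (¬ (X p.1 ↔ X p.2)) ∧ ¬ G.Adj p.1 p.2) ≤
      30 * β ^ 2) : G.HasHamCycle := by
  have hmpos : 0 < m := by omega
  have hmR : (0 : ℝ) < m := by exact_mod_cast hmpos
  have : Nonempty (Fin m) := ⟨⟨0, hmpos⟩⟩
  set M : Fin m × Fin m → Prop := fun p => (¬ (X p.1 ↔ X p.2)) ∧ ¬ G.Adj p.1 p.2 with hM
  set f : Fin m → ℝ := fun a => freq fun b => M (a, b) with hf
  set g : Fin m → ℝ := fun a => freq fun b => ¬ X a ∧ ¬ X b ∧ G.Adj a b with hg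
  let K₁ : Fin m → Prop := fun a => X a ∧ f a ≤ β / 4
  let K₂ : Fin m → Prop := fun a => η / 8 < g a ∧ f a ≤ η / 16
  have hη : 0 < η := by linarith
  have hYX := freq_not X
  have hY0 : ∀ a, η / 8 < g a → ¬ X a := by
    intro a ha hXa
    have : g a = 0 := by
      simp only [hg, hXa, not_true_eq_false, false_and]
      exact freq_false
    linarith
  have hmark : ∀ c : ℝ, 0 < c → freq (fun a => c < f a) ≤ 30 * β ^ 2 / c := by
    intro c hc
    rw [le_div_iff₀ hc]
    exact (freq_fiber_gt_mul_le M c).trans hmiss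
  have hK₁ : 1 / 2 - 125 * β ≤ freq K₁ := by
    have h1 : freq X ≤ freq K₁ + freq (fun a => β / 4 < f a) := freq_le_add fun a ha => by
      rcases le_or_gt (f a) (β / 4) with h | h
      · exact Or.inl ⟨ha, h⟩
      · exact Or.inr h
    have h2 := hmark (β / 4) (by positivity)
    have h3 : 30 * β ^ 2 / (β / 4) = 120 * β := by field_simp; norm_num
    linarith
  have hK₂ : η / 8 - β ≤ freq K₂ := by
    have h0 := freq_le_freq_fiber_gt_add (fun p : Fin m × Fin m =>
      ¬ X p.1 ∧ ¬ X p.2 ∧ G.Adj p.1 p.2) (η / 8) (by positivity)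
    have h1 : freq (fun a => η / 8 < g a) ≤ freq K₂ + freq (fun a => η / 16 < f a) :=
      freq_le_add fun a ha => by
        rcases le_or_gt (f a) (η / 16) with h | h
        · exact Or.inl ⟨ha, h⟩
        · exact Or.inr h
    have h2 := hmark (η / 16) (by positivity)
    have h3 : 30 * β ^ 2 / (η / 16) ≤ β := by
      rw [div_le_iff₀ (by positivity)]
      nlinarith
    have h4 : freq (fun a => η / 8 < freq fun b => ¬ X a ∧ ¬ X b ∧ G.Adj a b) =
      freq (fun a => η / 8 < g a) := rfl
    linarith
  set K : Finset (Fin m) := {a | K₁ a ∨ K₂ a} with hK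
  have hKcard : (1 / 2 + η / 16) * m ≤ #K := by
    have h1 := freq_or_of_disjoint K₁ K₂ fun a ha hb => hY0 a hb.1 ha.1
    refine (card_filter_le_of_freq_le (fun a => K₁ a ∨ K₂ a) (1 / 2 + η / 16)
      (by linarith)).trans_eq ?_
    rw [hK]
    congr!
  have hhalf : ∀ a ∈ K, 1 / 2 ≤ freq fun b => G.Adj a b := by
    intro a ha
    simp only [hK, mem_filter, mem_univ, true_and] at ha
    rcases ha with ha | ha
    · have h1 : freq (fun b => ¬ X b) ≤ freq (fun b => G.Adj a b) + f a :=
        freq_le_add fun b hb => by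
          by_cases hab : G.Adj a b
          · exact Or.inl hab
          · exact Or.inr ⟨by simp [ha.1, hb], hab⟩
      linarith [ha.2]
    · have hXa := hY0 a ha.1
      have h1 : freq (fun b => X b) ≤ freq (fun b => X b ∧ G.Adj a b) + f a :=
        freq_le_add fun b hb => by
          by_cases hab : G.Adj a b
          · exact Or.inl ⟨hb, hab⟩
          · exact Or.inr ⟨by simp [hXa, hb], hab⟩
      have h2 : freq (fun b => X b ∧ G.Adj a b) + g a = freq fun b => G.Adj a b := by
        rw [hg, ← freq_or_of_disjoint _ _ fun b hb hb' => hb'.2.1 hb.1]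
        exact freq_congr fun b => by tauto
      linarith [ha.1, ha.2]
  have hcount : ∀ (a : Fin m) (c : ℝ), (c ≤ freq fun b => G.Adj a b) →
      c * m ≤ #{b | G.Adj a b} := fun a c hc => card_filter_le_of_freq_le _ _ hc
  refine hasHamCycle_of_large_degrees (by simpa using hm) G K ⌈(1 / 2 - 5 * β) * m⌉₊ ?_ ?_ ?_ ?_
  · intro a ha
    have h1 := hcount a _ (hhalf a ha)
    rw [Fintype.card_fin]
    have : (m : ℝ) ≤ 2 * #{b | G.Adj a b} := by linarith
    exact_mod_cast this
  · intro a
    exact Nat.ceil_le.2 (hcount a _ (hdeg a))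
  · rw [Fintype.card_fin]
    have h1 := Nat.le_ceil ((1 / 2 - 5 * β) * (m : ℝ))
    have : (m : ℝ) + 1 ≤ #K + ⌈(1 / 2 - 5 * β) * (m : ℝ)⌉₊ := by nlinarith
    exact_mod_cast this
  · rw [Fintype.card_fin]
    have : (m : ℝ) + 1 ≤ 2 * #K := by nlinarith
    exact_mod_cast this

variable {V : Type*} [DecidableEq V] {m h : ℕ}

theorem part_swap_eq_exchange (e : Fin m × Fin h ≃ V) (π : Equiv.Perm V) (a b : Fin m)
    (hab : a ≠ b) (i j : Fin h) :
    (part e (Equiv.swap (part e π a i) (part e π b j) * π) a,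
      part e (Equiv.swap (part e π a i) (part e π b j) * π) b) =
      exchange i j (part e π a, part e π b) := by
  have hne : ∀ i' j', part e π a i' ≠ part e π b j' := by
    intro i' j' hcon
    simp only [part, EmbeddingLike.apply_eq_iff_eq, Prod.mk.injEq] at hcon
    exact hab hcon.1
  have hinj : ∀ (c : Fin m) i' j', i' ≠ j' → part e π c i' ≠ part e π c j' := by
    intro c i' j' hij hcon
    simp only [part, EmbeddingLike.apply_eq_iff_eq, Prod.mk.injEq] at hcon
    exact hij hcon.2
  have hrw : ∀ x y c l, part e (Equiv.swap x y * π) c l = Equiv.swap x y (part e π c l) :=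
    fun _ _ _ _ => rfl
  refine Prod.ext ?_ ?_
  · funext l
    simp only [exchange, hrw]
    by_cases hl : l = i
    · subst hl; simp
    · rw [update_of_ne hl, Equiv.swap_apply_of_ne_of_ne (hinj a _ _ hl) (hne _ _)]
  · funext l
    simp only [exchange, hrw]
    by_cases hl : l = j
    · subst hl; simp
    · rw [update_of_ne hl, Equiv.swap_apply_of_ne_of_ne (hne _ _).symm (hinj b _ _ hl)]

/-- One improving swap of two entries of a partition into tuples. -/
theorem exists_improving_swap (e : Fin m × Fin h ≃ V) (π : Equiv.Perm V) (X T : (Fin h → V) → Prop)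
    (i j : Fin h) (hφ : 1 / (m : ℝ) < freq fun p : Fin m × Fin m =>
      (indic X (exchange i j (part e π p.1, part e π p.2)).1 +
        indic X (exchange i j (part e π p.1, part e π p.2)).2 <
          indic X (part e π p.1) + indic X (part e π p.2)) ∧
      T (exchange i j (part e π p.1, part e π p.2)).1 ∧
      T (exchange i j (part e π p.1, part e π p.2)).2) :
    ∃ x y a b, a ≠ b ∧ (∀ c, c ≠ a → c ≠ b → part e (Equiv.swap x y * π) c = part e π c) ∧
      T (part e (Equiv.swap x y * π) a) ∧ T (part e (Equiv.swap x y * π) b) ∧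
      freq (fun c => X (part e (Equiv.swap x y * π) c)) + 1 / m ≤
        freq (fun c => X (part e π c)) := by
  have hdiag : freq (fun p : Fin m × Fin m => p.1 = p.2) ≤ 1 / m := by
    rcases Nat.eq_zero_or_pos m with rfl | hm
    · simp [freq]
    rw [freq_prod]
    have : ∀ x : Fin m, freq (fun y => x = y) = 1 / m := fun x => by
      rw [← freq_fin_eq x]; exact freq_congr fun y => eq_comm
    simp only [this, sum_const, card_univ, Fintype.card_fin, nsmul_eq_mul]
    have : (m : ℝ) ≠ 0 := by positivity
    field_simp
    rfl
  obtain ⟨⟨a, b⟩, hab⟩ : ∃ p : Fin m × Fin m,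
      ¬ ((indic X (exchange i j (part e π p.1, part e π p.2)).1 +
        indic X (exchange i j (part e π p.1, part e π p.2)).2 <
          indic X (part e π p.1) + indic X (part e π p.2)) ∧
      T (exchange i j (part e π p.1, part e π p.2)).1 ∧
      T (exchange i j (part e π p.1, part e π p.2)).2 → p.1 = p.2) := by
    by_contra! hcon
    exact absurd hφ (not_lt.2 (le_trans (freq_mono fun p hp => hcon p hp) hdiag))
  obtain ⟨hφab, hne⟩ := Classical.not_imp.1 hab
  simp only at hne hφab
  have hex := part_swap_eq_exchange e π a b hne i j
  rw [← hex] at hφab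
  obtain ⟨hlt, hT1, hT2⟩ := hφab
  dsimp only at hlt
  have hfix : ∀ c, c ≠ a → c ≠ b →
      part e (Equiv.swap (part e π a i) (part e π b j) * π) c = part e π c := by
    intro c hca hcb
    apply part_swap_of_ne
    · simpa [partIndex, part] using hca
    · simpa [partIndex, part] using hcb
  refine ⟨part e π a i, part e π b j, a, b, hne, hfix, hT1, hT2, ?_⟩
  · have hs : (∑ c, indic X (part e (Equiv.swap (part e π a i) (part e π b j) * π) c)) + 1 ≤
        ∑ c, indic X (part e π c) := by
      rw [← sub_nonneg, add_comm, ← sub_sub, sub_right_comm, ← sum_sub_distrib,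
        Fintype.sum_eq_add a b hne]
      · linarith
      · rintro c ⟨hca, hcb⟩
        rw [hfix c hca hcb, sub_self]
    have hcard : ∀ σ : Equiv.Perm V, freq (fun c => X (part e σ c)) =
        ((∑ c, indic X (part e σ c) : ℤ) : ℝ) / m := by
      intro σ
      rw [freq_eq_sum, Fintype.card_fin]
      simp [indic]
    rw [hcard, hcard, ← add_div]
    gcongr
    exact_mod_cast hs

end Barrier

section Swaps
variable {V : Type*} [DecidableEq V] {m h : ℕ}

/-- Iterating improving swaps decreases the number of parts in `X` and changes the other statistics
of the partition only slightly. -/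
theorem exists_perm_of_improving_swaps (hm : 0 < m) (e : Fin m × Fin h ≃ V) (π₀ : Equiv.Perm V)
    (X T : (Fin h → V) → Prop) (M : (Fin h → V) → (Fin h → V) → Prop)
    (hM : ∀ s t, M s t → M t s) (i j : Fin h) (R : ℕ) (μ : ℝ)
    (hφ : (4 * R + 1) / (m : ℝ) < freq fun p : Fin m × Fin m =>
      (indic X (exchange i j (part e π₀ p.1, part e π₀ p.2)).1 +
        indic X (exchange i j (part e π₀ p.1, part e π₀ p.2)).2 <
          indic X (part e π₀ p.1) + indic X (part e π₀ p.2)) ∧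
      T (exchange i j (part e π₀ p.1, part e π₀ p.2)).1 ∧
      T (exchange i j (part e π₀ p.1, part e π₀ p.2)).2)
    (hT : ∀ s, T s → freq (fun a => M s (part e π₀ a)) ≤ μ) (r : ℕ) (hr : r ≤ R) :
    ∃ π : Equiv.Perm V,
      (∀ q : (Fin h → V) → Prop, freq (fun a => q (part e π a)) ≤
        freq (fun a => q (part e π₀ a)) + 2 * r / m) ∧
      (∀ q : (Fin h → V) × (Fin h → V) → Prop,
        freq (fun p : Fin m × Fin m => q (part e π p.1, part e π p.2)) ≤
        freq (fun p : Fin m × Fin m => q (part e π₀ p.1, part e π₀ p.2)) + 4 * r / m) ∧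
      freq (fun a => X (part e π a)) + r / m ≤ freq (fun a => X (part e π₀ a)) ∧
      freq (fun p : Fin m × Fin m => M (part e π p.1) (part e π p.2)) ≤
        freq (fun p : Fin m × Fin m => M (part e π₀ p.1) (part e π₀ p.2)) +
          r * (4 / m * (μ + 2 * R / m)) := by
  have hmR : (0 : ℝ) < m := by exact_mod_cast hm
  have : Nonempty (Fin m) := ⟨⟨0, hm⟩⟩
  induction r with
  | zero => exact ⟨π₀, by simp, by simp, by simp, by simp⟩
  | succ r ih =>
    obtain ⟨π, h1, h2, h3, h4⟩ := ih (by omega)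
    have hrR : (r : ℝ) + 1 ≤ R := by exact_mod_cast hr
    set Φ : (Fin h → V) × (Fin h → V) → Prop := fun z =>
      (indic X (exchange i j z).1 + indic X (exchange i j z).2 < indic X z.1 + indic X z.2) ∧
      T (exchange i j z).1 ∧ T (exchange i j z).2 with hΦ
    have hφ' : 1 / (m : ℝ) < freq fun p : Fin m × Fin m => Φ (part e π p.1, part e π p.2) := by
      have h5 := h2 fun z => ¬ Φ z
      rw [freq_not, freq_not] at h5
      have h6 : (4 * R + 1) / (m : ℝ) < freq fun p : Fin m × Fin m =>
        Φ (part e π₀ p.1, part e π₀ p.2) := hφ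
      have h7 : 1 / (m : ℝ) + 4 * r / m ≤ (4 * R + 1) / (m : ℝ) := by
        rw [← add_div]
        exact div_le_div_of_nonneg_right (by linarith) hmR.le
      linarith
    obtain ⟨x, y, a, b, hab, hfix, hTa, hTb, hX⟩ := exists_improving_swap e π X T i j hφ'
    refine ⟨Equiv.swap x y * π, ?_, ?_, ?_, ?_⟩
    · intro q
      have := freq_part_swap_le e π x y q
      have h5 := h1 q
      push_cast
      rw [mul_add, add_div]
      linarith
    · intro q
      have := freq_pair_part_swap_le e π x y q
      have h5 := h2 q
      push_cast
      rw [mul_add, add_div]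
      linarith
    · push_cast
      rw [add_div]
      linarith
    · set σ := Equiv.swap x y * π with hσ
      have hMT : ∀ c, T (part e σ c) →
          freq (fun d => M (part e σ c) (part e σ d)) ≤ μ + 2 * R / m := by
        intro c hc
        have h5 := freq_part_swap_le e π x y (fun t => M (part e σ c) t)
        have h6 := h1 (fun t => M (part e σ c) t)
        have h7 := hT _ hc
        have h8 : 2 * (r : ℝ) / m + 2 / m ≤ 2 * R / m := by
          rw [← add_div]; gcongr; linarith
        linarith
      have hrow : ∀ c, T (part e σ c) → freq (fun p : Fin m × Fin m =>
          p.1 = c ∧ M (part e σ c) (part e σ p.2)) ≤ 1 / m * (μ + 2 * R / m) := by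
        intro c hc
        rw [freq_and_prod (fun d => d = c) (fun d => M (part e σ c) (part e σ d)), freq_fin_eq]
        have := hMT c hc
        gcongr
      have hcol : ∀ c, T (part e σ c) → freq (fun p : Fin m × Fin m =>
          p.2 = c ∧ M (part e σ c) (part e σ p.1)) ≤ 1 / m * (μ + 2 * R / m) := by
        intro c hc
        rw [← freq_swap]
        exact hrow c hc
      have h5 : freq (fun p : Fin m × Fin m => M (part e σ p.1) (part e σ p.2)) ≤
          freq (fun p : Fin m × Fin m => M (part e π p.1) (part e π p.2)) +
          (freq (fun p : Fin m × Fin m => p.1 = a ∧ M (part e σ a) (part e σ p.2)) +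
          (freq (fun p : Fin m × Fin m => p.1 = b ∧ M (part e σ b) (part e σ p.2)) +
          (freq (fun p : Fin m × Fin m => p.2 = a ∧ M (part e σ a) (part e σ p.1)) +
          freq (fun p : Fin m × Fin m => p.2 = b ∧ M (part e σ b) (part e σ p.1))))) := by
        refine le_trans (freq_le_add fun p hp => ?_) (add_le_add_right (le_trans
          (freq_le_add fun p hp => hp) (add_le_add_right (le_trans
          (freq_le_add fun p hp => hp) (add_le_add_right (
          (freq_le_add fun p hp => hp)) _)) _)) _)
        by_cases ha1 : p.1 = a
        · exact Or.inr (Or.inl ⟨ha1, ha1 ▸ hp⟩)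
        by_cases hb1 : p.1 = b
        · exact Or.inr (Or.inr (Or.inl ⟨hb1, hb1 ▸ hp⟩))
        by_cases ha2 : p.2 = a
        · exact Or.inr (Or.inr (Or.inr (Or.inl ⟨ha2, ha2 ▸ hM _ _ hp⟩)))
        by_cases hb2 : p.2 = b
        · exact Or.inr (Or.inr (Or.inr (Or.inr ⟨hb2, hb2 ▸ hM _ _ hp⟩)))
        rw [hfix _ ha1 hb1, hfix _ ha2 hb2] at hp
        exact Or.inl hp
      have := hrow a hTa
      have := hrow b hTb
      have := hcol a hTa
      have := hcol b hTb
      have h6 : 4 / (m : ℝ) * (μ + 2 * R / m) = 4 * (1 / m * (μ + 2 * R / m)) := by ring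
      push_cast
      rw [add_mul, one_mul]
      linarith

end Swaps

section NearlyBipartite

/-- A hypergraph whose tuples split into two halves `X` and `Xᶜ` with almost all edges between
them and many edges inside `Xᶜ` has a Hamilton cycle. -/
theorem KGraph.hasHamiltonCycle_of_nearly_bipartite (h : ℕ) (hh : 2 ≤ h) (η : ℝ) (hη : 0 < η) :
    ∃ δ : ℝ, 0 < δ ∧ ∃ m₀ : ℕ, ∀ m ≥ m₀, ∀ (V : Type*) [Fintype V] [DecidableEq V]
      (_ : Fin m × Fin h ≃ V) (H : KGraph V (h + h)) (X : (Fin h → V) → Prop),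
      (∀ z : Fin h → V, Injective z → 1 / 2 - δ ≤ freq fun t => H.PairEdge z t) →
      1 / 2 - δ ≤ freq X → freq X ≤ 1 / 2 + δ →
      freq (fun p : (Fin h → V) × (Fin h → V) =>
        (¬ (X p.1 ↔ X p.2)) ∧ ¬ H.PairEdge p.1 p.2) ≤ 8 * δ →
      η ≤ freq (fun p : (Fin h → V) × (Fin h → V) =>
        ¬ X p.1 ∧ ¬ X p.2 ∧ H.PairEdge p.1 p.2) →
      H.HasHamiltonCycle h := by
  have hh0 : 0 < h := by omega
  obtain ⟨ξ, hξ, hξX⟩ := exists_lt_freq_exchange_lt h hh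
  obtain ⟨β, hβ, hβξ, hβη, hβ1⟩ : ∃ β : ℝ, 0 < β ∧ 50 * β ≤ ξ ∧ 5000 * β ≤ η ∧ 1000 * β ≤ 1 := by
    refine ⟨min (ξ / 50) (min (η / 5000) (1 / 1000)), by positivity, ?_, ?_, ?_⟩
    · linarith [min_le_left (ξ / 50) (min (η / 5000) (1 / 1000))]
    · linarith [min_le_right (ξ / 50) (min (η / 5000) (1 / 1000)),
        min_le_left (η / 5000) (1 / 1000 : ℝ)]
    · linarith [min_le_right (ξ / 50) (min (η / 5000) (1 / 1000)),
        min_le_right (η / 5000) (1 / 1000 : ℝ)]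
  obtain ⟨δ, hδdef⟩ : ∃ δ : ℝ, δ = β ^ 2 := ⟨_, rfl⟩
  have hδ : 0 < δ := by rw [hδdef]; positivity
  have hδβ : 1000 * δ ≤ β := by rw [hδdef]; nlinarith
  obtain ⟨m₁, hm₁⟩ := exists_perm_sampling h hh0 δ hδ
  refine ⟨δ, hδ, max m₁ (max 3 ⌈10 / β⌉₊), ?_⟩
  intro m hm V _ _ e H X hdeg hX1 hX2 hmiss hY
  have hm3 : 3 ≤ m := (le_max_left _ _).trans ((le_max_right _ _).trans hm)
  have hmpos : 0 < m := by omega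
  have hmR : (0 : ℝ) < m := by positivity
  have hmβ : 10 ≤ β * m := by
    have : 10 / β ≤ m := (Nat.le_ceil _).trans
      (by exact_mod_cast (le_max_right _ _).trans ((le_max_right _ _).trans hm))
    rw [div_le_iff₀ (by positivity)] at this; linarith
  have : Nonempty (Fin m) := ⟨⟨0, hmpos⟩⟩
  have : Nonempty V := ⟨e (⟨0, hmpos⟩, ⟨0, hh0⟩)⟩
  let i₀ : Fin h := ⟨0, hh0⟩
  obtain ⟨i, hi⟩ := hξX V X (by linarith) (by linarith) i₀
  let M : (Fin h → V) → (Fin h → V) → Prop := fun s t => (¬ (X s ↔ X t)) ∧ ¬ H.PairEdge s t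
  have hMsymm : ∀ s t, M s t → M t s := fun s t hst =>
    ⟨fun hc => hst.1 hc.symm, fun hc => hst.2 ((H.pairEdge_comm _ _).1 hc)⟩
  let T : (Fin h → V) → Prop := fun s => freq (fun t => M s t) ≤ β
  have hTfreq : freq (fun s => ¬ T s) ≤ 8 * β := by
    have h1 := freq_fiber_gt_mul_le (fun p : (Fin h → V) × (Fin h → V) => M p.1 p.2) β
    have h2 : freq (fun s => ¬ T s) = freq fun s => β < freq fun t => M s t :=
      freq_congr fun s => not_le
    have h3 : freq (fun p : (Fin h → V) × (Fin h → V) => M p.1 p.2) ≤ 8 * δ := hmiss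
    rw [h2]
    refine le_of_mul_le_mul_right (h1.trans (h3.trans_eq ?_)) hβ
    rw [hδdef]; ring
  set Φ : (Fin h → V) × (Fin h → V) → Prop := fun z =>
    (indic X (exchange i i₀ z).1 + indic X (exchange i i₀ z).2 < indic X z.1 + indic X z.2) ∧
      T (exchange i i₀ z).1 ∧ T (exchange i i₀ z).2 with hΦ
  have hΦfreq : 34 * β ≤ freq Φ := by
    have h1 : _ ≤ freq Φ + freq (fun z => ¬ T (exchange i i₀ z).1 ∨ ¬ T (exchange i i₀ z).2) :=
      freq_le_add (p := fun z : (Fin h → V) × (Fin h → V) =>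
        indic X (exchange i i₀ z).1 + indic X (exchange i i₀ z).2 <
          indic X z.1 + indic X z.2) fun z hz => by
        by_cases h2 : T (exchange i i₀ z).1 ∧ T (exchange i i₀ z).2
        · exact Or.inl ⟨hz, h2⟩
        · exact Or.inr (by tauto)
    have h2 : freq (fun z => ¬ T (exchange i i₀ z).1 ∨ ¬ T (exchange i i₀ z).2) ≤
        freq (fun z => ¬ T (exchange i i₀ z).1) + freq (fun z => ¬ T (exchange i i₀ z).2) :=
      freq_le_add fun z hz => hz
    rw [freq_exchange i i₀ (fun z => ¬ T z.1), freq_exchange i i₀ (fun z => ¬ T z.2),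
      freq_fst (fun s => ¬ T s), freq_snd (fun s => ¬ T s)] at h2
    linarith
  let φ : ((Fin h → V) × Fin 2) ⊕ Fin 5 → (Fin h → V) × (Fin h → V) → Prop := fun z p =>
    match z with
    | Sum.inl (s, 0) => H.PairEdge s p.2
    | Sum.inl (s, 1) => ¬ M s p.2
    | Sum.inr 0 => X p.2
    | Sum.inr 1 => ¬ X p.2
    | Sum.inr 2 => ¬ X p.1 ∧ ¬ X p.2 ∧ H.PairEdge p.1 p.2
    | Sum.inr 3 => ¬ M p.1 p.2
    | Sum.inr 4 => Φ p
  obtain ⟨π₀, hπ₀⟩ := hm₁ m ((le_max_left _ _).trans hm) V e (((Fin h → V) × Fin 2) ⊕ Fin 5) φ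
    (by
      have : 0 < Fintype.card (Fin h → V) := Fintype.card_pos
      rw [Fintype.card_sum, Fintype.card_prod, Fintype.card_fin, Fintype.card_fin]; omega)
  have s1 : ∀ s : Fin h → V, freq (fun t => H.PairEdge s t) - δ ≤
      freq fun a => H.PairEdge s (part e π₀ a) := by
    intro s
    have := hπ₀ (Sum.inl (s, 0))
    simp only [φ] at this
    rwa [freq_snd (fun t => H.PairEdge s t),
      freq_snd (fun a => H.PairEdge s (part e π₀ a))] at this
  have s2 : ∀ s : Fin h → V, freq (fun a => M s (part e π₀ a)) ≤ freq (fun t => M s t) + δ := by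
    intro s
    have := hπ₀ (Sum.inl (s, 1))
    simp only [φ] at this
    rw [freq_snd (fun t => ¬ M s t), freq_snd (fun a => ¬ M s (part e π₀ a)), freq_not,
      freq_not] at this
    linarith
  have s3 : freq X - δ ≤ freq fun a => X (part e π₀ a) := by
    have := hπ₀ (Sum.inr 0)
    simp only [φ] at this
    rwa [freq_snd (fun t => X t), freq_snd (fun a => X (part e π₀ a))] at this
  have s4 : freq (fun a => X (part e π₀ a)) ≤ freq X + δ := by
    have := hπ₀ (Sum.inr 1)
    simp only [φ] at this
    rw [freq_snd (fun t => ¬ X t), freq_snd (fun a => ¬ X (part e π₀ a)), freq_not,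
      freq_not] at this
    linarith
  have s5 := hπ₀ (Sum.inr 2)
  have s6 := hπ₀ (Sum.inr 3)
  have s7 := hπ₀ (Sum.inr 4)
  simp only [φ] at s5 s6 s7
  rw [freq_not, freq_not] at s6
  set R := ⌈β * m⌉₊ with hR
  obtain ⟨ρ, hρ⟩ : ∃ ρ : ℝ, ρ = R / m := ⟨_, rfl⟩
  have hρ1 : β ≤ ρ := by
    rw [hρ, le_div_iff₀ hmR]; exact Nat.le_ceil _
  have hinv : 1 / (m : ℝ) ≤ β / 10 := by
    rw [div_le_iff₀ hmR]; linarith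
  have hρ2 : ρ ≤ 11 / 10 * β := by
    rw [hρ, div_le_iff₀ hmR]
    have := Nat.ceil_lt_add_one (a := β * m) (by positivity)
    linarith
  obtain ⟨π, p1, p2, p3, p4⟩ := exists_perm_of_improving_swaps hmpos e π₀ X T M hMsymm i i₀ R
    (β + δ) (by
      have h1 : (4 * R + 1) / (m : ℝ) = 4 * ρ + 1 / m := by rw [hρ]; ring
      rw [h1]
      refine lt_of_lt_of_le ?_ s7
      linarith) (fun s hs => (s2 s).trans (by linarith [show freq (fun t => M s t) ≤ β from hs]))
    R le_rfl
  have c2 : 2 * (R : ℝ) / m = 2 * ρ := by rw [hρ]; ring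
  have c4 : 4 * (R : ℝ) / m = 4 * ρ := by rw [hρ]; ring
  have cR : (R : ℝ) * (4 / m * (β + δ + 2 * R / m)) = 4 * ρ * (β + δ + 2 * ρ) := by
    rw [hρ]; ring
  rw [c2] at p1
  rw [c4] at p2
  rw [← hρ] at p3
  rw [cR] at p4
  apply H.hasHamiltonCycle_of_partGraph hh0 hm3 e π
  refine SimpleGraph.hasHamCycle_of_nearly_bipartite hm3 _ (fun a => X (part e π a)) β η hβ hβη
    (by linarith) ?_ (by linarith) ?_ ?_ ?_
  · have h1 := p1 fun s => ¬ X s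
    rw [freq_not, freq_not] at h1
    linarith
  · intro a
    have h1 := p1 fun t => ¬ H.PairEdge (part e π a) t
    rw [freq_not, freq_not] at h1
    have h2 := s1 (part e π a)
    have h3 := hdeg _ (part_injective e π a)
    have h4 : (freq fun b => (H.partGraph hh0 e π).Adj a b) =
      freq fun b => H.PairEdge (part e π a) (part e π b) := rfl
    linarith
  · have h1 := p2 fun z => ¬ (¬ X z.1 ∧ ¬ X z.2 ∧ H.PairEdge z.1 z.2)
    rw [freq_not, freq_not] at h1
    refine le_trans ?_ (le_of_eq_of_le rfl (by linarith : _ ≤ freq fun p : Fin m × Fin m =>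
      ¬ X (part e π p.1) ∧ ¬ X (part e π p.2) ∧ H.PairEdge (part e π p.1) (part e π p.2)))
    linarith
  · have h1 : freq (fun p : (Fin h → V) × (Fin h → V) => M p.1 p.2) ≤ 8 * δ := hmiss
    have h2 : 4 * ρ * (β + δ + 2 * ρ) ≤ 4 * (11 / 10 * β) * (β + β + 2 * (11 / 10 * β)) := by
      have : δ ≤ β := by linarith
      have : 0 ≤ ρ := by linarith
      gcongr
    have h3 : (freq fun p : Fin m × Fin m => M (part e π p.1) (part e π p.2)) ≤ 30 * β ^ 2 := by
      nlinarith
    exact h3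

end NearlyBipartite

section Nonextremal
variable {V : Type*} [Fintype V] [DecidableEq V] {h : ℕ}

/-- If almost every tuple has large degree, then few non-edges from `P` to a set `Q` of about half
of the tuples follow from few edges from `P` to the complement of `Q`. -/
theorem KGraph.freq_not_pairEdge_le (H : KGraph V (h + h)) (γ c : ℝ) (hc : 0 ≤ c) [Nonempty V]
    (hdeg : ∀ z : Fin h → V, Injective z → 1 / 2 - γ ≤ freq fun t => H.PairEdge z t)
    (P Q : (Fin h → V) → Prop) (hQ : freq Q ≤ 1 / 2 - γ + c) :
    freq (fun p : (Fin h → V) × (Fin h → V) => P p.1 ∧ Q p.2 ∧ ¬ H.PairEdge p.1 p.2) ≤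
      c + freq (fun z : Fin h → V => ¬ Injective z) +
        freq (fun p : (Fin h → V) × (Fin h → V) => P p.1 ∧ ¬ Q p.2 ∧ H.PairEdge p.1 p.2) := by
  have hpos : (0 : ℝ) < Fintype.card (Fin h → V) := by exact_mod_cast Fintype.card_pos
  have hcsum : c = (∑ _s : Fin h → V, c) / Fintype.card (Fin h → V) := by
    rw [sum_const, card_univ, nsmul_eq_mul]; field_simp
  rw [freq_prod, freq_prod (fun p : (Fin h → V) × (Fin h → V) =>
    P p.1 ∧ ¬ Q p.2 ∧ H.PairEdge p.1 p.2), freq_eq_sum (fun z : Fin h → V => ¬ Injective z)]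
  nth_rewrite 1 [hcsum]
  rw [← add_div, ← add_div, ← sum_add_distrib, ← sum_add_distrib]
  gcongr with s
  have h0 := freq_nonneg fun t => P s ∧ ¬ Q t ∧ H.PairEdge s t
  by_cases hP : P s
  · by_cases hs : Injective s
    · have h1 := hdeg s hs
      have h2 : (freq fun t => H.PairEdge s t) ≤
          freq (fun t => Q t ∧ H.PairEdge s t) + freq fun t => P s ∧ ¬ Q t ∧ H.PairEdge s t :=
        freq_le_add fun t ht => by tauto
      have h3 := freq_or_of_disjoint (fun t => P s ∧ Q t ∧ ¬ H.PairEdge s t)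
        (fun t => Q t ∧ H.PairEdge s t) (fun t ht ht' => ht.2.2 ht'.2)
      have h4 : freq (fun t => (P s ∧ Q t ∧ ¬ H.PairEdge s t) ∨ (Q t ∧ H.PairEdge s t)) ≤ freq Q :=
        freq_mono fun t ht => by tauto
      simp only [hs, not_true_eq_false, if_false]
      linarith
    · simp only [hs, not_false_eq_true, if_true]
      linarith [freq_le_one fun t => P s ∧ Q t ∧ ¬ H.PairEdge s t]
  · have h1 : (freq fun t => P s ∧ Q t ∧ ¬ H.PairEdge s t) = 0 := by
      simp only [hP, false_and]; exact freq_false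
    dsimp only
    split_ifs <;> linarith

theorem KGraph.freq_pairEdge_swap (H : KGraph V (h + h)) (P Q : (Fin h → V) → Prop)
    (f : Prop → Prop) :
    freq (fun p : (Fin h → V) × (Fin h → V) => P p.1 ∧ Q p.2 ∧ f (H.PairEdge p.1 p.2)) =
      freq (fun p : (Fin h → V) × (Fin h → V) => Q p.1 ∧ P p.2 ∧ f (H.PairEdge p.1 p.2)) := by
  rw [← freq_swap]
  refine freq_congr fun p => ?_
  rw [propext (H.pairEdge_comm p.2 p.1)]
  tauto

end Nonextremal

theorem indicator_zmod_add_eq_zero_iff (p q : Prop) :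
    ((if p then 1 else 0 : ZMod 2) + (if q then 1 else 0) = 0) ↔ (p ↔ q) := by
  by_cases hp : p <;> by_cases hq : q <;> simp [hp, hq]
  decide

theorem indicator_zmod_add_eq_one_iff (p q : Prop) :
    ((if p then 1 else 0 : ZMod 2) + (if q then 1 else 0) = 1) ↔ ¬ (p ↔ q) := by
  by_cases hp : p <;> by_cases hq : q <;> simp [hp, hq]

theorem freq_not_iff_iff_le {α : Type*} [Fintype α] (X : α → Prop) (E : α → α → Prop) :
    freq (fun p : α × α => ¬ (E p.1 p.2 ↔ (X p.1 ↔ X p.2))) ≤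
      freq (fun p : α × α => X p.1 ∧ X p.2 ∧ ¬ E p.1 p.2) +
      freq (fun p : α × α => ¬ X p.1 ∧ ¬ X p.2 ∧ ¬ E p.1 p.2) +
      (freq (fun p : α × α => X p.1 ∧ ¬ X p.2 ∧ E p.1 p.2) +
      freq (fun p : α × α => ¬ X p.1 ∧ X p.2 ∧ E p.1 p.2)) := by
  refine le_trans (freq_le_add fun p hp => ?_) (add_le_add (freq_le_add fun p hp => hp)
    (freq_le_add fun p hp => hp))
  tauto

theorem freq_not_iff_and_le {α : Type*} [Fintype α] (X : α → Prop) (E : α → α → Prop) :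
    freq (fun p : α × α => ¬ (X p.1 ↔ X p.2) ∧ ¬ E p.1 p.2) ≤
      freq (fun p : α × α => X p.1 ∧ ¬ X p.2 ∧ ¬ E p.1 p.2) +
      freq (fun p : α × α => ¬ X p.1 ∧ X p.2 ∧ ¬ E p.1 p.2) :=
  freq_le_add fun p hp => by tauto

theorem freq_not_iff_not_iff_le {α : Type*} [Fintype α] (X : α → Prop) (E : α → α → Prop) :
    freq (fun p : α × α => ¬ (E p.1 p.2 ↔ ¬ (X p.1 ↔ X p.2))) ≤
      freq (fun p : α × α => ¬ (X p.1 ↔ X p.2) ∧ ¬ E p.1 p.2) +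
      (freq (fun p : α × α => X p.1 ∧ X p.2 ∧ E p.1 p.2) +
      freq (fun p : α × α => ¬ X p.1 ∧ ¬ X p.2 ∧ E p.1 p.2)) := by
  refine le_trans (freq_le_add fun p hp => ?_) (add_le_add_right (freq_le_add fun p hp => hp) _)
  tauto

/-- A hypergraph with minimum degree slightly below one half of the maximum possible and without a
Hamilton cycle is close to one of the two parity constructions. -/
theorem KGraph.hasHamiltonCycle_of_not_isClose (h : ℕ) (hh : 2 ≤ h) (d : ℕ) (hd : h ≤ d)
    (hdk : d ≤ h + h) (ε : ℝ) (hε : 0 < ε) :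
    ∃ γ : ℝ, 0 < γ ∧ ∃ n₀ : ℕ, ∀ (V : Type*) [Fintype V] [DecidableEq V] (H : KGraph V (h + h)),
      n₀ ≤ Fintype.card V → h ∣ Fintype.card V →
      (∀ A : Finset V, IsBalanced A →
        ¬ H.IsClose ε (oddGraph (h + h) A) ∧ ¬ H.IsClose ε (evenGraph (h + h) A)) →
      (1 / 2 - γ) * ((Fintype.card V - d).choose (h + h - d) : ℝ) ≤ (H.minDegree d : ℝ) →
      H.HasHamiltonCycle h := by
  have hh0 : 0 < h := by omega
  obtain ⟨ξ, hξ, n₁, hcol⟩ := exists_isClose_of_coloring h hh0 ε hε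
  obtain ⟨δ₁, hδ₁, m₁, hbip⟩ := hasHamiltonCycle_of_nearly_bipartite h hh (ξ / 4) (by positivity)
  obtain ⟨δ, hδ, hδδ₁, hδξ⟩ : ∃ δ : ℝ, 0 < δ ∧ δ ≤ δ₁ ∧ 20 * δ ≤ ξ :=
    ⟨min δ₁ (ξ / 20), by positivity, min_le_left _ _, by linarith [min_le_right δ₁ (ξ / 20)]⟩
  obtain ⟨γ₁, hγ₁, m₂, hrob⟩ := hasHamiltonCycle_of_robust h hh0 δ hδ
  obtain ⟨γ, hγ, hγγ₁, hγδ, hγ2⟩ : ∃ γ : ℝ, 0 < γ ∧ 2 * γ ≤ γ₁ ∧ 2 * γ ≤ δ ∧ γ ≤ 1 / 2 := by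
    refine ⟨min (γ₁ / 2) (min (δ / 2) (1 / 2)), by positivity, ?_, ?_, ?_⟩
    · linarith [min_le_left (γ₁ / 2) (min (δ / 2) (1 / 2))]
    · linarith [min_le_right (γ₁ / 2) (min (δ / 2) (1 / 2)), min_le_left (δ / 2) (1 / 2 : ℝ)]
    · linarith [min_le_right (γ₁ / 2) (min (δ / 2) (1 / 2)), min_le_right (δ / 2) (1 / 2 : ℝ)]
  refine ⟨γ, hγ, n₁ + h * m₁ + h * m₂ + (h + h) + ⌈(h : ℝ) ^ 2 / γ⌉₊, ?_⟩
  intro V _ _ H hn hdvd hfar hmin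
  obtain ⟨m, hm⟩ := hdvd
  have hm1 : m₁ ≤ m := by
    refine Nat.le_of_mul_le_mul_left ?_ hh0
    rw [← hm]; omega
  have hm2 : m₂ ≤ m := by
    refine Nat.le_of_mul_le_mul_left ?_ hh0
    rw [← hm]; omega
  have hn1 : n₁ ≤ Fintype.card V := by omega
  have hn2 : h + h ≤ Fintype.card V := by omega
  have hnpos : (0 : ℝ) < Fintype.card V := by
    have : 0 < Fintype.card V := by omega
    exact_mod_cast this
  have hnγ : (h : ℝ) ^ 2 ≤ γ * Fintype.card V := by
    have h1 : (h : ℝ) ^ 2 / γ ≤ Fintype.card V := (Nat.le_ceil _).trans (by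
      have : ⌈(h : ℝ) ^ 2 / γ⌉₊ ≤ Fintype.card V := by omega
      exact_mod_cast this)
    rw [div_le_iff₀ hγ] at h1; linarith
  have : Nonempty V := Fintype.card_pos_iff.1 (by omega)
  obtain ⟨e⟩ : Nonempty (Fin m × Fin h ≃ V) := by
    rw [← Fintype.card_eq, Fintype.card_prod, Fintype.card_fin, Fintype.card_fin, hm, mul_comm]
  have hdeg : ∀ z : Fin h → V, Injective z → 1 / 2 - 2 * γ ≤ freq fun t => H.PairEdge z t :=
    fun z hz => H.le_freq_pairEdge hh0 hd hdk γ hγ hγ2 hnγ hn2 hmin z hz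
  have hν : freq (fun z : Fin h → V => ¬ Injective z) ≤ δ := by
    refine (freq_not_injective_le (κ := Fin h)).trans ?_
    rw [Fintype.card_fin, div_le_iff₀ hnpos]
    nlinarith
  have hcolor : ∀ (X : (Fin h → V) → Prop) (c : ZMod 2), 1 / 2 - δ ≤ freq X → freq X ≤ 1 / 2 + δ →
      ¬ freq (fun z : (Fin h → V) × (Fin h → V) => ¬ (H.PairEdge z.1 z.2 ↔
        (if X z.1 then 1 else 0 : ZMod 2) + (if X z.2 then 1 else 0) = c)) ≤ ξ := by
    intro X c h1 h2 h3
    obtain ⟨A, hA, hAc⟩ := hcol V H (fun s => if X s then 1 else 0) c hn1 h3 (by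
      have h4 : freq (fun s => (if X s then 1 else 0 : ZMod 2) = 1) = freq X :=
        freq_congr fun s => by by_cases hs : X s <;> simp [hs]
      rw [h4, abs_le]
      constructor <;> linarith)
    rcases hAc with hAc | hAc
    · exact (hfar A hA).1 hAc
    · exact (hfar A hA).2 hAc
  by_contra hno
  have hfail := fun h1 h2 => hno (hrob m hm2 V e H (fun z hz => by linarith [hdeg z hz]) h1 h2)
  by_cases hcase : ∀ z : Fin h → V, Injective z → (1 / 2 + δ ≤ freq fun t => H.PairEdge z t) ∨
      δ ≤ freq fun p : (Fin h → V) × (Fin h → V) =>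
        ¬ H.PairEdge z p.1 ∧ ¬ H.PairEdge z p.2 ∧ H.PairEdge p.1 p.2
  · replace hfail : ¬ ∀ z : Fin h → V, Injective z → (1 / 2 + δ ≤ freq fun t => H.PairEdge z t) ∨
        δ ≤ freq fun p : (Fin h → V) × (Fin h → V) =>
          H.PairEdge z p.1 ∧ ¬ H.PairEdge z p.2 ∧ H.PairEdge p.1 p.2 := hfail hcase
    push Not at hfail
    obtain ⟨z, hz, hz1, hz2⟩ := hfail
    set X : (Fin h → V) → Prop := fun t => H.PairEdge z t
    have hX1 := hdeg z hz
    have hnX := freq_not X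
    refine hcolor X 0 (by linarith) hz1.le ?_
    simp only [indicator_zmod_add_eq_zero_iff]
    have t1 := H.freq_not_pairEdge_le (2 * γ) (2 * γ + δ) (by positivity) hdeg X X (by linarith)
    have t2 := H.freq_not_pairEdge_le (2 * γ) (4 * γ) (by positivity) hdeg (fun t => ¬ X t)
      (fun t => ¬ X t) (by linarith)
    have t3 := H.freq_pairEdge_swap X (fun t => ¬ X t) id
    simp only [id, not_not] at t2 t3
    have t4 := freq_not_iff_iff_le X H.PairEdge
    linarith
  · push Not at hcase
    obtain ⟨z, hz, hz1, hz2⟩ := hcase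
    set X : (Fin h → V) → Prop := fun t => ¬ H.PairEdge z t
    have hX1 := hdeg z hz
    have hnX := freq_not fun t => H.PairEdge z t
    have hnX' := freq_not X
    change freq X = _ at hnX
    have t1 := H.freq_not_pairEdge_le (2 * γ) (2 * γ + δ) (by positivity) hdeg X (fun t => ¬ X t)
      (by linarith)
    have t2 := H.freq_pairEdge_swap X (fun t => ¬ X t) Not
    simp only [not_not] at t1
    change freq (fun p : (Fin h → V) × (Fin h → V) => X p.1 ∧ X p.2 ∧ H.PairEdge p.1 p.2) < δ at hz2
    clear_value X
    have hmiss : freq (fun p : (Fin h → V) × (Fin h → V) =>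
        (¬ (X p.1 ↔ X p.2)) ∧ ¬ H.PairEdge p.1 p.2) ≤ 8 * δ := by
      have t3 := freq_not_iff_and_le X H.PairEdge
      linarith
    by_cases hη : ξ / 4 ≤ freq (fun p : (Fin h → V) × (Fin h → V) =>
        ¬ X p.1 ∧ ¬ X p.2 ∧ H.PairEdge p.1 p.2)
    · exact hno (hbip m hm1 V e H X (fun s hs => by linarith [hdeg s hs]) (by linarith)
        (by linarith) (by linarith) hη)
    · push Not at hη
      refine hcolor X 1 (by linarith) (by linarith) ?_
      simp only [indicator_zmod_add_eq_one_iff]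
      have t4 := freq_not_iff_not_iff_le X H.PairEdge
      linarith

end Development

theorem theorem1p5 (k : ℕ) (hk : 4 ≤ k) (hk_even : Even k) (d : ℕ) (hd : k / 2 ≤ d)
    (hd' : d ≤ k - 1) (ε : ℝ) (hε : 0 < ε) :
    ∃ γ : ℝ, 0 < γ ∧ ∃ n₀ : ℕ,
      ∀ (V : Type*) [Fintype V] [DecidableEq V] (H : KGraph V k),
        n₀ ≤ Fintype.card V →
        k / 2 ∣ Fintype.card V →
        (∀ A : Finset V, KGraph.IsBalanced A →
          ¬ H.IsClose ε (KGraph.oddGraph k A) ∧ ¬ H.IsClose ε (KGraph.evenGraph k A)) →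
        (1 / 2 - γ) * ((Fintype.card V - d).choose (k - d) : ℝ) ≤ (H.minDegree d : ℝ) →
        H.HasHamiltonCycle (k / 2) := by
  obtain ⟨h, rfl⟩ := hk_even
  have hh : (h + h) / 2 = h := by omega
  rw [hh] at hd ⊢
  exact KGraph.hasHamiltonCycle_of_not_isClose h (by omega) d hd (by omega) ε hε
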